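/- **Lemma 2.5 (bilinear Strichartz estimate).** Let $n\ge 2$. A pair $(q,r)$ is Schrödinger-admissible if $2\le q,r\le\infty$ and $\frac2q+\frac nr=\frac n2$; $p'$ denotes the dual exponent of $p$. The operator $|\nabla|^s$ is defined by $\widehat{|\nabla|^sf}(\xi)=|\xi|^s\hat f(\xi)$ for tempered distributions $f$ such that $\hat f$ is a function, and $\|f\|_{\dot H^s_x}=\||\nabla|^sf\|_{L^2_x}$; a norm is $\infty$ if the function whose norm it is does not exist. Let $0<\delta<\frac n2$ and $q_0>2$. There is a constant $C$, depending only on $n$, $\delta$ and $q_0$, such that the following holds. Let $(q,r)$ and $(\tilde q,\tilde r)$ be Schrödinger-admissible pairs with $q,\tilde q\ge q_0$, let $I\subseteq\mathbb R$ be an interval, let $t_0\in I$, and let $u,v:I\times\mathbb R^n\to\mathbb C$ be measurable functions that are, at almost every time, the values of time-dependent tempered distributions (denoted by the same letters, defined at every time in $I$). Then $$ \begin{aligned} \|uv\|_{L^2_{t,x}(I\times\mathbb R^n)}\le C\,&\Bigl(\|u(t_0)\|_{\dot H_x^{-\frac12+\delta}}+\bigl\||\nabla|^{-\frac12+\delta}(i\partial_t+\Delta)u\bigr\|_{L^{q'}_tL^{r'}_x(I\times\mathbb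 R^n)}\Bigr)\\ \times&\Bigl(\|v(t_0)\|_{\dot H_x^{\frac{n-1}2-\delta}}+\bigl\||\nabla|^{\frac{n-1}2-\delta}(i\partial_t+\Delta)v\bigr\|_{L^{\tilde q'}_tL^{\tilde r'}_x(I\times\mathbb R^n)}\Bigr), \end{aligned} $$ with the convention $0\cdot\infty=0$ on the right-hand side. Here $(i\partial_t+\Delta)u=F$ is understood weakly: for every Schwartz function $\varphi$ on $\mathbb R^n$ and all $a,b\in I$, the functions $s\mapsto\langle\Delta u(s),\varphi\rangle$ and $s\mapsto\langle F(s),\varphi\rangle$ are integrable between $a$ and $b$, and $$ i\langle u(b)-u(a),\varphi\rangle+\int_a^b\langle\Delta u(s),\varphi\rangle\,ds=\int_a^b\langle F(s),\varphi\rangle\,ds . $$ In particular, the estimate holds for all Schrödinger-admissible pairs with $q,\tilde q>2$. -/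

import Mathlib

open MeasureTheory Set
open scoped SchwartzMap FourierTransform Laplacian ENNReal NNReal

noncomputable section

namespace BilinearStrichartz

/-- The Euclidean space `ℝⁿ`. -/
abbrev Space (n : ℕ) : Type := EuclideanSpace ℝ (Fin n)

/-- The tempered distribution `T` is the function `f`: every pairing `⟨T, φ⟩` is the absolutely
convergent integral `∫ φ f`. -/
def RepresentedBy {n : ℕ} (T : 𝓢'(Space n, ℂ)) (f : Space n → ℂ) : Prop :=
  ∀ φ : 𝓢(Space n, ℂ),
    Integrable (fun x => φ x * f x) volume ∧ T φ = ∫ x, φ x * f x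

/-- `g = |∇|^s T`, where `|∇|^s` multiplies the Fourier transform by `|ξ|^s`. The Fourier transform
of `T` has to be a function `a`, and `g` is the function whose Fourier transform is `|ξ|^s a(ξ)`.
Mathlib's Fourier transform has the kernel `exp (-2πi x·ξ)`. -/
def IsFracDeriv {n : ℕ} (s : ℝ) (T : 𝓢'(Space n, ℂ)) (g : Space n → ℂ) : Prop :=
  ∃ (a : Space n → ℂ) (S : 𝓢'(Space n, ℂ)),
    RepresentedBy (𝓕 T) a ∧ RepresentedBy S g ∧
      RepresentedBy (𝓕 S) (fun ξ => ((‖ξ‖ ^ s : ℝ) : ℂ) * a ξ)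

/-- The homogeneous Sobolev norm `‖T‖_{Ḣ^s} = ‖|∇|^s T‖_{L²}`. The function `|∇|^s T` is unique up
to null sets; the infimum is its `L²` norm if it exists, and `∞` if it does not. -/
def sobolevNorm {n : ℕ} (s : ℝ) (T : 𝓢'(Space n, ℂ)) : ℝ≥0∞ :=
  ⨅ (g : Space n → ℂ) (_ : IsFracDeriv s T g), eLpNorm g 2 volume

/-- The norm of `L^q_t L^r_x (I × ℝⁿ)`. -/
def mixedNorm {n : ℕ} (I : Set ℝ) (q r : ℝ≥0∞) (h : ℝ → Space n → ℂ) : ℝ≥0∞ :=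
  eLpNorm (fun t => eLpNorm (h t) r volume) q (volume.restrict I)

/-- `(i∂_t + Δ) U = F` on `I × ℝⁿ`, tested against Schwartz functions of `x` and integrated in
time. In particular `t ↦ ⟨U t, φ⟩` is continuous on `I`, so that the values `U t` at single times
are meaningful. -/
def SolvesForced {n : ℕ} (I : Set ℝ) (U F : ℝ → 𝓢'(Space n, ℂ)) : Prop :=
  ∀ φ : 𝓢(Space n, ℂ), ∀ a ∈ I, ∀ b ∈ I,
    IntervalIntegrable (fun s => (Δ (U s)) φ) volume a b ∧
    IntervalIntegrable (fun s => F s φ) volume a b ∧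
    Complex.I * (U b φ - U a φ) + ∫ s in a..b, (Δ (U s)) φ = ∫ s in a..b, F s φ

/-- The norm `‖|∇|^s (i∂_t + Δ) U‖_{L^q_t L^r_x (I × ℝⁿ)}`. The space-time function
`H = |∇|^s (i∂_t + Δ) U` is unique up to null sets; the infimum is its norm if it exists, and `∞`
if it does not. -/
def forcingNorm {n : ℕ} (I : Set ℝ) (s : ℝ) (q r : ℝ≥0∞) (U : ℝ → 𝓢'(Space n, ℂ)) : ℝ≥0∞ :=
  ⨅ (F : ℝ → 𝓢'(Space n, ℂ)) (H : ℝ → Space n → ℂ)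
    (_ : SolvesForced I U F)
    (_ : AEStronglyMeasurable (Function.uncurry H) ((volume.restrict I).prod volume))
    (_ : ∀ᵐ t ∂volume.restrict I, IsFracDeriv s (F t) (H t)), mixedNorm I q r H

/-- `u` is a measurable function on the slab `I × ℝⁿ` and `U t` is the tempered distribution
`u(t, ·)` for almost every `t`. (For rough data `U t` need not be a function at every time.) -/
structure IsSlabFunction {n : ℕ} (I : Set ℝ) (U : ℝ → 𝓢'(Space n, ℂ))
    (u : ℝ → Space n → ℂ) : Prop where
  aestronglyMeasurable :
    AEStronglyMeasurable (Function.uncurry u) ((volume.restrict I).prod volume)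
  represented : ∀ᵐ t ∂volume.restrict I, RepresentedBy (U t) (u t)

/-- Schrödinger-admissible pairs of exponents in dimension `n`. -/
def Admissible (n : ℕ) (q r : ℝ≥0∞) : Prop :=
  2 ≤ q ∧ 2 ≤ r ∧ 2 / q + (n : ℝ≥0∞) / r = (n : ℝ≥0∞) / 2

end BilinearStrichartz

end

noncomputable section

namespace BilinearStrichartz

/-! ### Plancherel and the Hausdorff–Young inequality -/

section Fourier

variable {E : Type*} [NormedAddCommGroup E] [InnerProductSpace ℝ E] [FiniteDimensional ℝ E]
  [MeasurableSpace E] [BorelSpace E]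

/-! The estimate is first proved for a product of two free waves and then transferred to forced
solutions by dominating each solution, at all times at once, by a square-summable family of free
waves.

Free waves (`bilinear_freeWave`). By duality the product is paired with a function `F`. Fubini turns
the pairing into the integral of `f η * g ζ` against the space-time Fourier transform of `F` at
spatial frequency `η + ζ` and temporal frequency `-(2π(|η|² + |ζ|²))`. Cauchy–Schwarz with the
weights `|η|^α |ζ|^β` leaves a weighted integral over these resonant frequencies
(`lintegral_resonance_le`). In coordinates centred at `(η + ζ)/2`, with `α + β = 2 - n`, the radial
power is exactly the one needed to change variables from radius to temporal frequency. What remains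
is the integral of `|a + θ|^α |a - θ|^β` over the unit sphere, which must be bounded uniformly in
`a` (`exists_lintegral_sphere_mul_le`). This requires `α, β > -(n - 1)`. For `α = 1 - 2δ` and `β =
-(n - 1) + 2δ` this says `0 < δ < n/2`.

Transfer (`exists_freeWave_atoms`). Let `Φ t ψ` be the pairing of `𝓕 (U t)` with `evol t * ψ`. The
free evolution cancels, so `Φ` moves only because of the forcing. Duhamel's formula, Hölder and the
homogeneous Strichartz estimate bound `Φ b - Φ a`, as a functional in the weighted `L²` norm of `ψ`,
by the `L^{q'} L^{r'}` norm of the forcing on `[a, b]`. Thus `Φ` is a path of finite `q'`-variation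
with `q' < 2`. Dyadic chaining (`exists_atoms`) writes such a path as a sum of increments, with
about `2^k` possible values of size `2^{-kκ}` at level `k`. Since `κ > 1/2`, suitably weighted
increments form a square-summable family `p i` with `|L (Φ t)|² ≤ ∑ |L (p i)|²` for every continuous
linear functional `L`. Each `p i` is the frequency profile of a free wave.

Conclusion (`lintegral_mul_sq_le_of_atoms`). Testing against translates of a mollifier bounds the
mollified `|u|²` and `|v|²` by sums of squared free waves. The bilinear estimate is summed over all
pairs, and Fatou's lemma removes the mollifier. A factor equal to zero on the right-hand side is
treated apart: then the corresponding solution vanishes, which settles the product `0 · ∞`.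

The constant does not depend on the pairs because Strichartz is interpolated between one fixed pair
and the energy bound (`strichartz`), and because `κ = 1 - 1/q₀` serves all `q ≥ q₀`. Strichartz
itself comes from Hausdorff–Young (`hausdorffYoung`), the dispersive estimate (`dispersive`),
Hardy–Littlewood–Sobolev in time and the `T T*` argument (`dualStrichartz`). -/

theorem continuous_fourier {f : E → ℂ} (hf : Integrable f) : Continuous (𝓕 f) :=
  VectorFourier.fourierIntegral_continuous Real.continuous_fourierChar
    (by simpa using continuous_inner) hf

theorem norm_fourier_le (f : E → ℂ) (x : E) : ‖𝓕 f x‖ ≤ ∫ y, ‖f y‖ :=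
  VectorFourier.norm_fourierIntegral_le_integral_norm _ _ _ _ _

theorem integral_mul_fourier {f g : E → ℂ} (hf : Integrable f) (hg : Integrable g) :
    ∫ x, 𝓕 f x * g x = ∫ x, f x * 𝓕 g x := by
  have := VectorFourier.integral_fourierIntegral_smul_eq_flip (μ := volume) (ν := volume)
    (L := innerₗ E) (f := f) (g := g) Real.continuous_fourierChar
    (by simpa using continuous_inner) hf hg
  simp only [flip_innerₗ, smul_eq_mul] at this
  exact this

/-- Plancherel's theorem for functions in `L¹ ∩ L²`. -/
theorem eLpNorm_fourier_two {f : E → ℂ} (hf : Integrable f) (h2 : MemLp f 2) :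
    eLpNorm (𝓕 f) 2 = eLpNorm f 2 := by
  set g : Lp ℂ 2 (volume : Measure E) := h2.toLp f
  -- The Fourier integral and the `L²` Fourier transform define the same distribution; testing both
  -- against smooth compactly supported functions identifies them, and Plancherel in `L²` applies.
  have hae : 𝓕 f =ᵐ[volume] ((𝓕 g : Lp ℂ 2 (volume : Measure E)) : E → ℂ) := by
    refine ae_eq_of_integral_contDiff_smul_eq (continuous_fourier hf).locallyIntegrable
      ((Lp.memLp _).locallyIntegrable (by norm_num)) fun φ hφ hφc => ?_
    have h₁ : HasCompactSupport (Complex.ofRealCLM ∘ φ) := hφc.comp_left rfl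
    have h₂ : ContDiff ℝ _ (Complex.ofRealCLM ∘ φ) := Complex.ofRealCLM.contDiff.comp hφ
    set Φ : 𝓢(E, ℂ) := h₁.toSchwartzMap h₂
    have hΦ : ∀ x, Φ x = (φ x : ℂ) := fun x => rfl
    have key := congrArg (fun T : 𝓢'(E, ℂ) => T Φ) (Lp.fourier_toTemperedDistribution_eq g)
    simp only [TemperedDistribution.fourier_apply, Lp.toTemperedDistribution_apply] at key
    have e1 : ∫ x, (𝓕 Φ) x • g x = ∫ x, 𝓕 (Φ : E → ℂ) x * f x := by
      refine integral_congr_ae ?_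
      filter_upwards [h2.coeFn_toLp] with x hx
      rw [hx, SchwartzMap.fourier_coe, smul_eq_mul]
    rw [e1, integral_mul_fourier Φ.integrable hf] at key
    simpa [hΦ] using key
  rw [eLpNorm_congr_ae hae, ← eLpNorm_congr_ae h2.coeFn_toLp, ← ENNReal.toReal_eq_toReal_iff'
    (Lp.eLpNorm_ne_top _) (Lp.eLpNorm_ne_top _)]
  exact Lp.norm_fourier_eq g

theorem eLpNorm_two_sq {α : Type*} [MeasurableSpace α] {μ : Measure α} (f : α → ℂ) :
    eLpNorm f 2 μ ^ 2 = ∫⁻ x, ‖f x‖ₑ ^ 2 ∂μ := by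
  have h := eLpNorm_nnreal_pow_eq_lintegral (μ := μ) (f := f) (p := 2) (by norm_num)
  norm_num at h
  exact_mod_cast h

theorem lintegral_fourier_sq_le {f : E → ℂ} (hf : Integrable f) :
    ∫⁻ x, ‖𝓕 f x‖ₑ ^ 2 ≤ ∫⁻ x, ‖f x‖ₑ ^ 2 := by
  rw [← eLpNorm_two_sq, ← eLpNorm_two_sq]
  by_cases h : eLpNorm f 2 = ∞
  · simp [h]
  · rw [eLpNorm_fourier_two hf ⟨hf.1, lt_top_iff_ne_top.2 h⟩]

theorem lintegral_Ioc_rpow {b s : ℝ} (hb : 0 ≤ b) (hs : -1 < s) :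
    ∫⁻ t in Ioc 0 b, ENNReal.ofReal (t ^ s) = ENNReal.ofReal (b ^ (s + 1) / (s + 1)) := by
  rw [← ofReal_integral_eq_lintegral_ofReal]
  · rw [← intervalIntegral.integral_of_le hb, integral_rpow (Or.inl hs)]
    rw [Real.zero_rpow (by linarith), sub_zero]
  · exact (intervalIntegrable_iff_integrableOn_Ioc_of_le hb).1
      (intervalIntegral.intervalIntegrable_rpow' hs)
  · filter_upwards [ae_restrict_mem measurableSet_Ioc] with t ht
    exact Real.rpow_nonneg ht.1.le _

/-- Marcinkiewicz splitting at a height that depends on `α`. Where `α * |f|^(p-1) > 2A`, one has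
`|f| ≤ α/(2A) * |f|^p`, so this part of `f` has `L¹` norm at most `α/2` and its transform never
exceeds `α/2`. Where `|𝓕 f| > α`, the transform of the remaining part is thus at least `α/2`, and
Chebyshev with Plancherel gives the bound; the `4` is the square of that `2`. -/
theorem hausdorffYoung_distribution {f : E → ℂ} (hf : Integrable f) {p A α : ℝ} (hp : 1 < p)
    (hA : 0 < A) (hfA : ∫⁻ y, ENNReal.ofReal (‖f y‖ ^ p) = ENNReal.ofReal A) (hα : 0 < α) :
    volume {x | α < ‖𝓕 f x‖} * ENNReal.ofReal (α ^ 2) ≤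
      4 * ∫⁻ y, {y | α * ‖f y‖ ^ (p - 1) ≤ 2 * A}.indicator (fun y => ‖f y‖ₑ ^ 2) y := by
  have hfm := hf.1
  obtain ⟨g, hg, hfg⟩ : ∃ g : E → ℂ, Measurable g ∧ f =ᵐ[volume] g :=
    ⟨hfm.mk f, hfm.stronglyMeasurable_mk.measurable, hfm.ae_eq_mk⟩
  have hgi : Integrable g := hf.congr hfg
  have hF : 𝓕 f = 𝓕 g := funext fun x => Real.fourier_congr_ae hfg x
  have hgA : ∫⁻ y, ENNReal.ofReal (‖g y‖ ^ p) = ENNReal.ofReal A := by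
    rw [← hfA]; refine lintegral_congr_ae ?_
    filter_upwards [hfg] with y hy; rw [hy]
  have hR : ∫⁻ y, {y | α * ‖f y‖ ^ (p - 1) ≤ 2 * A}.indicator (fun y => ‖f y‖ₑ ^ 2) y =
      ∫⁻ y, {y | α * ‖g y‖ ^ (p - 1) ≤ 2 * A}.indicator (fun y => ‖g y‖ₑ ^ 2) y := by
    refine lintegral_congr_ae ?_
    filter_upwards [hfg] with y hy
    simp only [indicator, mem_ofPred_eq, hy]
  rw [hF, hR]
  set L : Set E := {y | α * ‖g y‖ ^ (p - 1) ≤ 2 * A}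
  have hL : MeasurableSet L :=
    measurableSet_le (measurable_const.mul (hg.norm.pow_const _)) measurable_const
  have hlow : Integrable (L.indicator g) := hgi.indicator hL
  have hhigh : Integrable (Lᶜ.indicator g) := hgi.indicator hL.compl
  have hpA : Integrable (fun y => ‖g y‖ ^ p) := by
    refine ⟨(hg.norm.pow_const _).aestronglyMeasurable, ?_⟩
    rw [hasFiniteIntegral_iff_ofReal (by filter_upwards with y; positivity), hgA]
    exact ENNReal.ofReal_lt_top
  have hint : ∫ y, ‖g y‖ ^ p = A := by
    rw [integral_eq_lintegral_of_nonneg_ae (by filter_upwards with y; positivity)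
      hpA.1, hgA, ENNReal.toReal_ofReal hA.le]
  have hsmall : ∫ y, ‖Lᶜ.indicator g y‖ ≤ α / 2 := by
    have : ∀ y, ‖Lᶜ.indicator g y‖ ≤ α / (2 * A) * ‖g y‖ ^ p := by
      intro y
      by_cases hy : y ∈ L
      · simp [hy]; positivity
      · rw [indicator_of_mem (by exact hy)]
        have h1 : 2 * A < α * ‖g y‖ ^ (p - 1) := not_le.1 hy
        have h2 : ‖g y‖ ^ p = ‖g y‖ ^ (p - 1) * ‖g y‖ := by
          rw [← Real.rpow_add_one' (norm_nonneg _) (by linarith)]; congr 1; ring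
        rw [h2, div_mul_eq_mul_div, le_div_iff₀ (by positivity)]
        nlinarith [norm_nonneg (g y)]
    calc ∫ y, ‖Lᶜ.indicator g y‖ ≤ ∫ y, α / (2 * A) * ‖g y‖ ^ p :=
          integral_mono hhigh.norm (hpA.const_mul _) this
      _ = α / 2 := by rw [integral_const_mul, hint]; field_simp
  have hsub : {x | α < ‖𝓕 g x‖} ⊆ {x | ENNReal.ofReal (α ^ 2) / 4 ≤ ‖𝓕 (L.indicator g) x‖ₑ ^ 2} := by
    intro x hx
    have hsum : 𝓕 g x = 𝓕 (L.indicator g) x + 𝓕 (Lᶜ.indicator g) x := by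
      have h := indicator_self_add_compl L g
      have h' := congrFun (VectorFourier.fourierIntegral_add (e := Real.fourierChar) (μ := volume)
        (L := innerₗ E) Real.continuous_fourierChar (by simpa using continuous_inner) hlow hhigh) x
      rw [h] at h'
      exact h'
    have h1 : ‖𝓕 (Lᶜ.indicator g) x‖ ≤ α / 2 := (norm_fourier_le _ _).trans hsmall
    have h2 : α / 2 ≤ ‖𝓕 (L.indicator g) x‖ := by
      have := norm_add_le (𝓕 (L.indicator g) x) (𝓕 (Lᶜ.indicator g) x)
      rw [← hsum] at this
      have hx' : α < ‖𝓕 g x‖ := hx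
      linarith
    have h3 : ENNReal.ofReal (α ^ 2) / 4 = ENNReal.ofReal ((α / 2) ^ 2) := by
      rw [div_pow, ENNReal.ofReal_div_of_pos (by norm_num)]; norm_num
    rw [mem_ofPred_eq, h3, ← ofReal_norm, ← ENNReal.ofReal_pow (norm_nonneg _)]
    gcongr
  have hcheb := mul_meas_ge_le_lintegral₀ (μ := volume)
    (f := fun x => ‖𝓕 (L.indicator g) x‖ₑ ^ 2)
    ((continuous_fourier hlow).enorm.measurable.pow_const 2).aemeasurable (ENNReal.ofReal (α ^ 2) / 4)
  calc volume {x | α < ‖𝓕 g x‖} * ENNReal.ofReal (α ^ 2)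
      = 4 * (ENNReal.ofReal (α ^ 2) / 4 * volume {x | α < ‖𝓕 g x‖}) := by
        rw [← mul_assoc, ENNReal.mul_div_cancel (by norm_num) (by norm_num), mul_comm]
    _ ≤ 4 * (ENNReal.ofReal (α ^ 2) / 4 *
          volume {x | ENNReal.ofReal (α ^ 2) / 4 ≤ ‖𝓕 (L.indicator g) x‖ₑ ^ 2}) := by gcongr
    _ ≤ 4 * ∫⁻ x, ‖𝓕 (L.indicator g) x‖ₑ ^ 2 := by gcongr
    _ ≤ 4 * ∫⁻ x, ‖L.indicator g x‖ₑ ^ 2 := mul_le_mul_right (lintegral_fourier_sq_le hlow) _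
    _ = _ := by
        congr 1; refine lintegral_congr fun y => ?_
        by_cases hy : y ∈ L <;> simp [hy]

/-- The Hausdorff–Young inequality for `2 < r < ∞`, without the sharp constant. -/
theorem hausdorffYoung {r p : ℝ} (hr : 2 < r) (hp : 1 < p) (hpr : (p - 1) * (r - 1) = 1) :
    ∃ C : ℝ≥0, ∀ f : E → ℂ, Integrable f →
      ∫⁻ x, ‖𝓕 f x‖ₑ ^ r ≤ C * (∫⁻ x, ‖f x‖ₑ ^ p) ^ (r - 1) := by
  have hr2 : 0 < r - 2 := by linarith
  have hCpos : 0 < r * 4 * 2 ^ (r - 2) / (r - 2) := by positivity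
  -- `r` is the layer-cake factor, `4` comes from `hausdorffYoung_distribution`, and `2^(r-2)/(r-2)`
  -- from integrating `α^(r-3)` up to the cut `2A/|f|^(p-1)`.
  refine ⟨Real.toNNReal (r * 4 * 2 ^ (r - 2) / (r - 2)), fun f hf => ?_⟩
  have hconv : ∀ s : ℝ, 0 < s → ∀ z : ℂ, ‖z‖ₑ ^ s = ENNReal.ofReal (‖z‖ ^ s) := fun s hs z => by
    rw [← ofReal_norm, ENNReal.ofReal_rpow_of_nonneg (norm_nonneg _) hs.le]
  obtain hA0 | hA0 := eq_or_ne (∫⁻ x, ‖f x‖ₑ ^ p) 0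
  · have hz : f =ᵐ[volume] 0 := by
      rw [lintegral_eq_zero_iff' (hf.1.enorm.pow_const _)] at hA0
      filter_upwards [hA0] with x hx
      simpa [ENNReal.rpow_eq_zero_iff, (zero_lt_one.trans hp)] using hx
    have : ∀ x, 𝓕 f x = 0 := fun x => by
      rw [Real.fourier_congr_ae hz x, Real.fourier_eq]; simp
    simp [this, ENNReal.zero_rpow_of_pos (show 0 < r by linarith)]
  obtain hAt | hAt := eq_or_ne (∫⁻ x, ‖f x‖ₑ ^ p) ∞
  · rw [hAt, ENNReal.top_rpow_of_pos (by linarith), ENNReal.mul_top]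
    · exact le_top
    · simpa using hCpos
  set A : ℝ := (∫⁻ x, ‖f x‖ₑ ^ p).toReal
  have hA : 0 < A := ENNReal.toReal_pos hA0 hAt
  have hAe : ∫⁻ x, ‖f x‖ₑ ^ p = ENNReal.ofReal A := (ENNReal.ofReal_toReal hAt).symm
  have hfA : ∫⁻ y, ENNReal.ofReal (‖f y‖ ^ p) = ENNReal.ofReal A := by
    rw [← hAe]; exact lintegral_congr fun y => (hconv p (by linarith) _).symm
  obtain ⟨g, hg, hfg⟩ : ∃ g : E → ℂ, Measurable g ∧ f =ᵐ[volume] g :=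
    ⟨hf.1.mk f, hf.1.stronglyMeasurable_mk.measurable, hf.1.ae_eq_mk⟩
  have hgA : ∫⁻ y, ENNReal.ofReal (‖g y‖ ^ p) = ENNReal.ofReal A := by
    rw [← hfA]; refine lintegral_congr_ae ?_
    filter_upwards [hfg] with y hy; rw [hy]
  have hgi : Integrable g := hf.congr hfg
  have hF : 𝓕 f = 𝓕 g := funext fun x => Real.fourier_congr_ae hfg x
  rw [hF, hAe]
  -- At a fixed `y` the levels `α` run up to `2A/|g y|^(p-1)`. The duality relation gives `2 -
  -- (p-1)(r-2) = p`, so exactly `|g y|^p` is left.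
  have hslice : ∀ y, ∫⁻ α in Ioi (0 : ℝ), ENNReal.ofReal (α ^ (r - 3)) *
      {y | α * ‖g y‖ ^ (p - 1) ≤ 2 * A}.indicator (fun y => ‖g y‖ₑ ^ 2) y ≤
      ENNReal.ofReal ((2 * A) ^ (r - 2) / (r - 2)) * ENNReal.ofReal (‖g y‖ ^ p) := by
    intro y
    obtain h0 | h0 := eq_or_ne (g y) 0
    · simp only [indicator, h0]; simp
    have hy : 0 < ‖g y‖ := norm_pos_iff.2 h0
    have hb : 0 ≤ 2 * A / ‖g y‖ ^ (p - 1) := by positivity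
    calc ∫⁻ α in Ioi (0 : ℝ), ENNReal.ofReal (α ^ (r - 3)) *
          {y | α * ‖g y‖ ^ (p - 1) ≤ 2 * A}.indicator (fun y => ‖g y‖ₑ ^ 2) y
        = ∫⁻ α in Ioi (0 : ℝ), (Iic (2 * A / ‖g y‖ ^ (p - 1))).indicator
            (fun α => ENNReal.ofReal (α ^ (r - 3)) * ‖g y‖ₑ ^ 2) α := by
          refine lintegral_congr fun α => ?_
          simp only [indicator, mem_ofPred_eq, mem_Iic, le_div_iff₀ (Real.rpow_pos_of_pos hy _)]
          split_ifs <;> simp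
      _ = ∫⁻ α in Ioc 0 (2 * A / ‖g y‖ ^ (p - 1)), ENNReal.ofReal (α ^ (r - 3)) * ‖g y‖ₑ ^ 2 := by
          rw [lintegral_indicator measurableSet_Iic, Measure.restrict_restrict measurableSet_Iic]
          congr 2; ext; simp [and_comm]
      _ = ENNReal.ofReal ((2 * A / ‖g y‖ ^ (p - 1)) ^ (r - 2) / (r - 2)) * ‖g y‖ₑ ^ 2 := by
          rw [lintegral_mul_const _ (by fun_prop), lintegral_Ioc_rpow hb (by linarith),
            show r - 3 + 1 = r - 2 by ring]
      _ = ENNReal.ofReal ((2 * A) ^ (r - 2) / (r - 2)) * ENNReal.ofReal (‖g y‖ ^ p) := by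
          rw [← ofReal_norm, ← ENNReal.ofReal_pow hy.le, ← ENNReal.ofReal_mul (by positivity),
            ← ENNReal.ofReal_mul (by positivity)]
          congr 1
          rw [Real.div_rpow (by positivity) (by positivity), ← Real.rpow_mul hy.le]
          have e : ‖g y‖ ^ p * ‖g y‖ ^ ((p - 1) * (r - 2)) = ‖g y‖ ^ 2 := by
            rw [← Real.rpow_add hy, ← Real.rpow_natCast]
            congr 1; push_cast; linarith
          have : ‖g y‖ ^ ((p - 1) * (r - 2)) ≠ 0 := (Real.rpow_pos_of_pos hy _).ne'
          rw [← e]; field_simp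
      _ ≤ _ := le_rfl
  have hmeas : Measurable (Function.uncurry fun (α : ℝ) (y : E) => ENNReal.ofReal (α ^ (r - 3)) *
      {y | α * ‖g y‖ ^ (p - 1) ≤ 2 * A}.indicator (fun y => ‖g y‖ₑ ^ 2) y) := by
    have hS : MeasurableSet {z : ℝ × E | z.1 * ‖g z.2‖ ^ (p - 1) ≤ 2 * A} :=
      measurableSet_le (measurable_fst.mul ((hg.comp measurable_snd).norm.pow_const _))
        measurable_const
    have : Measurable (fun z : ℝ × E => ENNReal.ofReal (z.1 ^ (r - 3)) *
        {z : ℝ × E | z.1 * ‖g z.2‖ ^ (p - 1) ≤ 2 * A}.indicator (fun z => ‖g z.2‖ₑ ^ 2) z) :=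
      ((measurable_fst.pow_const _).ennreal_ofReal).mul
        (((hg.comp measurable_snd).enorm.pow_const _).indicator hS)
    exact this
  calc ∫⁻ x, ‖𝓕 g x‖ₑ ^ r = ∫⁻ x, ENNReal.ofReal (‖𝓕 g x‖ ^ r) :=
        lintegral_congr fun x => hconv r (by linarith) _
    _ = ENNReal.ofReal r * ∫⁻ α in Ioi (0 : ℝ), volume {x | α < ‖𝓕 g x‖} *
          ENNReal.ofReal (α ^ (r - 1)) :=
        lintegral_rpow_eq_lintegral_meas_lt_mul _ (by filter_upwards with x; positivity)
          (continuous_fourier hgi).norm.measurable.aemeasurable (by linarith)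
    _ ≤ ENNReal.ofReal r * ∫⁻ α in Ioi (0 : ℝ), 4 * ∫⁻ y, ENNReal.ofReal (α ^ (r - 3)) *
          {y | α * ‖g y‖ ^ (p - 1) ≤ 2 * A}.indicator (fun y => ‖g y‖ₑ ^ 2) y := by
        refine mul_le_mul_right (setLIntegral_mono' measurableSet_Ioi fun α hα => ?_) _
        have hα' : 0 < α := hα
        have e : α ^ (r - 1) = α ^ 2 * α ^ (r - 3) := by
          rw [← Real.rpow_natCast, ← Real.rpow_add hα']; congr 1; push_cast; ring
        rw [e, ENNReal.ofReal_mul (by positivity), ← mul_assoc, lintegral_const_mul]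
        · calc _ ≤ (4 * ∫⁻ y, {y | α * ‖g y‖ ^ (p - 1) ≤ 2 * A}.indicator
                (fun y => ‖g y‖ₑ ^ 2) y) * ENNReal.ofReal (α ^ (r - 3)) :=
              mul_le_mul_left (hausdorffYoung_distribution hgi hp hA hgA hα') _
            _ = _ := by ring
        · refine (hg.enorm.pow_const _).indicator ?_
          exact measurableSet_le (measurable_const.mul (hg.norm.pow_const _)) measurable_const
    _ = ENNReal.ofReal r * (4 * ∫⁻ y, ∫⁻ α in Ioi (0 : ℝ), ENNReal.ofReal (α ^ (r - 3)) *
          {y | α * ‖g y‖ ^ (p - 1) ≤ 2 * A}.indicator (fun y => ‖g y‖ₑ ^ 2) y) := by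
        rw [lintegral_const_mul' _ _ (by norm_num), lintegral_lintegral_swap hmeas.aemeasurable]
    _ ≤ ENNReal.ofReal r * (4 * ∫⁻ y, ENNReal.ofReal ((2 * A) ^ (r - 2) / (r - 2)) *
          ENNReal.ofReal (‖g y‖ ^ p)) := by
        gcongr with y; exact hslice y
    _ = ENNReal.ofReal (r * 4 * 2 ^ (r - 2) / (r - 2)) * ENNReal.ofReal A ^ (r - 1) := by
        rw [lintegral_const_mul' _ _ ENNReal.ofReal_ne_top, hgA,
          ENNReal.ofReal_rpow_of_pos hA, ← ENNReal.ofReal_mul (by positivity)]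
        have h4 : (4 : ℝ≥0∞) = ENNReal.ofReal 4 := by norm_num
        rw [h4, ← ENNReal.ofReal_mul (by positivity), ← ENNReal.ofReal_mul (by positivity),
          ← ENNReal.ofReal_mul (by positivity)]
        congr 1
        rw [Real.mul_rpow (by norm_num) hA.le, show r - 1 = (r - 2) + 1 by ring,
          Real.rpow_add_one hA.ne']
        ring

end Fourier

/-! ### The dispersive estimate -/

section Dispersive

open Filter Topology

section Multiplier

variable {E : Type*} [NormedAddCommGroup E]

/-- The multiplier `exp (4 π² i t |ξ|²)` of the (backward) Schrödinger evolution. -/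
def evol (t : ℝ) (ξ : E) : ℂ := Complex.exp (((4 * Real.pi ^ 2 * t * ‖ξ‖ ^ 2 : ℝ) : ℂ) * Complex.I)

theorem norm_evol (t : ℝ) (ξ : E) : ‖evol t ξ‖ = 1 := Complex.norm_exp_ofReal_mul_I _

theorem enorm_evol (t : ℝ) (ξ : E) : ‖evol t ξ‖ₑ = 1 := by
  rw [← ofReal_norm, norm_evol]; simp

theorem continuous_evol : Continuous (fun z : ℝ × E => evol z.1 z.2) := by
  unfold evol; fun_prop

theorem continuous_evol_right (t : ℝ) : Continuous (evol t : E → ℂ) := by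
  unfold evol; fun_prop

theorem evol_add (s t : ℝ) (ξ : E) : evol (s + t) ξ = evol s ξ * evol t ξ := by
  rw [evol, evol, evol, ← Complex.exp_add]; congr 1; push_cast; ring

theorem evol_zero (ξ : E) : evol 0 ξ = 1 := by simp [evol]

theorem conj_evol (t : ℝ) (ξ : E) : (starRingEnd ℂ) (evol t ξ) = evol (-t) ξ := by
  rw [evol, evol, ← Complex.exp_conj, map_mul, Complex.conj_ofReal, Complex.conj_I]
  congr 1; push_cast; ring

end Multiplier

variable {E : Type*} [NormedAddCommGroup E] [InnerProductSpace ℝ E] [FiniteDimensional ℝ E]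
  [MeasurableSpace E] [BorelSpace E]

theorem integrable_evol_mul {f : E → ℂ} (hf : Integrable f) (t : ℝ) :
    Integrable (fun ξ => evol t ξ * f ξ) :=
  hf.bdd_mul (c := 1) (continuous_evol_right t).aestronglyMeasurable
    (Eventually.of_forall fun ξ => (norm_evol t ξ).le)

theorem integrable_gaussian_mul {f : E → ℂ} (hf : Integrable f) {b : ℂ} (hb : 0 < b.re) :
    Integrable (fun ξ : E => Complex.exp (-b * ‖ξ‖ ^ 2) * 𝓕 f ξ) := by
  have h1 : Integrable (fun ξ : E => Complex.exp (-b * ‖ξ‖ ^ 2)) := by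
    simpa using GaussianFourier.integrable_cexp_neg_mul_sq_norm_add hb 0 (0 : E)
  exact h1.mul_bdd (c := ∫ y, ‖f y‖) (continuous_fourier hf).aestronglyMeasurable
    (Eventually.of_forall fun ξ => norm_fourier_le _ _)

/-- For `Re b > 0` the multiplier is an integrable Gaussian, so the multiplication formula applies
twice and the transform of the Gaussian is explicit. The Schrödinger multiplier is the limit of
purely imaginary `b`. -/
theorem gaussian_pairing {f h : E → ℂ} (hf : Integrable f) (hh : Integrable h) {b : ℂ}
    (hb : 0 < b.re) :
    ∫ ξ : E, Complex.exp (-b * ‖ξ‖ ^ 2) * 𝓕 f ξ * 𝓕 h ξ =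
      (Real.pi / b) ^ (Module.finrank ℝ E / 2 : ℂ) *
        ∫ x, h x * ∫ y, Complex.exp (-Real.pi ^ 2 * ‖x + y‖ ^ 2 / b) * f y := by
  have h1 := integral_mul_fourier (integrable_gaussian_mul hf hb) hh
  rw [← h1, ← integral_const_mul]
  refine integral_congr_ae (Eventually.of_forall fun x => ?_)
  have hg : Integrable (fun ξ : E =>
      Complex.exp (-b * ‖ξ‖ ^ 2 + 2 * Real.pi * Complex.I * (inner ℝ (-x) ξ : ℝ))) := by
    simpa [add_comm] using GaussianFourier.integrable_cexp_neg_mul_sq_norm_add hb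
      (2 * Real.pi * Complex.I) (-x)
  have h2 : 𝓕 (fun ξ => Complex.exp (-b * ‖ξ‖ ^ 2) * 𝓕 f ξ) x = ∫ ξ, 𝓕 f ξ *
      Complex.exp (-b * ‖ξ‖ ^ 2 + 2 * Real.pi * Complex.I * (inner ℝ (-x) ξ : ℝ)) := by
    rw [Real.fourier_eq']
    refine integral_congr_ae (Eventually.of_forall fun ξ => ?_)
    simp only [smul_eq_mul]
    rw [Complex.exp_add, inner_neg_left, real_inner_comm]
    have : (((-2 * Real.pi * inner ℝ x ξ : ℝ) : ℂ) * Complex.I) =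
      2 * Real.pi * Complex.I * ((-inner ℝ x ξ : ℝ) : ℂ) := by push_cast; ring
    rw [this]; ring
  have h3 : ∀ w, 𝓕 (fun ξ : E =>
      Complex.exp (-b * ‖ξ‖ ^ 2 + 2 * Real.pi * Complex.I * (inner ℝ (-x) ξ : ℝ))) w =
      (Real.pi / b) ^ (Module.finrank ℝ E / 2 : ℂ) *
        Complex.exp (-Real.pi ^ 2 * ‖x + w‖ ^ 2 / b) := fun w => by
    rw [fourier_gaussian_innerProductSpace' hb (-x) w, show -x - w = -(x + w) by abel, norm_neg]
  simp only [h2]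
  rw [integral_mul_fourier hf hg]
  simp only [h3]
  rw [mul_comm, mul_left_comm]
  congr 1
  rw [← integral_const_mul]
  exact integral_congr_ae (Eventually.of_forall fun y => by ring)

theorem re_inv_nonneg {b : ℂ} (hb : 0 ≤ b.re) (u : ℝ) : (-Real.pi ^ 2 * (u : ℂ) ^ 2 / b).re ≤ 0 := by
  have : (-Real.pi ^ 2 * (u : ℂ) ^ 2 / b) = ((-(Real.pi ^ 2 * u ^ 2) : ℝ) : ℂ) * b⁻¹ := by
    push_cast; rw [div_eq_mul_inv]; ring
  rw [this, Complex.re_ofReal_mul, Complex.inv_re]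
  have := Complex.normSq_nonneg b
  have : 0 ≤ b.re / Complex.normSq b := by positivity
  nlinarith [mul_nonneg (sq_nonneg (Real.pi * u)) this]

theorem norm_gaussian_kernel_le {b : ℂ} (hb : 0 ≤ b.re) (u : ℝ) :
    ‖Complex.exp (-Real.pi ^ 2 * (u : ℂ) ^ 2 / b)‖ ≤ 1 := by
  rw [Complex.norm_exp]
  exact Real.exp_le_one_iff.2 (re_inv_nonneg hb u)

/-- Limit of `gaussian_pairing` at `b = ε - 4π²iτ` as `ε ↓ 0`. The frequency side is dominated by
`|𝓕 f * 𝓕 h|`, integrable by Plancherel, and the space side by `|h| ∫ |f|`, because the Gaussian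
kernel is bounded by one. -/
theorem dispersive_kernel {f h : E → ℂ} (hf : Integrable f) (hf2 : MemLp f 2) (hh : Integrable h)
    (hh2 : MemLp h 2) {τ : ℝ} (hτ : τ ≠ 0) :
    ∫ ξ : E, evol τ ξ * 𝓕 f ξ * 𝓕 h ξ =
      (Real.pi / (-4 * Real.pi ^ 2 * τ * Complex.I : ℂ)) ^ (Module.finrank ℝ E / 2 : ℂ) *
        ∫ x, h x * ∫ y, Complex.exp (-Real.pi ^ 2 * ‖x + y‖ ^ 2 /
          (-4 * Real.pi ^ 2 * τ * Complex.I : ℂ)) * f y := by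
  set b₀ : ℂ := -4 * Real.pi ^ 2 * τ * Complex.I with hb₀
  have hτ' : (τ : ℂ) ≠ 0 := by exact_mod_cast hτ
  have hpi : (Real.pi : ℂ) ≠ 0 := by exact_mod_cast Real.pi_ne_zero
  have hb0 : b₀ ≠ 0 := by simp [hb₀, hτ', hpi]
  have hre0 : b₀.re = 0 := by
    have : b₀ = ((-4 * Real.pi ^ 2 * τ : ℝ) : ℂ) * Complex.I := by rw [hb₀]; push_cast; ring
    rw [this, Complex.re_ofReal_mul]; simp
  -- `π / b₀` is a non-zero imaginary number, off the branch cut, so the complex power is continuous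
  -- there.
  have him : (Real.pi / b₀).im ≠ 0 := by
    have : (Real.pi / b₀) = ((1 / (4 * Real.pi * τ) : ℝ) : ℂ) * Complex.I := by
      rw [hb₀]; push_cast; field_simp
      rw [Complex.I_sq]
    rw [this, Complex.im_ofReal_mul]; simp [hτ, Real.pi_ne_zero]
  set l : Filter ℝ := 𝓝[>] 0
  have hlim : Tendsto (fun ε : ℝ => (ε : ℂ) + b₀) l (𝓝 b₀) := by
    have : Tendsto (fun ε : ℝ => (ε : ℂ) + b₀) (𝓝 0) (𝓝 (((0 : ℝ) : ℂ) + b₀)) :=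
      Continuous.tendsto (by fun_prop) 0
    simpa using this.mono_left nhdsWithin_le_nhds
  have hpos : ∀ᶠ ε : ℝ in l, 0 < ((ε : ℂ) + b₀).re := by
    filter_upwards [self_mem_nhdsWithin] with ε hε
    simpa [hre0] using hε
  have hprod : Integrable (fun ξ => 𝓕 f ξ * 𝓕 h ξ) := by
    have m1 : MemLp (𝓕 f) 2 :=
      ⟨(continuous_fourier hf).aestronglyMeasurable, by rw [eLpNorm_fourier_two hf hf2]; exact hf2.2⟩
    have m2 : MemLp (𝓕 h) 2 :=
      ⟨(continuous_fourier hh).aestronglyMeasurable, by rw [eLpNorm_fourier_two hh hh2]; exact hh2.2⟩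
    exact m1.integrable_mul m2
  have hleft : Tendsto (fun ε : ℝ => ∫ ξ : E, Complex.exp (-((ε : ℂ) + b₀) * ‖ξ‖ ^ 2) * 𝓕 f ξ * 𝓕 h ξ)
      l (𝓝 (∫ ξ : E, evol τ ξ * 𝓕 f ξ * 𝓕 h ξ)) := by
    refine tendsto_integral_filter_of_dominated_convergence (fun ξ => ‖𝓕 f ξ * 𝓕 h ξ‖)
      ?_ ?_ hprod.norm ?_
    · filter_upwards with ε
      refine Continuous.aestronglyMeasurable ?_
      have := continuous_fourier hf
      have := continuous_fourier hh
      fun_prop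
    · filter_upwards [hpos] with ε hε
      filter_upwards with ξ
      rw [mul_assoc, norm_mul]
      refine mul_le_of_le_one_left (norm_nonneg _) ?_
      rw [Complex.norm_exp, Real.exp_le_one_iff]
      have : (-((ε : ℂ) + b₀) * ‖ξ‖ ^ 2) = ((‖ξ‖ ^ 2 : ℝ) : ℂ) * (-((ε : ℂ) + b₀)) := by
        push_cast; ring
      rw [this, Complex.re_ofReal_mul, Complex.neg_re]
      nlinarith [sq_nonneg ‖ξ‖]
    · filter_upwards with ξ
      refine Tendsto.mul_const _ (Tendsto.mul_const _ ?_)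
      have h1 : evol τ ξ = Complex.exp (-b₀ * ‖ξ‖ ^ 2) := by
        rw [evol, hb₀]; congr 1; push_cast; ring
      rw [h1]
      exact (Complex.continuous_exp.tendsto _).comp ((hlim.neg).mul_const _)
  have hker : ∀ u : ℝ, Tendsto (fun ε : ℝ => Complex.exp (-Real.pi ^ 2 * (u : ℂ) ^ 2 / ((ε : ℂ) + b₀)))
      l (𝓝 (Complex.exp (-Real.pi ^ 2 * (u : ℂ) ^ 2 / b₀))) := fun u =>
    (Complex.continuous_exp.tendsto _).comp (tendsto_const_nhds.div hlim hb0)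
  have hcont : ∀ b : ℂ, Continuous (fun z : E × E =>
      Complex.exp (-Real.pi ^ 2 * (‖z.1 + z.2‖ : ℂ) ^ 2 / b)) := fun b => by
    simp only [div_eq_mul_inv]; fun_prop
  have hin : ∀ x, Tendsto (fun ε : ℝ => ∫ y, Complex.exp (-Real.pi ^ 2 * ‖x + y‖ ^ 2 / ((ε : ℂ) + b₀)) * f y)
      l (𝓝 (∫ y, Complex.exp (-Real.pi ^ 2 * ‖x + y‖ ^ 2 / b₀) * f y)) := by
    intro x
    refine tendsto_integral_filter_of_dominated_convergence (fun y => ‖f y‖) ?_ ?_ hf.norm ?_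
    · filter_upwards with ε
      exact ((hcont _).comp (Continuous.prodMk_right x)).aestronglyMeasurable.mul hf.1
    · filter_upwards [hpos] with ε hε
      filter_upwards with y
      rw [norm_mul]
      exact mul_le_of_le_one_left (norm_nonneg _) (norm_gaussian_kernel_le hε.le _)
    · filter_upwards with y
      exact (hker _).mul_const _
  have hright : Tendsto (fun ε : ℝ => (Real.pi / ((ε : ℂ) + b₀)) ^ (Module.finrank ℝ E / 2 : ℂ) *
        ∫ x, h x * ∫ y, Complex.exp (-Real.pi ^ 2 * ‖x + y‖ ^ 2 / ((ε : ℂ) + b₀)) * f y) l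
      (𝓝 ((Real.pi / b₀) ^ (Module.finrank ℝ E / 2 : ℂ) *
        ∫ x, h x * ∫ y, Complex.exp (-Real.pi ^ 2 * ‖x + y‖ ^ 2 / b₀) * f y)) := by
    refine Tendsto.mul ?_ ?_
    · exact (tendsto_const_nhds.div hlim hb0).cpow tendsto_const_nhds (Or.inr him)
    · refine tendsto_integral_filter_of_dominated_convergence (fun x => ‖h x‖ * ∫ y, ‖f y‖)
        ?_ ?_ (hh.norm.mul_const _) ?_
      · filter_upwards with ε
        refine hh.1.mul ?_
        exact ((hcont _).aestronglyMeasurable.mul hf.1.comp_snd).integral_prod_right'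
      · filter_upwards [hpos] with ε hε
        filter_upwards with x
        rw [norm_mul]
        refine mul_le_mul_of_nonneg_left ((norm_integral_le_integral_norm _).trans ?_)
          (norm_nonneg _)
        refine integral_mono_of_nonneg (Eventually.of_forall fun y => norm_nonneg _) hf.norm
          (Eventually.of_forall fun y => ?_)
        simp only [norm_mul]
        exact mul_le_of_le_one_left (norm_nonneg _) (norm_gaussian_kernel_le hε.le _)
      · filter_upwards with x
        exact (hin x).const_mul _
  refine tendsto_nhds_unique (hleft.congr' ?_) hright
  filter_upwards [hpos] with ε hε
  exact gaussian_pairing hf hh hε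

theorem lintegral_comp_smul {g : E → ℝ≥0∞} (hg : Measurable g) {R : ℝ} (hR : R ≠ 0) :
    ∫⁻ x, g (R • x) = ENNReal.ofReal |(R ^ Module.finrank ℝ E)⁻¹| * ∫⁻ x, g x := by
  rw [← lintegral_map hg (measurable_const_smul R), Measure.map_addHaar_smul _ hR,
    lintegral_smul_measure, smul_eq_mul]

/-- The dispersive estimate `L^p → L^r`, `1/p + 1/r = 1`, in bilinear form. -/
theorem dispersive {r p : ℝ} (hr : 2 < r) (hp : 1 < p) (hpr : (p - 1) * (r - 1) = 1) :
    ∃ C : ℝ≥0, ∀ f h : E → ℂ, Integrable f → MemLp f 2 → Integrable h → MemLp h 2 →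
      ∀ τ : ℝ, τ ≠ 0 →
      ‖∫ ξ : E, evol τ ξ * 𝓕 f ξ * 𝓕 h ξ‖ₑ ≤
        C * ENNReal.ofReal (|τ| ^ (-(Module.finrank ℝ E * (1 / 2 - 1 / r)))) *
          ((∫⁻ x, ‖f x‖ₑ ^ p) ^ (1 / p) * (∫⁻ x, ‖h x‖ₑ ^ p) ^ (1 / p)) := by
  obtain ⟨C, hC⟩ := hausdorffYoung (E := E) hr hp hpr
  set d := Module.finrank ℝ E
  -- The exponent of `4π|τ|` is `-d/2` from the kernel plus `d/r` from rescaling space in the `L^r`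
  -- norm.
  refine ⟨C ^ (1 / r) * Real.toNNReal ((4 * Real.pi) ^ (-(d * (1 / 2 - 1 / r) : ℝ))), ?_⟩
  intro f h hf hf2 hh hh2 τ hτ
  have hr0 : 0 < r := by linarith
  have hp0 : 0 < p := by linarith
  have hτ' : (τ : ℂ) ≠ 0 := by exact_mod_cast hτ
  have hpi : (Real.pi : ℂ) ≠ 0 := by exact_mod_cast Real.pi_ne_zero
  -- Expanding `|x + y|²` factors the kernel into the unimodular chirps `q x` and `q y` and a
  -- Fourier character at the dilated point `R • x`. The propagator is thus a rescaled Fourier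
  -- transform of `q * f`, and Hausdorff–Young applies.
  set q : E → ℂ := fun y => Complex.exp (((-‖y‖ ^ 2 / (4 * τ) : ℝ) : ℂ) * Complex.I) with hq
  have hqn : ∀ y, ‖q y‖ = 1 := fun y => Complex.norm_exp_ofReal_mul_I _
  have hqe : ∀ y, ‖q y‖ₑ = 1 := fun y => by rw [← ofReal_norm, hqn]; simp
  have hqc : Continuous q := by
    simp only [hq, div_eq_mul_inv]; fun_prop
  have hqf : Integrable (fun y => q y * f y) :=
    hf.bdd_mul (c := 1) hqc.aestronglyMeasurable (Eventually.of_forall fun ξ => (hqn ξ).le)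
  set R : ℝ := 1 / (4 * Real.pi * τ) with hRdef
  have hR : R ≠ 0 := by simp [hRdef, hτ, Real.pi_ne_zero]
  have hinner : ∀ x, ∫ y, Complex.exp (-Real.pi ^ 2 * ‖x + y‖ ^ 2 /
          (-4 * Real.pi ^ 2 * τ * Complex.I : ℂ)) * f y = q x * 𝓕 (fun y => q y * f y) (R • x) := by
    intro x
    rw [Real.fourier_eq', ← integral_const_mul]
    refine integral_congr_ae (Eventually.of_forall fun y => ?_)
    simp only [smul_eq_mul, hq]
    rw [← mul_assoc, ← mul_assoc, ← Complex.exp_add, ← Complex.exp_add]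
    congr 2
    have e1 : ((‖x + y‖ : ℝ) : ℂ) ^ 2 = ((‖x‖ ^ 2 + 2 * inner ℝ y x + ‖y‖ ^ 2 : ℝ) : ℂ) := by
      rw [real_inner_comm, ← norm_add_sq_real]; push_cast; rfl
    rw [e1, inner_smul_right, hRdef]
    push_cast
    field_simp
    rw [Complex.I_sq]; ring
  rw [dispersive_kernel hf hf2 hh hh2 hτ]
  simp only [hinner]
  rw [enorm_mul]
  have hconst : ‖(Real.pi / (-4 * Real.pi ^ 2 * τ * Complex.I : ℂ)) ^ (d / 2 : ℂ)‖ₑ =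
      ENNReal.ofReal ((4 * Real.pi * |τ|) ^ (-(d / 2 : ℝ))) := by
    have hb : (Real.pi / (-4 * Real.pi ^ 2 * τ * Complex.I : ℂ)) ≠ 0 :=
      div_ne_zero hpi (by simp [hτ', hpi])
    rw [← ofReal_norm, show (d / 2 : ℂ) = ((d / 2 : ℝ) : ℂ) by push_cast; rfl,
      Complex.norm_cpow_of_ne_zero hb]
    simp only [Complex.ofReal_re, Complex.ofReal_im, mul_zero, Real.exp_zero, div_one]
    congr 1
    rw [Real.rpow_neg (by positivity), ← Real.inv_rpow (by positivity)]
    congr 1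
    simp only [norm_div, norm_mul, norm_neg, norm_pow, Complex.norm_real, Complex.norm_I,
      Real.norm_eq_abs, abs_of_pos Real.pi_pos]
    norm_num
    field_simp
  have hmain : ‖∫ x, h x * (q x * 𝓕 (fun y => q y * f y) (R • x))‖ₑ ≤
      (∫⁻ x, ‖h x‖ₑ ^ p) ^ (1 / p) * (∫⁻ x, ‖𝓕 (fun y => q y * f y) (R • x)‖ₑ ^ r) ^ (1 / r) := by
    have hconj : p.HolderConjugate r := by
      rw [Real.holderConjugate_iff]
      refine ⟨hp, ?_⟩
      field_simp; linarith
    refine (enorm_integral_le_lintegral_enorm _).trans ?_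
    calc ∫⁻ x, ‖h x * (q x * 𝓕 (fun y => q y * f y) (R • x))‖ₑ
        = ∫⁻ x, ((fun x => ‖h x‖ₑ) * fun x => ‖𝓕 (fun y => q y * f y) (R • x)‖ₑ) x := by
          refine lintegral_congr fun x => ?_
          simp [enorm_mul, hqe]
      _ ≤ _ := ENNReal.lintegral_mul_le_Lp_mul_Lq _ hconj hh.1.enorm
          ((continuous_fourier hqf).comp (continuous_const_smul R)).enorm.measurable.aemeasurable
  have hscale : (∫⁻ x, ‖𝓕 (fun y => q y * f y) (R • x)‖ₑ ^ r) ^ (1 / r) ≤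
      ENNReal.ofReal ((4 * Real.pi * |τ|) ^ (d / r : ℝ)) * ((C : ℝ≥0∞) ^ (1 / r) *
        (∫⁻ x, ‖f x‖ₑ ^ p) ^ (1 / p)) := by
    have e1 := lintegral_comp_smul (E := E)
      ((continuous_fourier hqf).enorm.measurable.pow_const r) hR
    rw [e1]
    have e2 : |(R ^ d)⁻¹| = (4 * Real.pi * |τ|) ^ (d : ℝ) := by
      rw [Real.rpow_natCast, ← inv_pow, abs_pow, hRdef, one_div, inv_inv, abs_mul, abs_mul,
        abs_of_pos Real.pi_pos]; norm_num
    have e3 := hC _ hqf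
    simp only [enorm_mul, hqe, one_mul] at e3
    have hpos : 0 < 4 * Real.pi * |τ| := by positivity
    calc _ ≤ (ENNReal.ofReal |(R ^ d)⁻¹| * (C * (∫⁻ x, ‖f x‖ₑ ^ p) ^ (r - 1))) ^ (1 / r) := by
          gcongr
      _ = _ := by
          rw [ENNReal.mul_rpow_of_nonneg _ _ (by positivity),
            ENNReal.mul_rpow_of_nonneg _ _ (by positivity), e2,
            ENNReal.ofReal_rpow_of_pos (by positivity), ← Real.rpow_mul hpos.le,
            ← ENNReal.rpow_mul]
          have : (r - 1) * (1 / r) = 1 / p := by field_simp; linarith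
          rw [this, mul_one_div]
  have hpos : 0 < 4 * Real.pi * |τ| := by positivity
  calc _ ≤ ENNReal.ofReal ((4 * Real.pi * |τ|) ^ (-(d / 2 : ℝ))) *
        ((∫⁻ x, ‖h x‖ₑ ^ p) ^ (1 / p) * (ENNReal.ofReal ((4 * Real.pi * |τ|) ^ (d / r : ℝ)) *
          ((C : ℝ≥0∞) ^ (1 / r) * (∫⁻ x, ‖f x‖ₑ ^ p) ^ (1 / p)))) := by
        rw [hconst]; gcongr; exact hmain.trans (by gcongr)
    _ = (C : ℝ≥0∞) ^ (1 / r) * (ENNReal.ofReal ((4 * Real.pi * |τ|) ^ (-(d / 2 : ℝ))) *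
        ENNReal.ofReal ((4 * Real.pi * |τ|) ^ (d / r : ℝ))) *
        ((∫⁻ x, ‖f x‖ₑ ^ p) ^ (1 / p) * (∫⁻ x, ‖h x‖ₑ ^ p) ^ (1 / p)) := by ring
    _ = _ := by
        rw [← ENNReal.ofReal_mul (by positivity), ← Real.rpow_add hpos,
          show -(d / 2 : ℝ) + d / r = -(d * (1 / 2 - 1 / r)) by ring,
          Real.mul_rpow (by positivity) (abs_nonneg _), ENNReal.ofReal_mul (by positivity)]
        rw [ENNReal.coe_mul, ENNReal.coe_rpow_of_nonneg _ (by positivity)]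
        simp only [ENNReal.ofReal]; ring

end Dispersive

/-! ### Fractional integration in time -/

section FractionalIntegration

theorem lintegral_near {lam R : ℝ} (hlam : lam < 1) (hR : 0 ≤ R) (s : ℝ) :
    ∫⁻ t in {t | |t - s| ≤ R}, ENNReal.ofReal (|t - s| ^ (-lam)) ≤
      ENNReal.ofReal (2 * (R ^ (1 - lam) / (1 - lam))) := by
  have h0 : ∫⁻ t in {t | |t - s| ≤ R}, ENNReal.ofReal (|t - s| ^ (-lam)) =
      ∫⁻ t, (Icc (-R) R).indicator (fun t => ENNReal.ofReal (|t| ^ (-lam))) t := by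
    rw [← lintegral_indicator (measurableSet_le (by fun_prop) measurable_const),
      ← lintegral_add_right_eq_self _ s]
    refine lintegral_congr fun t => ?_
    simp only [indicator, mem_ofPred_eq, mem_Icc, abs_le, add_sub_cancel_right]
  have hm : Measurable (fun t : ℝ => ENNReal.ofReal (|t| ^ (-lam))) := by fun_prop
  have h1 : ∫⁻ t in Ioc 0 R, ENNReal.ofReal (|t| ^ (-lam)) =
      ENNReal.ofReal (R ^ (1 - lam) / (1 - lam)) := by
    rw [show 1 - lam = -lam + 1 by ring, ← lintegral_Ioc_rpow hR (by linarith)]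
    refine setLIntegral_congr_fun measurableSet_Ioc fun t ht => ?_
    simp only [abs_of_pos ht.1]
  have h2 : ∫⁻ t in Ico (-R) 0, ENNReal.ofReal (|t| ^ (-lam)) =
      ENNReal.ofReal (R ^ (1 - lam) / (1 - lam)) := by
    rw [← h1, ← lintegral_indicator measurableSet_Ico, ← lintegral_indicator measurableSet_Ioc,
      ← lintegral_neg_eq_self]
    refine lintegral_congr fun t => ?_
    simp only [indicator, mem_Ico, mem_Ioc, abs_neg]
    congr 1
    simp only [eq_iff_iff]; constructor <;> rintro ⟨a, b⟩ <;> constructor <;> linarith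
  have hsub : Icc (-R) R ⊆ Ico (-R) 0 ∪ ({0} ∪ Ioc 0 R) := by
    intro t ht
    rcases lt_trichotomy t 0 with h | h | h
    · exact Or.inl ⟨ht.1, h⟩
    · exact Or.inr (Or.inl h)
    · exact Or.inr (Or.inr ⟨h, ht.2⟩)
  rw [h0, lintegral_indicator measurableSet_Icc]
  calc _ ≤ ∫⁻ t in Ico (-R) 0 ∪ ({0} ∪ Ioc 0 R), ENNReal.ofReal (|t| ^ (-lam)) :=
        lintegral_mono_set hsub
    _ ≤ (∫⁻ t in Ico (-R) 0, ENNReal.ofReal (|t| ^ (-lam))) +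
        ((∫⁻ t in ({0} : Set ℝ), ENNReal.ofReal (|t| ^ (-lam))) +
          ∫⁻ t in Ioc 0 R, ENNReal.ofReal (|t| ^ (-lam))) :=
        (lintegral_union_le _ _ _).trans (by gcongr; exact lintegral_union_le _ _ _)
    _ = _ := by
        rw [h1, h2, Measure.restrict_singleton]
        simp only [Real.volume_singleton, zero_smul, lintegral_zero_measure, zero_add]
        have h1l : 0 < 1 - lam := by linarith
        rw [← ENNReal.ofReal_add (by positivity) (by positivity), two_mul]

/-- The exponent `-2` is that of `|t|^(-2/q)` raised to the power `q`, as Hölder's inequality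
produces it. -/
theorem lintegral_far {R : ℝ} (hR : 0 < R) (s : ℝ) :
    ∫⁻ t in {t | R < |t - s|}, ENNReal.ofReal (|t - s| ^ (-2 : ℝ)) ≤ ENNReal.ofReal (2 / R) := by
  have h0 : ∫⁻ t in {t | R < |t - s|}, ENNReal.ofReal (|t - s| ^ (-2 : ℝ)) =
      ∫⁻ t, {t : ℝ | R < |t|}.indicator (fun t => ENNReal.ofReal (|t| ^ (-2 : ℝ))) t := by
    rw [← lintegral_indicator (measurableSet_lt measurable_const (by fun_prop)),
      ← lintegral_add_right_eq_self _ s]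
    exact lintegral_congr fun t => by
      simp only [indicator, mem_ofPred_eq, add_sub_cancel_right]
  have h1 : ∫⁻ t in Ioi R, ENNReal.ofReal (|t| ^ (-2 : ℝ)) = ENNReal.ofReal (1 / R) := by
    have e : ∫⁻ t in Ioi R, ENNReal.ofReal (|t| ^ (-2 : ℝ)) =
        ∫⁻ t in Ioi R, ENNReal.ofReal (t ^ (-2 : ℝ)) :=
      setLIntegral_congr_fun measurableSet_Ioi fun t ht => by
        simp only [abs_of_pos (hR.trans ht)]
    rw [e, ← ofReal_integral_eq_lintegral_ofReal]
    · rw [integral_Ioi_rpow_of_lt (by norm_num) hR]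
      congr 1
      rw [show (-2 + 1 : ℝ) = -1 by norm_num, Real.rpow_neg_one]; field_simp
    · exact integrableOn_Ioi_rpow_of_lt (by norm_num) hR
    · filter_upwards [ae_restrict_mem measurableSet_Ioi] with t ht
      exact Real.rpow_nonneg (hR.trans ht).le _
  have h2 : ∫⁻ t in Iio (-R), ENNReal.ofReal (|t| ^ (-2 : ℝ)) = ENNReal.ofReal (1 / R) := by
    rw [← h1, ← lintegral_indicator measurableSet_Iio, ← lintegral_indicator measurableSet_Ioi,
      ← lintegral_neg_eq_self]
    refine lintegral_congr fun t => ?_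
    simp only [indicator, mem_Iio, mem_Ioi, abs_neg, neg_lt_neg_iff]
  have hsub : {t : ℝ | R < |t|} ⊆ Iio (-R) ∪ Ioi R := by
    intro t ht
    rcases lt_abs.1 (show R < |t| from ht) with h | h
    · exact Or.inr h
    · exact Or.inl (by simp only [mem_Iio]; linarith)
  rw [h0, lintegral_indicator (measurableSet_lt measurable_const (by fun_prop))]
  calc _ ≤ ∫⁻ t in Iio (-R) ∪ Ioi R, ENNReal.ofReal (|t| ^ (-2 : ℝ)) := lintegral_mono_set hsub
    _ ≤ _ := lintegral_union_le _ _ _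
    _ = _ := by
        rw [h1, h2, ← ENNReal.ofReal_add (by positivity) (by positivity)]; congr 1; ring

/-- The Riesz potential of the part of `h` below the level `h s`. -/
theorem lintegral_riesz_le {q p : ℝ} (hq : 2 < q) (hp : p = q / (q - 1)) {h : ℝ → ℝ}
    (hm : Measurable h) (h0 : ∀ t, 0 ≤ h t) {M : ℝ} (hM : 0 < M)
    (hhM : ∫⁻ t, ENNReal.ofReal (h t ^ p) = ENNReal.ofReal (M ^ p)) {A : ℝ} (hA : 0 < A) (s : ℝ) :
    ∫⁻ t, {t | h t ≤ A}.indicator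
        (fun t => ENNReal.ofReal (h t) * ENNReal.ofReal (|t - s| ^ (-(2 / q)))) t ≤
      ENNReal.ofReal ((2 / (1 - 2 / q) + 2) * (M ^ (2 - p) * A ^ (p - 1))) := by
  have hq1 : 0 < q - 1 := by linarith
  have hq0 : 0 < q := by linarith
  have hp1 : 1 < p := by rw [hp, lt_div_iff₀ hq1]; linarith
  have hlam : 2 / q < 1 := by rw [div_lt_one hq0]; exact hq
  have hlam' : 0 < 1 - 2 / q := by linarith
  -- This radius balances the two regions: near `s` the bound `h ≤ A` is used, far from `s` Hölder's
  -- inequality with `‖h‖_p = M`, and both give a multiple of `M^(2-p) * A^(p-1)`.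
  set R : ℝ := (M / A) ^ p
  have hR : 0 < R := by positivity
  have hconj : p.HolderConjugate q := by
    rw [Real.holderConjugate_iff]; refine ⟨hp1, ?_⟩; rw [hp]; field_simp; ring
  have hmh : Measurable fun t => ENNReal.ofReal (h t) := hm.ennreal_ofReal
  have near : ∫⁻ t in {t | |t - s| ≤ R}, {t | h t ≤ A}.indicator
        (fun t => ENNReal.ofReal (h t) * ENNReal.ofReal (|t - s| ^ (-(2 / q)))) t ≤
      ENNReal.ofReal (2 / (1 - 2 / q) * (M ^ (2 - p) * A ^ (p - 1))) := by
    calc _ ≤ ∫⁻ t in {t | |t - s| ≤ R}, ENNReal.ofReal A * ENNReal.ofReal (|t - s| ^ (-(2 / q))) := by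
          refine lintegral_mono fun t => ?_
          by_cases ht : h t ≤ A
          · simp only [indicator, mem_ofPred_eq, ht, if_true]; gcongr
          · simp [indicator, ht]
      _ ≤ ENNReal.ofReal A * ENNReal.ofReal (2 * (R ^ (1 - 2 / q) / (1 - 2 / q))) := by
          rw [lintegral_const_mul' _ _ ENNReal.ofReal_ne_top]
          gcongr; exact lintegral_near hlam hR.le s
      _ = _ := by
          rw [← ENNReal.ofReal_mul hA.le]
          congr 1
          have e : R ^ (1 - 2 / q) = M ^ (2 - p) * A ^ (p - 1) / A := by
            rw [← Real.rpow_mul (by positivity), show p * (1 - 2 / q) = 2 - p by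
              rw [hp]; field_simp; ring, Real.div_rpow hM.le hA.le, div_eq_mul_inv, mul_div_assoc]
            congr 1
            rw [← Real.rpow_neg hA.le, ← Real.rpow_sub_one hA.ne']; congr 1; ring
          rw [e]; field_simp
  have far : ∫⁻ t in {t | |t - s| ≤ R}ᶜ, {t | h t ≤ A}.indicator
        (fun t => ENNReal.ofReal (h t) * ENNReal.ofReal (|t - s| ^ (-(2 / q)))) t ≤
      ENNReal.ofReal (2 * (M ^ (2 - p) * A ^ (p - 1))) := by
    have hcompl : {t | |t - s| ≤ R}ᶜ = {t | R < |t - s|} := by ext; simp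
    rw [hcompl]
    calc _ ≤ ∫⁻ t in {t | R < |t - s|}, ((fun t => ENNReal.ofReal (h t)) *
            fun t => ENNReal.ofReal (|t - s| ^ (-(2 / q)))) t := by
          refine lintegral_mono fun t => ?_
          by_cases ht : h t ≤ A <;> simp [indicator, ht]
      _ ≤ (∫⁻ t in {t | R < |t - s|}, ENNReal.ofReal (h t) ^ p) ^ (1 / p) *
          (∫⁻ t in {t | R < |t - s|}, ENNReal.ofReal (|t - s| ^ (-(2 / q))) ^ q) ^ (1 / q) :=
          ENNReal.lintegral_mul_le_Lp_mul_Lq _ hconj hmh.aemeasurable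
            (by fun_prop)
      _ ≤ (ENNReal.ofReal (M ^ p)) ^ (1 / p) * (ENNReal.ofReal (2 / R)) ^ (1 / q) := by
          gcongr
          · rw [← hhM]
            refine (setLIntegral_le_lintegral _ _).trans (lintegral_mono fun t => ?_)
            rw [ENNReal.ofReal_rpow_of_nonneg (h0 t) (by linarith)]
          · refine le_trans (le_of_eq ?_) (lintegral_far hR s)
            refine lintegral_congr fun t => ?_
            rw [ENNReal.ofReal_rpow_of_nonneg (by positivity) hq0.le,
              ← Real.rpow_mul (abs_nonneg _)]
            congr 2; field_simp
      _ ≤ _ := by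
          rw [ENNReal.ofReal_rpow_of_pos (by positivity), ENNReal.ofReal_rpow_of_pos (by positivity),
            ← ENNReal.ofReal_mul (by positivity)]
          refine ENNReal.ofReal_le_ofReal ?_
          rw [← Real.rpow_mul hM.le, mul_one_div_cancel (by linarith), Real.rpow_one,
            Real.div_rpow (by norm_num) hR.le]
          have e : M / R ^ (1 / q) = M ^ (2 - p) * A ^ (p - 1) := by
            rw [← Real.rpow_mul (by positivity), show p * (1 / q) = p - 1 by
              rw [hp]; field_simp; ring, Real.div_rpow hM.le hA.le,
              show 2 - p = 1 - (p - 1) by ring, Real.rpow_sub hM 1, Real.rpow_one]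
            field_simp
          have h2 : (2 : ℝ) ^ (1 / q) ≤ 2 := by
            calc (2 : ℝ) ^ (1 / q) ≤ 2 ^ (1 : ℝ) :=
                  Real.rpow_le_rpow_of_exponent_le (by norm_num)
                    (by rw [div_le_one hq0]; linarith)
              _ = 2 := Real.rpow_one _
          calc _ = 2 ^ (1 / q) * (M / R ^ (1 / q)) := by ring
            _ = 2 ^ (1 / q) * (M ^ (2 - p) * A ^ (p - 1)) := by rw [e]
            _ ≤ _ := by gcongr
  rw [← lintegral_add_compl _ (measurableSet_le (f := fun t => |t - s|) (g := fun _ => R)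
    (by fun_prop) measurable_const)]
  refine (add_le_add near far).trans ?_
  rw [← ENNReal.ofReal_add (by positivity) (by positivity)]
  exact ENNReal.ofReal_le_ofReal (by ring_nf; rfl)

/-- The Hardy–Littlewood–Sobolev inequality on the line, on the diagonal. -/
theorem hardyLittlewoodSobolev {q p : ℝ} (hq : 2 < q) (hp : p = q / (q - 1)) :
    ∃ C : ℝ≥0, ∀ h : ℝ → ℝ, Measurable h → (∀ t, 0 ≤ h t) →
      ∫⁻ s, ∫⁻ t, ENNReal.ofReal (h s) * ENNReal.ofReal (h t) *
        ENNReal.ofReal (|t - s| ^ (-(2 / q))) ≤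
      C * (∫⁻ t, ENNReal.ofReal (h t ^ p)) ^ (2 / p) := by
  have hq1 : 0 < q - 1 := by linarith
  have hq0 : 0 < q := by linarith
  have hp1 : 1 < p := by rw [hp, lt_div_iff₀ hq1]; linarith
  have hlam' : 0 < 1 - 2 / q := by
    have : 2 / q < 1 := by rw [div_lt_one hq0]; exact hq
    linarith
  set K : ℝ := 2 / (1 - 2 / q) + 2
  have hK : 0 < K := by positivity
  refine ⟨Real.toNNReal (2 * K), fun h hm h0 => ?_⟩
  obtain hz | hz := eq_or_ne (∫⁻ t, ENNReal.ofReal (h t ^ p)) 0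
  · rw [lintegral_eq_zero_iff (by fun_prop)] at hz
    have : ∀ᵐ t, ENNReal.ofReal (h t) = 0 := by
      filter_upwards [hz] with t ht
      have h1 : h t ^ p ≤ 0 := by simpa using ht
      have h2 : h t = 0 := by
        by_contra hne
        exact absurd h1 (not_le.2 (Real.rpow_pos_of_pos (lt_of_le_of_ne (h0 t) (Ne.symm hne)) _))
      simp [h2]
    rw [lintegral_congr_ae (g := 0) (by filter_upwards [this] with t ht; simp [ht])]
    simp
  obtain htop | htop := eq_or_ne (∫⁻ t, ENNReal.ofReal (h t ^ p)) ∞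
  · rw [htop, ENNReal.top_rpow_of_pos (by positivity), ENNReal.mul_top]
    · exact le_top
    · simpa using hK
  set I₀ : ℝ := (∫⁻ t, ENNReal.ofReal (h t ^ p)).toReal
  have hI : 0 < I₀ := ENNReal.toReal_pos hz htop
  have hIe : ∫⁻ t, ENNReal.ofReal (h t ^ p) = ENNReal.ofReal I₀ := (ENNReal.ofReal_toReal htop).symm
  set M : ℝ := I₀ ^ (1 / p)
  have hM : 0 < M := by positivity
  have hMp : M ^ p = I₀ := by
    rw [← Real.rpow_mul hI.le, one_div_mul_cancel (by linarith), Real.rpow_one]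
  have hhM : ∫⁻ t, ENNReal.ofReal (h t ^ p) = ENNReal.ofReal (M ^ p) := by rw [hMp, hIe]
  set k : ℝ → ℝ → ℝ≥0∞ := fun s t => ENNReal.ofReal (h s) * ENNReal.ofReal (h t) *
        ENNReal.ofReal (|t - s| ^ (-(2 / q))) with hk
  -- By symmetry it suffices to integrate over pairs with `h t ≤ h s`. There `lintegral_riesz_le` at
  -- the level `A = h s` bounds the inner integral by a multiple of `h s * (h s)^(p-1) = (h s)^p`.
  set k' : ℝ → ℝ → ℝ≥0∞ := fun s t => {t | h t ≤ h s}.indicator (k s) t with hk'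
  have hkm : Measurable (Function.uncurry k') := by
    have : Measurable ({z : ℝ × ℝ | h z.2 ≤ h z.1}.indicator (fun z => k z.1 z.2)) := by
      refine Measurable.indicator ?_ (measurableSet_le (by fun_prop) (by fun_prop))
      simp only [hk]; fun_prop
    exact this
  have hkm' : ∀ s, Measurable (k' s) := fun s => hkm.comp measurable_prodMk_left
  have hsymm : ∀ s t, k s t ≤ k' s t + k' t s := by
    intro s t
    have hc : k s t = k t s := by simp only [hk, abs_sub_comm t s]; ring
    rcases le_total (h t) (h s) with h1 | h1
    · simp [hk', h1]
    · have : k' t s = k s t := by simp [hk', h1, hc]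
      rw [this]; exact le_add_self
  have hinner : ∀ s, ∫⁻ t, k' s t ≤ ENNReal.ofReal (K * M ^ (2 - p)) * ENNReal.ofReal (h s ^ p) := by
    intro s
    obtain hs | hs := eq_or_lt_of_le (h0 s)
    · have : ∀ t, k' s t = 0 := fun t => by simp [hk', hk, ← hs]
      simp [this]
    have e : ∀ t, k' s t = ENNReal.ofReal (h s) * {t | h t ≤ h s}.indicator
        (fun t => ENNReal.ofReal (h t) * ENNReal.ofReal (|t - s| ^ (-(2 / q)))) t := by
      intro t
      simp only [hk', hk, indicator]
      split_ifs <;> ring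
    simp only [e]
    rw [lintegral_const_mul' _ _ ENNReal.ofReal_ne_top]
    refine (mul_le_mul_right (lintegral_riesz_le hq hp hm h0 hM hhM hs s) _).trans ?_
    rw [← ENNReal.ofReal_mul hs.le, ← ENNReal.ofReal_mul (by positivity)]
    refine ENNReal.ofReal_le_ofReal (le_of_eq ?_)
    have : h s ^ p = h s * h s ^ (p - 1) := by
      rw [mul_comm, ← Real.rpow_add_one hs.ne']; congr 1; ring
    rw [this]; ring
  have hone : ∫⁻ s, ∫⁻ t, k' s t ≤ ENNReal.ofReal (K * M ^ 2) := by
    calc _ ≤ ∫⁻ s, ENNReal.ofReal (K * M ^ (2 - p)) * ENNReal.ofReal (h s ^ p) :=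
          lintegral_mono hinner
      _ = ENNReal.ofReal (K * M ^ (2 - p)) * ENNReal.ofReal (M ^ p) := by
          rw [lintegral_const_mul' _ _ ENNReal.ofReal_ne_top, hhM]
      _ = _ := by
          rw [← ENNReal.ofReal_mul (by positivity), mul_assoc, ← Real.rpow_add hM]
          congr 2
          rw [← Real.rpow_natCast]; congr 1; push_cast; ring
  calc ∫⁻ s, ∫⁻ t, k s t ≤ ∫⁻ s, ∫⁻ t, (k' s t + k' t s) :=
        lintegral_mono fun s => lintegral_mono fun t => hsymm s t
    _ = (∫⁻ s, ∫⁻ t, k' s t) + ∫⁻ s, ∫⁻ t, k' t s := by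
        have e : ∀ s, ∫⁻ t, (k' s t + k' t s) = (∫⁻ t, k' s t) + ∫⁻ t, k' t s :=
          fun s => lintegral_add_left (hkm' s) _
        simp only [e]
        exact lintegral_add_left hkm.lintegral_prod_right' _
    _ = (∫⁻ s, ∫⁻ t, k' s t) + ∫⁻ s, ∫⁻ t, k' s t := by
        congr 1
        exact lintegral_lintegral_swap (hkm.comp measurable_swap).aemeasurable
    _ ≤ ENNReal.ofReal (K * M ^ 2) + ENNReal.ofReal (K * M ^ 2) := add_le_add hone hone
    _ = _ := by
        rw [hIe, ENNReal.ofReal_rpow_of_pos hI, ← ENNReal.ofReal_add (by positivity) (by positivity)]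
        have : M ^ 2 = I₀ ^ (2 / p) := by
          rw [← Real.rpow_natCast, ← Real.rpow_mul hI.le]; congr 1; push_cast; ring
        rw [this, ← two_mul, ← mul_assoc, ENNReal.ofReal_mul (by positivity)]; rfl

end FractionalIntegration

/-! ### The dual Strichartz estimate -/

section Strichartz

open Filter Topology

variable {E : Type*} [NormedAddCommGroup E] [InnerProductSpace ℝ E] [FiniteDimensional ℝ E]
  [MeasurableSpace E] [BorelSpace E]

/-- Turns the conjugate in the `T T*` form into a Fourier transform, so that the bilinear form of
`dispersive` covers it. -/
theorem fourier_conj_neg (f : E → ℂ) (ξ : E) :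
    𝓕 (fun x => (starRingEnd ℂ) (f (-x))) ξ = (starRingEnd ℂ) (𝓕 f ξ) := by
  rw [Real.fourier_eq', Real.fourier_eq', ← integral_conj, ← integral_neg_eq_self]
  refine integral_congr_ae (Eventually.of_forall fun x => ?_)
  simp only [smul_eq_mul, map_mul, neg_neg, inner_neg_left, ← Complex.exp_conj,
    Complex.conj_ofReal, Complex.conj_I]
  congr 2; push_cast; ring

theorem stronglyMeasurable_fourier {T : Type*} [MeasurableSpace T] {F : T → E → ℂ}
    (hF : Measurable (Function.uncurry F)) :
    StronglyMeasurable (fun z : T × E => 𝓕 (F z.1) z.2) := by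
  simp only [Real.fourier_eq', smul_eq_mul]
  refine StronglyMeasurable.integral_prod_right' (f := fun z : (T × E) × E =>
    Complex.exp (((-2 * Real.pi * inner ℝ z.2 z.1.2 : ℝ) : ℂ) * Complex.I) * F z.1.1 z.2) ?_
  refine Measurable.stronglyMeasurable (Measurable.mul ?_ ?_)
  · have : Continuous fun z : E × E =>
      Complex.exp (((-2 * Real.pi * inner ℝ z.2 z.1 : ℝ) : ℂ) * Complex.I) := by fun_prop
    exact this.measurable.comp ((measurable_snd.comp measurable_fst).prodMk measurable_snd)
  · exact hF.comp ((measurable_fst.comp measurable_fst).prodMk measurable_snd)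

/-- The product is dominated by the sum of the two squares, whose frequency integrals are bounded
uniformly in time, and both times range over a set of finite measure. -/
theorem integrable_mul_conj (g : ℝ → E → ℂ) (hm : Measurable (Function.uncurry g)) {J : Set ℝ}
    {B : ℝ≥0∞} (hJ : MeasurableSet J) (hJt : volume J < ∞) (hB : B < ∞)
    (hg : ∀ t, ∫⁻ ξ, ‖g t ξ‖ₑ ^ 2 ≤ B) (h0 : ∀ t, t ∉ J → ∀ ξ, g t ξ = 0) :
    Integrable (fun z : E × (ℝ × ℝ) => g z.2.1 z.1 * (starRingEnd ℂ) (g z.2.2 z.1))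
      ((volume : Measure E).prod ((volume : Measure ℝ).prod (volume : Measure ℝ))) := by
  have hm1 : Measurable fun z : E × (ℝ × ℝ) => g z.2.1 z.1 :=
    hm.comp ((measurable_fst.comp measurable_snd).prodMk measurable_fst)
  have hm2 : Measurable fun z : E × (ℝ × ℝ) => g z.2.2 z.1 :=
    hm.comp ((measurable_snd.comp measurable_snd).prodMk measurable_fst)
  have hmm : Measurable (fun z : E × (ℝ × ℝ) => g z.2.1 z.1 * (starRingEnd ℂ) (g z.2.2 z.1)) :=
    hm1.mul (Complex.continuous_conj.measurable.comp hm2)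
  refine ⟨hmm.aestronglyMeasurable, ?_⟩
  rw [HasFiniteIntegral, lintegral_prod_symm _ hmm.enorm.aemeasurable]
  have hbound : ∀ z : ℝ × ℝ, ∫⁻ ξ : E, ‖g z.1 ξ * (starRingEnd ℂ) (g z.2 ξ)‖ₑ ≤
      (J ×ˢ J).indicator (fun _ => B + B) z := by
    intro z
    by_cases hz : z ∈ J ×ˢ J
    · rw [indicator_of_mem hz]
      calc _ ≤ ∫⁻ ξ, (‖g z.1 ξ‖ₑ ^ 2 + ‖g z.2 ξ‖ₑ ^ 2) := by
            refine lintegral_mono fun ξ => ?_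
            simp only [enorm_mul, RCLike.enorm_conj]
            rcases le_total ‖g z.1 ξ‖ₑ ‖g z.2 ξ‖ₑ with h1 | h1
            · calc _ ≤ ‖g z.2 ξ‖ₑ * ‖g z.2 ξ‖ₑ := by gcongr
                _ ≤ _ := by rw [← sq]; exact le_add_self
            · calc _ ≤ ‖g z.1 ξ‖ₑ * ‖g z.1 ξ‖ₑ := by gcongr
                _ ≤ _ := by rw [← sq]; exact le_self_add
        _ ≤ B + B := by
            have hgm : Measurable (g z.1) := hm.comp measurable_prodMk_left
            rw [lintegral_add_left (hgm.enorm.pow_const _)]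
            exact add_le_add (hg _) (hg _)
    · have : z.1 ∉ J ∨ z.2 ∉ J := by
        by_contra hc; push Not at hc; exact hz ⟨hc.1, hc.2⟩
      rcases this with h1 | h1
      · simp [h0 _ h1]
      · simp [h0 _ h1]
  refine (lintegral_mono hbound).trans_lt ?_
  rw [lintegral_indicator (hJ.prod hJ), setLIntegral_const, Measure.prod_prod]
  exact ENNReal.mul_lt_top (ENNReal.add_lt_top.2 ⟨hB, hB⟩) (ENNReal.mul_lt_top hJt hJt)

/-- A bounded measurable function on `ℝ × E` that vanishes off a rectangle of finite measure. -/
structure BoundedOnBox (F : ℝ → E → ℂ) (J : Set ℝ) (K : Set E) (M : ℝ) : Prop where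
  measurable : Measurable (Function.uncurry F)
  measurableSet_left : MeasurableSet J
  measurableSet_right : MeasurableSet K
  left_lt_top : volume J < ∞
  right_lt_top : volume K < ∞
  bound : ∀ t x, ‖F t x‖ ≤ M
  zero_left : ∀ t, t ∉ J → ∀ x, F t x = 0
  zero_right : ∀ t x, x ∉ K → F t x = 0

namespace BoundedOnBox

variable {F : ℝ → E → ℂ} {J : Set ℝ} {K : Set E} {M : ℝ}

theorem measurable_right (h : BoundedOnBox F J K M) (t : ℝ) : Measurable (F t) :=
  h.measurable.comp measurable_prodMk_left

theorem enorm_rpow_le (h : BoundedOnBox F J K M) {s : ℝ} (hs : 0 < s) (t : ℝ) (x : E) :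
    ‖F t x‖ₑ ^ s ≤ K.indicator (fun _ => ENNReal.ofReal M ^ s) x := by
  by_cases hx : x ∈ K
  · rw [indicator_of_mem hx, ← ofReal_norm]
    gcongr; exact h.bound t x
  · simp [hx, h.zero_right t x hx, ENNReal.zero_rpow_of_pos hs]

theorem lintegral_rpow_le (h : BoundedOnBox F J K M) {s : ℝ} (hs : 0 < s) (t : ℝ) :
    ∫⁻ x, ‖F t x‖ₑ ^ s ≤ ENNReal.ofReal M ^ s * volume K := by
  refine (lintegral_mono (h.enorm_rpow_le hs t)).trans ?_
  rw [lintegral_indicator h.measurableSet_right, setLIntegral_const]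

theorem lintegral_rpow_ne_top (h : BoundedOnBox F J K M) {s : ℝ} (hs : 0 < s) (t : ℝ) :
    ∫⁻ x, ‖F t x‖ₑ ^ s ≠ ∞ :=
  ((h.lintegral_rpow_le hs t).trans_lt (ENNReal.mul_lt_top
    (ENNReal.rpow_lt_top_of_nonneg hs.le ENNReal.ofReal_ne_top) h.right_lt_top)).ne

theorem integrable_right (h : BoundedOnBox F J K M) (t : ℝ) : Integrable (F t) := by
  refine ⟨(h.measurable_right t).aestronglyMeasurable, ?_⟩
  have := h.lintegral_rpow_ne_top zero_lt_one t
  simp only [ENNReal.rpow_one] at this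
  exact lt_top_iff_ne_top.2 this

theorem lintegral_sq_le (h : BoundedOnBox F J K M) (t : ℝ) :
    ∫⁻ x, ‖F t x‖ₑ ^ 2 ≤ ENNReal.ofReal M ^ 2 * volume K := by
  have := h.lintegral_rpow_le (zero_lt_two) t
  simpa only [ENNReal.rpow_two] using this

theorem memLp_right (h : BoundedOnBox F J K M) (t : ℝ) : MemLp (F t) 2 := by
  refine ⟨(h.measurable_right t).aestronglyMeasurable, ?_⟩
  have h2 : eLpNorm (F t) 2 ^ 2 < ∞ := by
    rw [eLpNorm_two_sq]
    exact (h.lintegral_sq_le t).trans_lt (ENNReal.mul_lt_top (by simp) h.right_lt_top)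
  by_contra hc
  rw [not_lt, top_le_iff] at hc
  simp [hc] at h2

theorem fourier_eq_zero (h : BoundedOnBox F J K M) {t : ℝ} (ht : t ∉ J) (ξ : E) :
    𝓕 (F t) ξ = 0 := by
  rw [Real.fourier_eq]; simp [h.zero_left t ht]

theorem norm_fourier_le (h : BoundedOnBox F J K M) (t : ℝ) (ξ : E) :
    ‖𝓕 (F t) ξ‖ ≤ J.indicator (fun _ => M * (volume K).toReal) t := by
  by_cases ht : t ∈ J
  · rw [indicator_of_mem ht]
    refine (BilinearStrichartz.norm_fourier_le _ _).trans ?_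
    calc ∫ y, ‖F t y‖ ≤ ∫ y, K.indicator (fun _ => M) y := by
          refine integral_mono (h.integrable_right t).norm ?_ fun y => ?_
          · exact (integrable_indicator_iff h.measurableSet_right).2
              (integrableOn_const h.right_lt_top.ne)
          · by_cases hy : y ∈ K
            · simpa [hy] using h.bound t y
            · simp [hy, h.zero_right t y hy]
      _ = _ := by
          rw [integral_indicator h.measurableSet_right, setIntegral_const, smul_eq_mul, mul_comm]
          rfl
  · simp [ht, h.fourier_eq_zero ht]

theorem conj_neg (h : BoundedOnBox F J K M) (t : ℝ) :
    Integrable (fun x => (starRingEnd ℂ) (F t (-x))) ∧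
      MemLp (fun x => (starRingEnd ℂ) (F t (-x))) 2 := by
  have hm : Measurable fun x => (starRingEnd ℂ) (F t (-x)) :=
    Complex.continuous_conj.measurable.comp ((h.measurable_right t).comp measurable_neg)
  constructor
  · refine ((h.integrable_right t).comp_neg).mono hm.aestronglyMeasurable ?_
    exact Eventually.of_forall fun x => by simp
  · have h1 : MemLp (fun x => F t (-x)) 2 :=
      (h.memLp_right t).comp_measurePreserving (Measure.measurePreserving_neg volume)
    exact h1.mono hm.aestronglyMeasurable (Eventually.of_forall fun x => by simp)

/-- The Fubini argument behind the `T T*` identity. -/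
theorem integrable_kernel (h : BoundedOnBox F J K M) :
    Integrable (fun z : E × (ℝ × ℝ) =>
      evol z.2.1 z.1 * 𝓕 (F z.2.1) z.1 * (starRingEnd ℂ) (evol z.2.2 z.1 * 𝓕 (F z.2.2) z.1))
      ((volume : Measure E).prod ((volume : Measure ℝ).prod (volume : Measure ℝ))) := by
  have hm : Measurable (Function.uncurry fun (t : ℝ) (ξ : E) => evol t ξ * 𝓕 (F t) ξ) :=
    continuous_evol.measurable.mul (stronglyMeasurable_fourier h.measurable).measurable
  refine integrable_mul_conj (fun (t : ℝ) (ξ : E) => evol t ξ * 𝓕 (F t) ξ) hm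
    (B := ENNReal.ofReal M ^ 2 * volume K) h.measurableSet_left h.left_lt_top
    (ENNReal.mul_lt_top (by simp) h.right_lt_top) (fun t => ?_) (fun t ht ξ => ?_)
  · simp only [enorm_mul, enorm_evol, one_mul]
    exact (lintegral_fourier_sq_le (h.integrable_right t)).trans (h.lintegral_sq_le t)
  · rw [h.fourier_eq_zero ht, mul_zero]

/-- The `T T*` identity: the square of a time integral is a double time integral, and Fubini moves
the frequency integral inside, where the dispersive estimate can be applied. -/
theorem lintegral_sq_eq (h : BoundedOnBox F J K M) :
    ∫⁻ ξ, ‖∫ t, evol t ξ * 𝓕 (F t) ξ‖ₑ ^ 2 = ‖∫ z : ℝ × ℝ, ∫ ξ : E,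
      evol z.1 ξ * 𝓕 (F z.1) ξ * (starRingEnd ℂ) (evol z.2 ξ * 𝓕 (F z.2) ξ)‖ₑ := by
  have hint := h.integrable_kernel
  have hprod : ∀ ξ : E, ∫ z : ℝ × ℝ, evol z.1 ξ * 𝓕 (F z.1) ξ *
      (starRingEnd ℂ) (evol z.2 ξ * 𝓕 (F z.2) ξ) =
      ((‖∫ t, evol t ξ * 𝓕 (F t) ξ‖ ^ 2 : ℝ) : ℂ) := by
    intro ξ
    rw [Measure.volume_eq_prod, integral_prod_mul (f := fun t => evol t ξ * 𝓕 (F t) ξ)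
      (g := fun s => (starRingEnd ℂ) (evol s ξ * 𝓕 (F s) ξ)), integral_conj, Complex.mul_conj']
    push_cast; rfl
  have hint1 := hint.integral_prod_left
  have hsw := integral_integral_swap (f := fun (ξ : E) (z : ℝ × ℝ) =>
    evol z.1 ξ * 𝓕 (F z.1) ξ * (starRingEnd ℂ) (evol z.2 ξ * 𝓕 (F z.2) ξ)) hint
  rw [Measure.volume_eq_prod] at hprod ⊢
  rw [← hsw]
  simp only [hprod] at hint1 ⊢
  rw [integral_complex_ofReal, ← ofReal_norm, Complex.norm_real, Real.norm_of_nonneg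
    (integral_nonneg fun ξ => by positivity), ofReal_integral_eq_lintegral_ofReal]
  · refine lintegral_congr fun ξ => ?_
    rw [ENNReal.ofReal_pow (norm_nonneg _), ofReal_norm]
  · simpa using hint1.norm
  · exact Eventually.of_forall fun ξ => by positivity

end BoundedOnBox

/-- The dual Strichartz estimate for bounded functions on boxes. -/
theorem dualStrichartz {r pr q p : ℝ} (hr : 2 < r) (hpr : 1 < pr) (hprr : (pr - 1) * (r - 1) = 1)
    (hq : 2 < q) (hp : p = q / (q - 1))
    (hadm : Module.finrank ℝ E * (1 / 2 - 1 / r) = 2 / q) :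
    ∃ C : ℝ≥0, ∀ (F : ℝ → E → ℂ) (J : Set ℝ) (K : Set E) (M : ℝ), BoundedOnBox F J K M →
      ∫⁻ ξ, ‖∫ t, evol t ξ * 𝓕 (F t) ξ‖ₑ ^ 2 ≤
        C * (∫⁻ t, ((∫⁻ x, ‖F t x‖ₑ ^ pr) ^ (1 / pr)) ^ p) ^ (2 / p) := by
  obtain ⟨C₁, hC₁⟩ := dispersive (E := E) hr hpr hprr
  obtain ⟨C₂, hC₂⟩ := hardyLittlewoodSobolev hq hp
  have hq1 : 0 < q - 1 := by linarith
  have hp1 : 0 < p := by rw [hp]; positivity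
  refine ⟨C₁ * C₂, fun F J K M h => ?_⟩
  set h' : ℝ → ℝ≥0∞ := fun t => (∫⁻ x, ‖F t x‖ₑ ^ pr) ^ (1 / pr) with hh'
  have hfin : ∀ t, h' t ≠ ∞ := fun t => ENNReal.rpow_ne_top_of_nonneg (by positivity)
    (h.lintegral_rpow_ne_top (by linarith) t)
  have hmeas : Measurable h' :=
    (Measurable.lintegral_prod_right (h.measurable.enorm.pow_const pr)).pow_const _
  have hof : ∀ t, ENNReal.ofReal (h' t).toReal = h' t := fun t => ENNReal.ofReal_toReal (hfin t)
  -- Conjugation reverses the evolution at time `s`, so only the time difference `t - s` enters the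
  -- dispersive bound; admissibility turns its decay rate into `2/q`.
  have hpair : ∀ t s : ℝ, t ≠ s → ‖∫ ξ : E, evol t ξ * 𝓕 (F t) ξ *
      (starRingEnd ℂ) (evol s ξ * 𝓕 (F s) ξ)‖ₑ ≤
      C₁ * (ENNReal.ofReal (h' s).toReal * ENNReal.ofReal (h' t).toReal *
        ENNReal.ofReal (|t - s| ^ (-(2 / q)))) := by
    intro t s hts
    have e : ∀ ξ : E, evol t ξ * 𝓕 (F t) ξ * (starRingEnd ℂ) (evol s ξ * 𝓕 (F s) ξ) =
        evol (t - s) ξ * 𝓕 (F t) ξ * 𝓕 (fun x => (starRingEnd ℂ) (F s (-x))) ξ := by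
      intro ξ
      rw [fourier_conj_neg, map_mul, conj_evol, sub_eq_add_neg, evol_add]; ring
    simp only [e]
    refine (hC₁ _ _ (h.integrable_right t) (h.memLp_right t) (h.conj_neg s).1 (h.conj_neg s).2
      (t - s) (sub_ne_zero.2 hts)).trans (le_of_eq ?_)
    have e2 : ∫⁻ x, ‖(starRingEnd ℂ) (F s (-x))‖ₑ ^ pr = ∫⁻ x, ‖F s x‖ₑ ^ pr := by
      rw [← lintegral_neg_eq_self]; simp
    rw [e2, hadm, hof, hof]; ring
  rw [h.lintegral_sq_eq]
  refine (enorm_integral_le_lintegral_enorm _).trans ?_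
  calc ∫⁻ z : ℝ × ℝ, ‖∫ ξ : E, evol z.1 ξ * 𝓕 (F z.1) ξ *
        (starRingEnd ℂ) (evol z.2 ξ * 𝓕 (F z.2) ξ)‖ₑ
      ≤ ∫⁻ z : ℝ × ℝ, C₁ * (ENNReal.ofReal (h' z.2).toReal * ENNReal.ofReal (h' z.1).toReal *
        ENNReal.ofReal (|z.1 - z.2| ^ (-(2 / q)))) := by
        refine lintegral_mono_ae ?_
        have hdiag : ∀ᵐ z : ℝ × ℝ, z.1 ≠ z.2 := by
          rw [Measure.volume_eq_prod, Measure.ae_prod_iff_ae_ae]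
          · refine Eventually.of_forall fun t => ?_
            have : ∀ᵐ s : ℝ, s ≠ t := by simp [ae_iff]
            filter_upwards [this] with s hs using hs.symm
          · exact (measurableSet_eq_fun measurable_fst measurable_snd).compl
        filter_upwards [hdiag] with z hz using hpair z.1 z.2 hz
    _ = C₁ * ∫⁻ s, ∫⁻ t, ENNReal.ofReal (h' s).toReal * ENNReal.ofReal (h' t).toReal *
        ENNReal.ofReal (|t - s| ^ (-(2 / q))) := by
        rw [lintegral_const_mul' _ _ ENNReal.coe_ne_top, Measure.volume_eq_prod,
          lintegral_prod_symm]
        refine Measurable.aemeasurable ?_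
        have h1 : Measurable fun t => (h' t).toReal := hmeas.ennreal_toReal
        fun_prop
    _ ≤ C₁ * (C₂ * (∫⁻ t, ENNReal.ofReal ((h' t).toReal ^ p)) ^ (2 / p)) := by
        gcongr
        exact hC₂ _ hmeas.ennreal_toReal fun t => ENNReal.toReal_nonneg
    _ = _ := by
        have : ∀ t, ENNReal.ofReal ((h' t).toReal ^ p) = h' t ^ p := fun t => by
          rw [← ENNReal.ofReal_rpow_of_nonneg ENNReal.toReal_nonneg hp1.le, hof]
        simp only [this]
        rw [ENNReal.coe_mul, mul_assoc]

end Strichartz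

/-! ### The homogeneous Strichartz estimate for one pair -/

section Strichartz

open Filter Topology

variable {E : Type*} [NormedAddCommGroup E] [InnerProductSpace ℝ E] [FiniteDimensional ℝ E]
  [MeasurableSpace E] [BorelSpace E]

/-- The free evolution of the frequency profile `ψ`. -/
def freeWave (ψ : E → ℂ) (t : ℝ) (x : E) : ℂ := 𝓕 (fun ξ => evol t ξ * ψ ξ) x

theorem norm_freeWave_le (ψ : E → ℂ) (t : ℝ) (x : E) : ‖freeWave ψ t x‖ ≤ ∫ ξ, ‖ψ ξ‖ := by
  refine (norm_fourier_le _ _).trans (le_of_eq ?_)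
  simp [norm_evol]

theorem freeWave_congr {ψ φ : E → ℂ} (h : ψ =ᵐ[volume] φ) : freeWave ψ = freeWave φ := by
  funext t x
  refine Real.fourier_congr_ae ?_ x
  filter_upwards [h] with ξ hξ
  rw [hξ]

theorem stronglyMeasurable_freeWave {ψ : E → ℂ} (hψ : AEStronglyMeasurable ψ) :
    StronglyMeasurable (fun z : ℝ × E => freeWave ψ z.1 z.2) := by
  rw [freeWave_congr hψ.ae_eq_mk]
  exact stronglyMeasurable_fourier (F := fun (t : ℝ) ξ => evol t ξ * hψ.mk ψ ξ)
    (continuous_evol.measurable.mul (hψ.stronglyMeasurable_mk.measurable.comp measurable_snd))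

theorem measurable_freeWave {ψ : E → ℂ} (hψ : AEStronglyMeasurable ψ) :
    Measurable (Function.uncurry (freeWave ψ)) :=
  (stronglyMeasurable_freeWave hψ).measurable

theorem lintegral_freeWave_sq_le {ψ : E → ℂ} (hψ : Integrable ψ) (t : ℝ) :
    ∫⁻ x, ‖freeWave ψ t x‖ₑ ^ 2 ≤ ∫⁻ ξ, ‖ψ ξ‖ₑ ^ 2 := by
  refine (lintegral_fourier_sq_le (integrable_evol_mul hψ t)).trans (le_of_eq ?_)
  simp [enorm_mul, enorm_evol]

namespace BoundedOnBox

variable {F : ℝ → E → ℂ} {J : Set ℝ} {K : Set E} {M : ℝ}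

/-- Adjointness: it transfers a bound for the time-integrated operator of `dualStrichartz` to the
free evolution. -/
theorem integral_mul_freeWave (h : BoundedOnBox F J K M) {ψ : E → ℂ} (hψ : Integrable ψ) :
    ∫ t, ∫ x, F t x * freeWave ψ t x = ∫ ξ, ψ ξ * ∫ t, evol t ξ * 𝓕 (F t) ξ := by
  have h1 : ∀ t, ∫ x, F t x * freeWave ψ t x = ∫ ξ, 𝓕 (F t) ξ * (evol t ξ * ψ ξ) := fun t =>
    (integral_mul_fourier (h.integrable_right t) (integrable_evol_mul hψ t)).symm
  simp only [h1]
  rw [integral_integral_swap]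
  · refine integral_congr_ae (Eventually.of_forall fun ξ => ?_)
    simp only
    rw [← integral_const_mul]
    exact integral_congr_ae (Eventually.of_forall fun t => by ring)
  · have hJ : Integrable (J.indicator (fun _ => M * (volume K).toReal)) :=
      (integrable_indicator_iff h.measurableSet_left).2 (integrableOn_const h.left_lt_top.ne)
    refine (hJ.mul_prod hψ.norm).mono' ?_ ?_
    · exact (stronglyMeasurable_fourier h.measurable).aestronglyMeasurable.mul
        (continuous_evol.aestronglyMeasurable.mul hψ.1.comp_snd)
    · refine Eventually.of_forall fun z => ?_
      simp only [Function.uncurry, norm_mul, norm_evol, one_mul]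
      exact mul_le_mul_of_nonneg_right (h.norm_fourier_le _ _) (norm_nonneg _)

end BoundedOnBox

set_option maxHeartbeats 800000 in
/-- The Strichartz estimate on a box away from the times at which the wave is small. -/
theorem strichartz_box {r pr q p : ℝ} (hr : 2 < r) (hpr : 1 < pr) (hprr : (pr - 1) * (r - 1) = 1)
    (hq : 2 < q) (hp : p = q / (q - 1)) {C : ℝ≥0}
    (hC : ∀ (F : ℝ → E → ℂ) (J : Set ℝ) (K : Set E) (M : ℝ), BoundedOnBox F J K M →
      ∫⁻ ξ, ‖∫ t, evol t ξ * 𝓕 (F t) ξ‖ₑ ^ 2 ≤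
        C * (∫⁻ t, ((∫⁻ x, ‖F t x‖ₑ ^ pr) ^ (1 / pr)) ^ p) ^ (2 / p))
    {ψ : E → ℂ} (hψ : Integrable ψ) {J : Set ℝ} {K : Set E} (hJ : MeasurableSet J)
    (hK : MeasurableSet K) (hJt : volume J < ∞) (hKt : volume K < ∞) {κ : ℝ} (hκ : 0 < κ)
    (hJκ : ∀ t ∈ J, ENNReal.ofReal κ ≤ ∫⁻ x in K, ‖freeWave ψ t x‖ₑ ^ r) :
    ∫⁻ t in J, (∫⁻ x in K, ‖freeWave ψ t x‖ₑ ^ r) ^ (q / r) ≤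
      (C * ∫⁻ ξ, ‖ψ ξ‖ₑ ^ 2) ^ (q / 2) := by
  have hr0 : 0 < r := by linarith
  have hq0 : 0 < q := by linarith
  have hq1 : 0 < q - 1 := by linarith
  have hp0 : 0 < p := by rw [hp]; positivity
  set G := freeWave ψ
  have hG : Measurable (Function.uncurry G) := measurable_freeWave hψ.1
  have hGt : ∀ t, Measurable (G t) := fun t => hG.of_uncurry_left
  set B : ℝ := ∫ ξ, ‖ψ ξ‖
  have hB0 : 0 ≤ B := integral_nonneg fun _ => norm_nonneg _
  have hGB : ∀ t x, ‖G t x‖ ≤ B := norm_freeWave_le ψ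
  set N : ℝ → ℝ≥0∞ := fun t => ∫⁻ x in K, ‖G t x‖ₑ ^ r
  have hNm : Measurable N := Measurable.lintegral_prod_right (hG.enorm.pow_const r)
  set D : ℝ := B ^ r * (volume K).toReal
  have hND : ∀ t, N t ≤ ENNReal.ofReal D := fun t => by
    calc N t ≤ ∫⁻ x in K, ENNReal.ofReal (B ^ r) := by
          refine lintegral_mono fun x => ?_
          rw [← ofReal_norm, ENNReal.ofReal_rpow_of_nonneg (norm_nonneg _) hr0.le]
          exact ENNReal.ofReal_le_ofReal (Real.rpow_le_rpow (norm_nonneg _) (hGB t x) hr0.le)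
      _ = _ := by
          rw [setLIntegral_const, ENNReal.ofReal_mul (by positivity), ENNReal.ofReal_toReal hKt.ne]
  have hNt : ∀ t, N t ≠ ∞ := fun t => ((hND t).trans_lt ENNReal.ofReal_lt_top).ne
  set n : ℝ → ℝ := fun t => (N t).toReal
  have hnN : ∀ t, ENNReal.ofReal (n t) = N t := fun t => ENNReal.ofReal_toReal (hNt t)
  have hn0 : ∀ t, 0 ≤ n t := fun t => ENNReal.toReal_nonneg
  have hnκ : ∀ t ∈ J, κ ≤ n t := fun t ht =>
    (ENNReal.ofReal_le_iff_le_toReal (hNt t)).1 (hJκ t ht)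
  have hnD : ∀ t, n t ≤ D := fun t => ENNReal.toReal_le_of_le_ofReal (by positivity) (hND t)
  have hnm : Measurable n := hNm.ennreal_toReal
  have hnI : ∀ t, ∫ x in K, ‖G t x‖ ^ r = n t := fun t => by
    rw [integral_eq_lintegral_of_nonneg_ae (Eventually.of_forall fun x => by positivity)
      ((hGt t).norm.pow_const r).aestronglyMeasurable]
    congr 1
    refine lintegral_congr fun x => ?_
    rw [← ofReal_norm, ENNReal.ofReal_rpow_of_nonneg (norm_nonneg _) hr0.le]
  -- `F` below is the extremiser of the duality between mixed norms, cut off to `J × K`: its pairing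
  -- with `G` and the `p`-th power of its dual norm are both equal to `Z`. For `q < r` the exponent
  -- `e` is negative, and the lower bound `κ` keeps `n^e` bounded.
  set e : ℝ := (q - r) / r
  set F : ℝ → E → ℂ := fun t x => J.indicator (fun t => (((n t) ^ e : ℝ) : ℂ)) t *
    K.indicator (fun x => ((‖G t x‖ ^ (r - 2) : ℝ) : ℂ) * (starRingEnd ℂ) (G t x)) x with hFdef
  have hFnorm : ∀ t ∈ J, ∀ x ∈ K, ‖F t x‖ = n t ^ e * ‖G t x‖ ^ (r - 1) := by
    intro t ht x hx
    simp only [hFdef, ht, hx, indicator_of_mem, norm_mul, Complex.norm_real, RCLike.norm_conj]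
    rw [Real.norm_of_nonneg (Real.rpow_nonneg (hn0 t) _),
      Real.norm_of_nonneg (Real.rpow_nonneg (norm_nonneg _) _),
      ← Real.rpow_add_one' (norm_nonneg _) (by linarith)]
    congr 2; ring
  have hbox : BoundedOnBox F J K ((κ ^ e + D ^ e) * B ^ (r - 1)) := by
    have hD0 : 0 ≤ D := by positivity
    refine ⟨?_, hJ, hK, hJt, hKt, ?_, ?_, ?_⟩
    · refine Measurable.mul ?_ ?_
      · exact ((Complex.continuous_ofReal.measurable.comp (hnm.pow_const e)).indicator hJ).comp
          measurable_fst
      · have : Measurable ((Prod.snd ⁻¹' K : Set (ℝ × E)).indicator fun z : ℝ × E =>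
            ((‖G z.1 z.2‖ ^ (r - 2) : ℝ) : ℂ) * (starRingEnd ℂ) (G z.1 z.2)) := by
          refine Measurable.indicator ?_ (measurable_snd hK)
          exact (Complex.continuous_ofReal.measurable.comp (hG.norm.pow_const _)).mul
            (Complex.continuous_conj.measurable.comp hG)
        exact this
    · intro t x
      by_cases ht : t ∈ J
      · by_cases hx : x ∈ K
        · rw [hFnorm t ht x hx]
          refine mul_le_mul ?_ (Real.rpow_le_rpow (norm_nonneg _) (hGB t x) (by linarith))
            (by positivity) (by positivity)
          have hn := hnκ t ht
          rcases le_total 0 e with he | he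
          · exact (Real.rpow_le_rpow (hn0 t) (hnD t) he).trans
              (le_add_of_nonneg_left (by positivity))
          · exact (Real.rpow_le_rpow_of_nonpos hκ hn he).trans
              (le_add_of_nonneg_right (by positivity))
        · simp [hFdef, hx]; positivity
      · simp [hFdef, ht]; positivity
    · intro t ht x; simp [hFdef, ht]
    · intro t x hx; simp [hFdef, hx]
  set Z : ℝ≥0∞ := ∫⁻ t in J, N t ^ (q / r)
  have hZt : Z ≠ ∞ := by
    refine ((lintegral_mono fun t => ENNReal.rpow_le_rpow (hND t) (by positivity :
      0 ≤ q / r)).trans_lt ?_).ne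
    rw [setLIntegral_const]
    exact ENNReal.mul_lt_top (ENNReal.rpow_lt_top_of_nonneg (by positivity) ENNReal.ofReal_ne_top) hJt
  have hpair : ‖∫ t, ∫ x, F t x * G t x‖ₑ = Z := by
    have h1 : ∀ t, ∫ x, F t x * G t x = ((J.indicator (fun t => n t ^ (q / r)) t : ℝ) : ℂ) := by
      intro t
      by_cases ht : t ∈ J
      · have h2 : ∀ x, F t x * G t x = ((n t ^ e * K.indicator (fun x => ‖G t x‖ ^ r) x : ℝ) : ℂ) := by
          intro x
          by_cases hx : x ∈ K
          · simp only [hFdef, ht, hx, indicator_of_mem]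
            rw [mul_assoc, mul_assoc, mul_comm ((starRingEnd ℂ) (G t x)), Complex.mul_conj']
            push_cast
            congr 1
            norm_cast
            rw [← Real.rpow_natCast, ← Real.rpow_add_of_nonneg (norm_nonneg _) (by linarith)
              (by norm_num)]
            congr 1; push_cast; ring
          · simp [hFdef, hx]
        simp only [h2]
        rw [integral_complex_ofReal, integral_const_mul, integral_indicator hK, hnI,
          indicator_of_mem ht]
        congr 1
        have hnp : 0 < n t := hκ.trans_le (hnκ t ht)
        rw [← Real.rpow_add_one hnp.ne']
        congr 1; simp only [e]; field_simp; ring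
      · simp [hFdef, ht]
    simp only [h1]
    rw [integral_complex_ofReal, ← ofReal_norm, Complex.norm_real, Real.norm_of_nonneg
      (integral_nonneg fun t => indicator_nonneg (fun t _ => Real.rpow_nonneg (hn0 t) _) t),
      integral_indicator hJ, integral_eq_lintegral_of_nonneg_ae
        (Eventually.of_forall fun t => Real.rpow_nonneg (hn0 t) _)
        (hnm.pow_const _).aestronglyMeasurable]
    have h3 : ∫⁻ t in J, ENNReal.ofReal (n t ^ (q / r)) = Z := by
      refine lintegral_congr fun t => ?_
      rw [← ENNReal.ofReal_rpow_of_nonneg (hn0 t) (by positivity), hnN]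
    rw [h3, ENNReal.ofReal_toReal hZt]
  have hFZ : ∫⁻ t, ((∫⁻ x, ‖F t x‖ₑ ^ pr) ^ (1 / pr)) ^ p = Z := by
    have hZJ : Z = ∫⁻ t, J.indicator (fun t => N t ^ (q / r)) t := (lintegral_indicator hJ _).symm
    rw [hZJ]
    refine lintegral_congr fun t => ?_
    by_cases ht : t ∈ J
    · rw [indicator_of_mem ht]
      have hnp : 0 < n t := hκ.trans_le (hnκ t ht)
      have h1 : ∫⁻ x, ‖F t x‖ₑ ^ pr = ENNReal.ofReal (n t ^ (e * pr)) * N t := by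
        rw [← lintegral_const_mul' _ _ ENNReal.ofReal_ne_top, ← lintegral_indicator hK]
        refine lintegral_congr fun x => ?_
        by_cases hx : x ∈ K
        · rw [indicator_of_mem hx, ← ofReal_norm, hFnorm t ht x hx,
            ENNReal.ofReal_rpow_of_nonneg (by positivity) (by linarith),
            Real.mul_rpow (by positivity) (by positivity), ← Real.rpow_mul hnp.le,
            ← Real.rpow_mul (norm_nonneg _), ENNReal.ofReal_mul (by positivity),
            show (r - 1) * pr = r by linarith, ← ofReal_norm,
            ENNReal.ofReal_rpow_of_nonneg (norm_nonneg _) hr0.le]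
        · rw [indicator_of_notMem hx, hbox.zero_right t x hx]
          simp [ENNReal.zero_rpow_of_pos (zero_lt_one.trans hpr)]
      rw [h1, ← hnN t, ← ENNReal.ofReal_mul (by positivity), ← Real.rpow_add_one hnp.ne',
        ← ENNReal.rpow_mul, ENNReal.ofReal_rpow_of_pos (by positivity),
        ENNReal.ofReal_rpow_of_pos hnp, ← Real.rpow_mul hnp.le]
      congr 2
      have hprr' : 1 / pr = (r - 1) / r := by field_simp; linarith
      have : (e * pr + 1) * (1 / pr * p) = (e + 1 / pr) * p := by field_simp
      rw [this, hprr', hp]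
      simp only [e]; field_simp; ring
    · rw [indicator_of_notMem ht]
      have : ∀ x, ‖F t x‖ₑ ^ pr = 0 := fun x => by
        rw [hbox.zero_left t ht x]; simp [ENNReal.zero_rpow_of_pos (zero_lt_one.trans hpr)]
      simp only [this, lintegral_zero]
      rw [ENNReal.zero_rpow_of_pos (by positivity), ENNReal.zero_rpow_of_pos hp0]
  have hQm : AEMeasurable fun ξ : E => ‖∫ t, evol t ξ * 𝓕 (F t) ξ‖ₑ := by
    have : StronglyMeasurable fun z : E × ℝ => evol z.2 z.1 * 𝓕 (F z.2) z.1 :=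
      (continuous_evol.stronglyMeasurable.mul
        (stronglyMeasurable_fourier hbox.measurable)).comp_measurable measurable_swap
    exact this.integral_prod_right'.enorm.aemeasurable
  -- The right-hand side contains `Z^(1/p)`, which is finite because of the box; dividing by it
  -- leaves `Z^(1/q)` on the left.
  have hmain : Z ≤ (∫⁻ ξ, ‖ψ ξ‖ₑ ^ 2) ^ (1 / 2 : ℝ) * (C * Z ^ (2 / p)) ^ (1 / 2 : ℝ) := by
    calc Z = ‖∫ t, ∫ x, F t x * G t x‖ₑ := hpair.symm
      _ = ‖∫ ξ, ψ ξ * ∫ t, evol t ξ * 𝓕 (F t) ξ‖ₑ := by rw [hbox.integral_mul_freeWave hψ]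
      _ ≤ ∫⁻ ξ, ((fun ξ => ‖ψ ξ‖ₑ) * fun ξ => ‖∫ t, evol t ξ * 𝓕 (F t) ξ‖ₑ) ξ := by
          refine (enorm_integral_le_lintegral_enorm _).trans (le_of_eq ?_)
          exact lintegral_congr fun ξ => by simp [enorm_mul]
      _ ≤ (∫⁻ ξ, ‖ψ ξ‖ₑ ^ (2 : ℝ)) ^ (1 / 2 : ℝ) *
          (∫⁻ ξ, ‖∫ t, evol t ξ * 𝓕 (F t) ξ‖ₑ ^ (2 : ℝ)) ^ (1 / 2 : ℝ) :=
          ENNReal.lintegral_mul_le_Lp_mul_Lq _ Real.HolderConjugate.two_two hψ.1.enorm hQm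
      _ ≤ _ := by
          simp only [ENNReal.rpow_two]
          gcongr
          rw [← hFZ]
          exact hC F J K _ hbox
  change Z ≤ _
  obtain hZ0 | hZ0 := eq_or_ne Z 0
  · rw [hZ0]; exact zero_le
  have hsplit : (∫⁻ ξ, ‖ψ ξ‖ₑ ^ 2) ^ (1 / 2 : ℝ) * (C * Z ^ (2 / p)) ^ (1 / 2 : ℝ) =
      (C * ∫⁻ ξ, ‖ψ ξ‖ₑ ^ 2) ^ (1 / 2 : ℝ) * Z ^ (1 / p) := by
    rw [ENNReal.mul_rpow_of_nonneg _ _ (by norm_num), ENNReal.mul_rpow_of_nonneg _ _ (by norm_num),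
      ← ENNReal.rpow_mul, show 2 / p * (1 / 2) = 1 / p by ring]
    ring
  rw [hsplit] at hmain
  have hZp0 : Z ^ (1 / p) ≠ 0 := by simp [ENNReal.rpow_eq_zero_iff, hZ0, hZt]
  have hZpt : Z ^ (1 / p) ≠ ∞ := ENNReal.rpow_ne_top_of_nonneg (by positivity) hZt
  have h4 : Z ^ (1 / q) ≤ (C * ∫⁻ ξ, ‖ψ ξ‖ₑ ^ 2) ^ (1 / 2 : ℝ) := by
    have : Z ^ (1 / q) * Z ^ (1 / p) = Z := by
      rw [← ENNReal.rpow_add _ _ hZ0 hZt]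
      have : 1 / q + 1 / p = 1 := by rw [hp]; field_simp; ring
      rw [this, ENNReal.rpow_one]
    exact (ENNReal.mul_le_mul_iff_left hZp0 hZpt).1 (this.trans_le hmain)
  calc Z = (Z ^ (1 / q)) ^ q := by
        rw [← ENNReal.rpow_mul, one_div_mul_cancel hq0.ne', ENNReal.rpow_one]
    _ ≤ ((C * ∫⁻ ξ, ‖ψ ξ‖ₑ ^ 2) ^ (1 / 2 : ℝ)) ^ q := by gcongr
    _ = _ := by rw [← ENNReal.rpow_mul]; congr 1; ring

/-- The Strichartz estimate for one pair of finite exponents. -/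
theorem strichartz_finite {r pr q : ℝ} (hr : 2 < r) (hpr : 1 < pr)
    (hprr : (pr - 1) * (r - 1) = 1) (hq : 2 < q)
    (hadm : Module.finrank ℝ E * (1 / 2 - 1 / r) = 2 / q) :
    ∃ C : ℝ≥0, ∀ ψ : E → ℂ, Integrable ψ →
      ∫⁻ t, (∫⁻ x, ‖freeWave ψ t x‖ₑ ^ r) ^ (q / r) ≤ (C * ∫⁻ ξ, ‖ψ ξ‖ₑ ^ 2) ^ (q / 2) := by
  obtain ⟨C, hC⟩ := dualStrichartz (E := E) hr hpr hprr hq rfl hadm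
  refine ⟨C, fun ψ hψ => ?_⟩
  have hr0 : 0 < r := by linarith
  have hq0 : 0 < q := by linarith
  have hG := measurable_freeWave hψ.1
  set K : ℕ → Set E := fun k => Metric.closedBall 0 k
  set N : ℕ → ℝ → ℝ≥0∞ := fun k t => ∫⁻ x in K k, ‖freeWave ψ t x‖ₑ ^ r
  have hNm : ∀ k, Measurable (N k) := fun k =>
    Measurable.lintegral_prod_right (hG.enorm.pow_const r)
  -- Every time at which the wave is non-zero eventually lies in `J k`, and other times contribute
  -- nothing, so Fatou's lemma recovers the whole norm.
  set J : ℕ → Set ℝ := fun k => Icc (-(k : ℝ)) k ∩ {t | ENNReal.ofReal (1 / (k + 1)) ≤ N k t}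
  have hJm : ∀ k, MeasurableSet (J k) := fun k =>
    measurableSet_Icc.inter (measurableSet_le measurable_const (hNm k))
  have hKmono : Monotone K := fun a b hab => Metric.closedBall_subset_closedBall (by exact_mod_cast hab)
  have hNlim : ∀ t, Tendsto (fun k => N k t) atTop (𝓝 (∫⁻ x, ‖freeWave ψ t x‖ₑ ^ r)) := by
    intro t
    have h1 : ∀ k, N k t = (volume.withDensity fun x => ‖freeWave ψ t x‖ₑ ^ r) (K k) := fun k =>
      (withDensity_apply _ Metric.isClosed_closedBall.measurableSet).symm
    have h2 : ∫⁻ x, ‖freeWave ψ t x‖ₑ ^ r =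
        (volume.withDensity fun x => ‖freeWave ψ t x‖ₑ ^ r) (⋃ k, K k) := by
      rw [Metric.iUnion_closedBall_nat, withDensity_apply _ MeasurableSet.univ, setLIntegral_univ]
    simp only [h1, h2]
    exact tendsto_measure_iUnion_atTop hKmono
  set f : ℕ → ℝ → ℝ≥0∞ := fun k => (J k).indicator fun t => N k t ^ (q / r)
  have hlim : ∀ t, (∫⁻ x, ‖freeWave ψ t x‖ₑ ^ r) ^ (q / r) ≤ liminf (fun k => f k t) atTop := by
    intro t
    obtain h0 | h0 := eq_or_ne (∫⁻ x, ‖freeWave ψ t x‖ₑ ^ r) 0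
    · rw [h0, ENNReal.zero_rpow_of_pos (by positivity)]; exact zero_le
    have hlimN := hNlim t
    obtain ⟨c, hc0, hc⟩ := ENNReal.lt_iff_exists_real_btwn.1 (pos_iff_ne_zero.2 h0)
    have hcpos : 0 < c := by
      have := hc.1; simpa using this
    have ev1 : ∀ᶠ k in atTop, ENNReal.ofReal c < N k t := hlimN.eventually (lt_mem_nhds hc.2)
    have ev2 : ∀ᶠ k : ℕ in atTop, 1 / ((k : ℝ) + 1) < c :=
      tendsto_one_div_add_atTop_nhds_zero_nat.eventually (gt_mem_nhds hcpos)
    obtain ⟨k₀, hk₀⟩ := exists_nat_ge |t|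
    have ev3 : ∀ᶠ k in atTop, f k t = N k t ^ (q / r) := by
      filter_upwards [ev1, ev2, eventually_ge_atTop k₀] with k h1 h2 h3
      have hmem : t ∈ J k := ⟨abs_le.1 (hk₀.trans (by exact_mod_cast h3)),
        (ENNReal.ofReal_le_ofReal h2.le).trans h1.le⟩
      exact indicator_of_mem hmem _
    have : Tendsto (fun k => f k t) atTop (𝓝 ((∫⁻ x, ‖freeWave ψ t x‖ₑ ^ r) ^ (q / r))) :=
      (((ENNReal.continuous_rpow_const (y := q / r)).tendsto _).comp hlimN).congr'
        (by filter_upwards [ev3] with k hk using hk.symm)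
    exact this.liminf_eq.ge
  calc ∫⁻ t, (∫⁻ x, ‖freeWave ψ t x‖ₑ ^ r) ^ (q / r) ≤ ∫⁻ t, liminf (fun k => f k t) atTop :=
        lintegral_mono hlim
    _ ≤ liminf (fun k => ∫⁻ t, f k t) atTop :=
        lintegral_liminf_le fun k => ((hNm k).pow_const _).indicator (hJm k)
    _ ≤ liminf (fun _ : ℕ => (C * ∫⁻ ξ, ‖ψ ξ‖ₑ ^ 2) ^ (q / 2)) atTop := by
        refine liminf_le_liminf (Eventually.of_forall fun k => ?_)
        rw [lintegral_indicator (hJm k)]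
        refine strichartz_box hr hpr hprr hq rfl hC hψ (hJm k) Metric.isClosed_closedBall.measurableSet
          ?_ measure_closedBall_lt_top (κ := 1 / (k + 1)) (by positivity) fun t ht => ht.2
        exact (measure_mono inter_subset_left).trans_lt measure_Icc_lt_top
    _ = _ := liminf_const _

end Strichartz

/-! ### Strichartz uniformly over the admissible pairs -/

section Strichartz

open Filter Topology

/-- Admissible exponents beyond the endpoint are `(∞, 2)` or real. -/
theorem Admissible.cases {n : ℕ} (hn : 2 ≤ n) {q r : ℝ≥0∞} (h : Admissible n q r) (hq : 2 < q) :
    (q = ∞ ∧ r = 2) ∨ ∃ q' r' : ℝ, q = ENNReal.ofReal q' ∧ r = ENNReal.ofReal r' ∧ 2 < q' ∧ 2 < r' ∧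
      n * (1 / 2 - 1 / r') = 2 / q' := by
  obtain ⟨-, hr2, h3⟩ := h
  have hn0 : (n : ℝ≥0∞) ≠ 0 := by simp; omega
  have hnt : (n : ℝ≥0∞) ≠ ∞ := ENNReal.natCast_ne_top n
  have hnR : (2 : ℝ) ≤ n := by exact_mod_cast hn
  have hr0 : r ≠ 0 := (lt_of_lt_of_le (by norm_num) hr2).ne'
  -- With `r = ∞` admissibility reads `2/q = n/2`, which is impossible for `q > 2` and `n ≥ 2`.
  have hrt : r ≠ ∞ := by
    rintro rfl
    rw [ENNReal.div_top, add_zero] at h3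
    obtain rfl | hqt := eq_or_ne q ∞
    · rw [ENNReal.div_top] at h3
      exact absurd h3.symm (ENNReal.div_ne_zero.2 ⟨hn0, by norm_num⟩)
    · have hq2 : 2 < q.toReal := by
        have := (ENNReal.toReal_lt_toReal (by norm_num) hqt).2 hq; simpa using this
      have h4 := congrArg ENNReal.toReal h3
      simp only [ENNReal.toReal_div, ENNReal.toReal_ofNat, ENNReal.toReal_natCast] at h4
      rw [div_eq_div_iff (by linarith) (by norm_num)] at h4
      nlinarith
  have hrr : 2 ≤ r.toReal := by
    have := (ENNReal.toReal_le_toReal (by norm_num) hrt).2 hr2; simpa using this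
  have hnr : (n : ℝ≥0∞) / r ≠ ∞ := ENNReal.div_ne_top hnt hr0
  obtain rfl | hqt := eq_or_ne q ∞
  · left
    refine ⟨rfl, ?_⟩
    rw [ENNReal.div_top, zero_add] at h3
    have h4 := congrArg ENNReal.toReal h3
    simp only [ENNReal.toReal_div, ENNReal.toReal_ofNat, ENNReal.toReal_natCast] at h4
    rw [div_eq_div_iff (by linarith) (by norm_num)] at h4
    have : r.toReal = 2 := by nlinarith
    rw [← ENNReal.ofReal_toReal hrt, this]; norm_num
  · right
    have hq2 : 2 < q.toReal := by
      have := (ENNReal.toReal_lt_toReal (by norm_num) hqt).2 hq; simpa using this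
    have h4 := congrArg ENNReal.toReal h3
    rw [ENNReal.toReal_add (ENNReal.div_ne_top (by norm_num) (by
      rintro rfl; simp at hq)) hnr] at h4
    simp only [ENNReal.toReal_div, ENNReal.toReal_ofNat, ENNReal.toReal_natCast] at h4
    refine ⟨q.toReal, r.toReal, (ENNReal.ofReal_toReal hqt).symm, (ENNReal.ofReal_toReal hrt).symm,
      hq2, lt_of_le_of_ne hrr fun he => ?_, ?_⟩
    · rw [← he] at h4
      have : 0 < 2 / q.toReal := by positivity
      linarith
    · rw [mul_sub, mul_one_div, mul_one_div]; linarith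

theorem lintegral_rpow_interpolate {α : Type*} [MeasurableSpace α] {μ : Measure α} {f : α → ℝ≥0∞}
    (hf : AEMeasurable f μ) {a b r₀ r₁ : ℝ} (ha : 0 ≤ a) (hb : 0 ≤ b) (hab : a + b = 1)
    (h0 : 0 ≤ r₀) (h1 : 0 ≤ r₁) :
    ∫⁻ x, f x ^ (a * r₀ + b * r₁) ∂μ ≤ (∫⁻ x, f x ^ r₀ ∂μ) ^ a * (∫⁻ x, f x ^ r₁ ∂μ) ^ b := by
  refine le_trans (le_of_eq (lintegral_congr fun x => ?_))
    (ENNReal.lintegral_mul_norm_pow_le (hf.pow_const r₀) (hf.pow_const r₁) ha hb hab)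
  rw [ENNReal.rpow_add_of_nonneg _ _ (by positivity) (by positivity), mul_comm a, mul_comm b,
    ENNReal.rpow_mul, ENNReal.rpow_mul]

theorem eLpNorm_enn {α : Type*} [MeasurableSpace α] {μ : Measure α} (f : α → ℝ≥0∞) {q : ℝ}
    (hq : 0 < q) : eLpNorm f (ENNReal.ofReal q) μ = (∫⁻ t, f t ^ q ∂μ) ^ (1 / q) := by
  rw [eLpNorm_eq_lintegral_rpow_enorm_toReal (by simpa using hq) ENNReal.ofReal_ne_top,
    ENNReal.toReal_ofReal hq.le]
  simp

theorem eLpNorm_real {α : Type*} [MeasurableSpace α] {μ : Measure α} (f : α → ℂ) {q : ℝ}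
    (hq : 0 < q) : eLpNorm f (ENNReal.ofReal q) μ = (∫⁻ t, ‖f t‖ₑ ^ q ∂μ) ^ (1 / q) := by
  rw [eLpNorm_eq_lintegral_rpow_enorm_toReal (by simpa using hq) ENNReal.ofReal_ne_top,
    ENNReal.toReal_ofReal hq.le]

/-- The homogeneous Strichartz estimate, uniformly over the admissible pairs with `q ≥ q₀ > 2`. -/
theorem strichartz {n : ℕ} (hn : 2 ≤ n) {q₀ : ℝ≥0∞} (hq₀ : 2 < q₀) :
    ∃ C : ℝ≥0, ∀ q r : ℝ≥0∞, Admissible n q r → q₀ ≤ q → ∀ ψ : Space n → ℂ, Integrable ψ →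
      eLpNorm (fun t => eLpNorm (freeWave ψ t) r volume) q volume ≤ C * eLpNorm ψ 2 volume := by
  have hnR : (2 : ℝ) ≤ n := by exact_mod_cast hn
  -- A single admissible pair `(q₁, r₁)` with real `q₁ ≤ q₀` is fixed. All other pairs lie between
  -- it and the energy pair `(∞, 2)`, which is what makes the constant uniform.
  obtain ⟨q₁, hq12, hq1⟩ : ∃ q₁ : ℝ, 2 < q₁ ∧ ENNReal.ofReal q₁ ≤ q₀ := by
    obtain ⟨c, hc1, hc2⟩ := ENNReal.lt_iff_exists_real_btwn.1 hq₀
    refine ⟨c, ?_, hc2.2.le⟩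
    have := hc2.1
    rw [show (2 : ℝ≥0∞) = ENNReal.ofReal 2 by norm_num, ENNReal.ofReal_lt_ofReal_iff'] at this
    exact this.1
  have hq10 : 0 < q₁ := by linarith
  have hfrac : 0 < 2 / (n * q₁) ∧ 2 / (n * q₁) < 1 / 2 := by
    refine ⟨by positivity, ?_⟩
    rw [div_lt_div_iff₀ (by positivity) (by norm_num)]; nlinarith
  set r₁ : ℝ := 1 / (1 / 2 - 2 / (n * q₁)) with hr₁
  have hr12 : 2 < r₁ := by
    rw [hr₁, lt_div_iff₀ (by linarith [hfrac.2])]; linarith [hfrac.1]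
  have hadm₁ : (n : ℝ) * (1 / 2 - 1 / r₁) = 2 / q₁ := by
    rw [hr₁, one_div_one_div]; field_simp; ring
  obtain ⟨C, hC⟩ := strichartz_finite (E := Space n) (r := r₁) (pr := r₁ / (r₁ - 1)) (q := q₁) hr12
    (by rw [lt_div_iff₀ (by linarith)]; linarith)
    (by have : r₁ - 1 ≠ 0 := by linarith
        field_simp; ring) hq12 (by simpa using hadm₁)
  have hP : ∀ ψ : Space n → ℂ, eLpNorm ψ 2 volume = (∫⁻ ξ, ‖ψ ξ‖ₑ ^ 2) ^ (1 / 2 : ℝ) := fun ψ => by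
    rw [← eLpNorm_two_sq, ← ENNReal.rpow_natCast, ← ENNReal.rpow_mul]; norm_num
  -- Interpolation produces `C^(q₁/(2q'))` with an exponent in `[0, 1]`, hence at most `max 1 C`;
  -- the energy pair itself has constant one.
  refine ⟨max 1 C, fun q r hadm hq ψ hψ => ?_⟩
  have hG := measurable_freeWave hψ.1
  set P : ℝ≥0∞ := ∫⁻ ξ, ‖ψ ξ‖ₑ ^ 2
  rw [hP]
  obtain ⟨rfl, rfl⟩ | ⟨q', r', rfl, rfl, hq', hr', hqr⟩ := hadm.cases hn (hq₀.trans_le hq)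
  · calc _ ≤ P ^ (1 / 2 : ℝ) := by
          rw [eLpNorm_exponent_top]
          refine essSup_le_of_ae_le _ (Eventually.of_forall fun t => ?_)
          simp only [enorm_eq_self, hP]
          gcongr; exact lintegral_freeWave_sq_le hψ t
      _ = 1 * P ^ (1 / 2 : ℝ) := (one_mul _).symm
      _ ≤ _ := by gcongr; exact_mod_cast le_max_left 1 C
  · have hq'0 : 0 < q' := by linarith
    have hr'0 : 0 < r' := by linarith
    have hr10 : 0 < r₁ := by linarith
    have hqq : q₁ ≤ q' := by
      have := hq1.trans hq
      exact (ENNReal.ofReal_le_ofReal_iff hq'0.le).1 this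
    rw [eLpNorm_enn _ hq'0]
    -- Interpolation weights between `L²` and `L^{r₁}` in space: `a + b = 1` and `2a + r₁b = r'`.
    -- After raising to the power `q'`, the `L^{r₁}` norm appears to the power `q₁`, which is
    -- integrable in time by the fixed estimate.
    set b : ℝ := q₁ / r₁ * (r' / q')
    set a : ℝ := (q' - q₁) / 2 * (r' / q')
    have hinv : 1 / r' = 1 / 2 - 2 / (n * q') := by
      have : (n : ℝ) ≠ 0 := by linarith
      field_simp at hqr ⊢; linarith
    have hinv1 : 1 / r₁ = 1 / 2 - 2 / (n * q₁) := by rw [hr₁, one_div_one_div]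
    have hab : a + b = 1 := by
      have : a + b = r' * ((q' - q₁) / 2 / q' + q₁ / q' * (1 / r₁)) := by
        simp only [a, b]; field_simp
      rw [this, hinv1]
      have h2 : (q' - q₁) / 2 / q' + q₁ / q' * (1 / 2 - 2 / (n * q₁)) = 1 / 2 - 2 / (n * q') := by
        have : (n : ℝ) ≠ 0 := by linarith
        field_simp; ring
      rw [h2, ← hinv]; field_simp
    have ha : 0 ≤ a := mul_nonneg (by linarith) (by positivity)
    have hb : 0 ≤ b := by positivity
    have hsum : a * 2 + b * r₁ = r' := by
      simp only [a, b]; field_simp; ring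
    have hslice : ∀ t, eLpNorm (freeWave ψ t) (ENNReal.ofReal r') volume ^ q' ≤
        P ^ ((q' - q₁) / 2) * (∫⁻ x, ‖freeWave ψ t x‖ₑ ^ r₁) ^ (q₁ / r₁) := by
      intro t
      have hGt : AEMeasurable (fun x => ‖freeWave ψ t x‖ₑ) :=
        (hG.of_uncurry_left (x := t)).enorm.aemeasurable
      have h1 := lintegral_rpow_interpolate (μ := (volume : Measure (Space n))) hGt ha hb hab
        zero_le_two hr10.le
      rw [hsum] at h1
      simp only [ENNReal.rpow_two] at h1
      rw [eLpNorm_real _ hr'0, ← ENNReal.rpow_mul]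
      calc _ ≤ (P ^ a * (∫⁻ x, ‖freeWave ψ t x‖ₑ ^ r₁) ^ b) ^ (1 / r' * q') := by
            gcongr
            refine h1.trans ?_
            gcongr
            exact lintegral_freeWave_sq_le hψ t
        _ = _ := by
            rw [ENNReal.mul_rpow_of_nonneg _ _ (by positivity), ← ENNReal.rpow_mul,
              ← ENNReal.rpow_mul]
            congr 2
            · simp only [a]; field_simp
            · simp only [b]; field_simp
    have hmeas : Measurable fun t => (∫⁻ x, ‖freeWave ψ t x‖ₑ ^ r₁) ^ (q₁ / r₁) :=
      (Measurable.lintegral_prod_right (hG.enorm.pow_const r₁)).pow_const _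
    calc (∫⁻ t, eLpNorm (freeWave ψ t) (ENNReal.ofReal r') volume ^ q') ^ (1 / q')
        ≤ (P ^ ((q' - q₁) / 2) * (C * P) ^ (q₁ / 2)) ^ (1 / q') := by
          gcongr
          refine (lintegral_mono hslice).trans ?_
          rw [lintegral_const_mul _ hmeas]
          gcongr; exact hC ψ hψ
      _ = (C : ℝ≥0∞) ^ (q₁ / 2 / q') * P ^ (1 / 2 : ℝ) := by
          rw [ENNReal.mul_rpow_of_nonneg _ _ (by positivity : (0 : ℝ) ≤ q₁ / 2), mul_left_comm,
            ← ENNReal.rpow_add_of_nonneg _ _ (by linarith) (by positivity),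
            ENNReal.mul_rpow_of_nonneg _ _ (by positivity), ← ENNReal.rpow_mul, ← ENNReal.rpow_mul]
          congr 2
          · ring
          · field_simp; ring
      _ ≤ _ := by
          gcongr
          calc (C : ℝ≥0∞) ^ (q₁ / 2 / q') ≤ ((max 1 C : ℝ≥0) : ℝ≥0∞) ^ (q₁ / 2 / q') := by
                gcongr; exact le_max_right 1 C
            _ ≤ ((max 1 C : ℝ≥0) : ℝ≥0∞) ^ (1 : ℝ) := by
                refine ENNReal.rpow_le_rpow_of_exponent_le (by exact_mod_cast le_max_left 1 C) ?_
                rw [div_le_one hq'0]; linarith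
            _ = _ := ENNReal.rpow_one _

end Strichartz

/-! ### Singular integrals on the unit sphere -/

section Sphere

open Filter Topology Metric

variable {E : Type*} [NormedAddCommGroup E] [InnerProductSpace ℝ E] [FiniteDimensional ℝ E]
  [MeasurableSpace E] [BorelSpace E]

/-- Integration in polar coordinates. -/
theorem lintegral_polar [Nontrivial E] {f : E → ℝ≥0∞} (hf : Measurable f) :
    ∫⁻ x, f x = ∫⁻ θ : sphere (0 : E) 1, (∫⁻ ρ in Ioi (0 : ℝ),
      ENNReal.ofReal (ρ ^ (Module.finrank ℝ E - 1)) * f (ρ • (θ : E)))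
      ∂(volume : Measure E).toSphere := by
  have hmp := (volume : Measure E).measurePreserving_homeomorphUnitSphereProd
  have hg : Measurable fun z : sphere (0 : E) 1 × Ioi (0 : ℝ) => f ((z.2 : ℝ) • (z.1 : E)) :=
    hf.comp (by fun_prop)
  calc ∫⁻ x, f x = ∫⁻ x in ({0}ᶜ : Set E), f x := by rw [restrict_compl_singleton]
    _ = ∫⁻ x : ({0}ᶜ : Set E), f x ∂(volume.comap (Subtype.val : ({0}ᶜ : Set E) → E)) :=
        (lintegral_subtype_comap (measurableSet_singleton _).compl f).symm
    _ = ∫⁻ x : ({0}ᶜ : Set E), f (((homeomorphUnitSphereProd E x).2 : ℝ) •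
          ((homeomorphUnitSphereProd E x).1 : E)) ∂(volume.comap (Subtype.val : ({0}ᶜ : Set E) → E)) := by
        refine lintegral_congr fun x => ?_
        congr 1
        have hx : ‖(x : E)‖ ≠ 0 := norm_ne_zero_iff.2 x.2
        simp [smul_smul, hx]
    _ = ∫⁻ z, f ((z.2 : ℝ) • (z.1 : E)) ∂((volume : Measure E).toSphere.prod
          (Measure.volumeIoiPow (Module.finrank ℝ E - 1))) :=
        hmp.lintegral_comp_emb (Homeomorph.measurableEmbedding _)
          (fun z : sphere (0 : E) 1 × Ioi (0 : ℝ) => f ((z.2 : ℝ) • (z.1 : E)))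
    _ = ∫⁻ θ : sphere (0 : E) 1, ∫⁻ ρ : Ioi (0 : ℝ), f ((ρ : ℝ) • (θ : E))
          ∂(Measure.volumeIoiPow (Module.finrank ℝ E - 1)) ∂(volume : Measure E).toSphere :=
        lintegral_prod _ hg.aemeasurable
    _ = _ := by
        refine lintegral_congr fun θ => ?_
        have hgθ : Measurable fun ρ : Ioi (0 : ℝ) => f ((ρ : ℝ) • (θ : E)) :=
          hf.comp (by fun_prop)
        rw [Measure.volumeIoiPow, lintegral_withDensity_eq_lintegral_mul _ (by fun_prop) hgθ,
          ← lintegral_subtype_comap measurableSet_Ioi]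
        rfl

/-- Spherical caps of radius `s` have measure `O(s^{d-1})`. -/
theorem exists_toSphere_cap_le [Nontrivial E] : ∃ C : ℝ≥0, ∀ (a : E) (s : ℝ), 0 < s → s ≤ 1 / 2 →
    (volume : Measure E).toSphere {θ | ‖a - θ‖ ≤ s} ≤
      C * ENNReal.ofReal (s ^ (Module.finrank ℝ E - 1)) := by
  set d := Module.finrank ℝ E
  have hd : 0 < d := Module.finrank_pos
  set B : ℝ≥0∞ := volume (ball (0 : E) 1)
  have hB : B ≠ ∞ := measure_ball_lt_top.ne
  refine ⟨2 ^ (d - 1) * 2 ^ d * B.toNNReal, fun a s hs hs2 => ?_⟩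
  have hcap : MeasurableSet {θ : sphere (0 : E) 1 | ‖a - θ‖ ≤ s} :=
    measurableSet_le (by fun_prop) measurable_const
  set σ := (volume : Measure E).toSphere
  have hball : volume (closedBall a (2 * s)) = ENNReal.ofReal ((2 * s) ^ d) * B := by
    rw [Measure.addHaar_closedBall _ _ (by positivity)]
  -- The part of the cone over the cap with radii in `[1 - s, 1]` lies in the ball of radius `2s`
  -- about `a`, and there the polar density is at least `(1/2)^(d-1)` because `s ≤ 1/2`.
  have hlow : σ {θ | ‖a - θ‖ ≤ s} * (ENNReal.ofReal ((1 / 2) ^ (d - 1)) * ENNReal.ofReal s) ≤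
      volume (closedBall a (2 * s)) := by
    have h1 : volume (closedBall a (2 * s)) =
        ∫⁻ x, (closedBall a (2 * s)).indicator (fun _ => (1 : ℝ≥0∞)) x := by
      rw [lintegral_indicator isClosed_closedBall.measurableSet]; simp
    rw [h1, lintegral_polar (measurable_const.indicator isClosed_closedBall.measurableSet)]
    calc σ {θ | ‖a - θ‖ ≤ s} * (ENNReal.ofReal ((1 / 2) ^ (d - 1)) * ENNReal.ofReal s)
        = ∫⁻ θ in {θ : sphere (0 : E) 1 | ‖a - θ‖ ≤ s}, ∫⁻ ρ in Icc (1 - s) 1,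
            ENNReal.ofReal ((1 / 2) ^ (d - 1)) ∂volume ∂σ := by
          rw [setLIntegral_const, setLIntegral_const, Real.volume_Icc, mul_comm]
          simp
      _ ≤ ∫⁻ θ in {θ : sphere (0 : E) 1 | ‖a - θ‖ ≤ s}, ∫⁻ ρ in Ioi (0 : ℝ),
            ENNReal.ofReal (ρ ^ (d - 1)) *
              (closedBall a (2 * s)).indicator (fun _ => (1 : ℝ≥0∞)) (ρ • (θ : E)) ∂volume ∂σ := by
          refine setLIntegral_mono' hcap fun θ hθ => ?_
          refine le_trans (setLIntegral_mono' measurableSet_Icc fun ρ hρ => ?_)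
            (lintegral_mono_set fun ρ hρ => lt_of_lt_of_le (by linarith) hρ.1)
          have hθ1 : ‖(θ : E)‖ = 1 := norm_eq_of_mem_sphere θ
          have hθs : ‖a - θ‖ ≤ s := hθ
          have hmem : ρ • (θ : E) ∈ closedBall a (2 * s) := by
            rw [mem_closedBall, dist_comm, dist_eq_norm]
            have e : a - ρ • (θ : E) = (a - θ) + (1 - ρ) • (θ : E) := by
              rw [sub_smul, one_smul]; abel
            rw [e]
            refine (norm_add_le _ _).trans ?_
            rw [norm_smul, hθ1, mul_one, Real.norm_of_nonneg (by linarith [hρ.2])]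
            linarith [hρ.1]
          rw [indicator_of_mem hmem, mul_one]
          exact ENNReal.ofReal_le_ofReal (pow_le_pow_left₀ (by norm_num) (by linarith [hρ.1]) _)
      _ ≤ _ := setLIntegral_le_lintegral _ _
  rw [hball] at hlow
  have hs0 : ENNReal.ofReal s ≠ 0 := by simpa using hs
  have h2 : ENNReal.ofReal ((1 / 2) ^ (d - 1)) * 2 ^ (d - 1) = 1 := by
    rw [show (2 : ℝ≥0∞) ^ (d - 1) = ENNReal.ofReal (2 ^ (d - 1)) by
      rw [ENNReal.ofReal_pow (by norm_num)]; norm_num, ← ENNReal.ofReal_mul (by positivity),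
      ← mul_pow]; norm_num
  have h3 : ENNReal.ofReal ((2 * s) ^ d) = 2 ^ d * ENNReal.ofReal (s ^ (d - 1)) * ENNReal.ofReal s := by
    rw [mul_assoc, ← ENNReal.ofReal_mul (by positivity), ← pow_succ, Nat.sub_add_cancel hd, mul_pow,
      ENNReal.ofReal_mul (by positivity), ENNReal.ofReal_pow (by norm_num)]; norm_num
  have h4 : σ {θ | ‖a - θ‖ ≤ s} * ENNReal.ofReal s ≤
      (2 ^ (d - 1) * 2 ^ d * B * ENNReal.ofReal (s ^ (d - 1))) * ENNReal.ofReal s := by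
    calc _ = σ {θ | ‖a - θ‖ ≤ s} * (ENNReal.ofReal ((1 / 2) ^ (d - 1)) * ENNReal.ofReal s) *
          2 ^ (d - 1) := by
          rw [mul_assoc, mul_right_comm (ENNReal.ofReal _), h2, one_mul]
      _ ≤ (ENNReal.ofReal ((2 * s) ^ d) * B) * 2 ^ (d - 1) := by gcongr
      _ = _ := by rw [h3]; ring
  have h5 := (ENNReal.mul_le_mul_iff_left hs0 ENNReal.ofReal_ne_top).1 h4
  refine h5.trans (le_of_eq ?_)
  rw [ENNReal.coe_mul, ENNReal.coe_toNNReal hB]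
  push_cast; rfl

/-- Singular integrals of order `γ < d - 1` over the unit sphere are bounded uniformly in the pole. -/
theorem exists_lintegral_sphere_le [Nontrivial E] {γ : ℝ} (h0 : 0 ≤ γ)
    (hγ : γ < Module.finrank ℝ E - 1) : ∃ C : ℝ≥0, ∀ a : E,
    ∫⁻ θ : sphere (0 : E) 1, ENNReal.ofReal (‖a - θ‖ ^ (-γ)) ∂(volume : Measure E).toSphere ≤ C := by
  set d := Module.finrank ℝ E
  have hd : 0 < d := Module.finrank_pos
  set σ := (volume : Measure E).toSphere
  have hσ : σ univ ≠ ∞ := measure_ne_top _ _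
  obtain rfl | hγ0 := eq_or_lt_of_le h0
  · refine ⟨(σ univ).toNNReal, fun a => ?_⟩
    rw [ENNReal.coe_toNNReal hσ]; simp
  obtain ⟨C, hC⟩ := exists_toSphere_cap_le (E := E)
  -- Layer cake in the level `t` of `‖a - θ‖⁻¹`. For `t ≤ 2` the whole mass of the sphere is used,
  -- for `t > 2` the cap of radius `1/t`; the tail `t^(γ-d)` is integrable because `γ < d - 1`.
  set I₁ : ℝ≥0∞ := ENNReal.ofReal (2 ^ (γ - 1 + 1) / (γ - 1 + 1))
  set I₂ : ℝ≥0∞ := ENNReal.ofReal (-2 ^ (γ - d + 1) / (γ - d + 1))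
  refine ⟨(ENNReal.ofReal γ * (σ univ * I₁ + C * I₂)).toNNReal, fun a => ?_⟩
  have hfin : ENNReal.ofReal γ * (σ univ * I₁ + C * I₂) ≠ ∞ :=
    ENNReal.mul_ne_top ENNReal.ofReal_ne_top (ENNReal.add_ne_top.2
      ⟨ENNReal.mul_ne_top hσ ENNReal.ofReal_ne_top,
        ENNReal.mul_ne_top ENNReal.coe_ne_top ENNReal.ofReal_ne_top⟩)
  rw [ENNReal.coe_toNNReal hfin]
  have e1 : ∫⁻ θ : sphere (0 : E) 1, ENNReal.ofReal (‖a - θ‖ ^ (-γ)) ∂σ =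
      ∫⁻ θ : sphere (0 : E) 1, ENNReal.ofReal ((‖a - θ‖⁻¹) ^ γ) ∂σ := by
    refine lintegral_congr fun θ => ?_
    rw [Real.rpow_neg (norm_nonneg _), Real.inv_rpow (norm_nonneg _)]
  rw [e1, lintegral_rpow_eq_lintegral_meas_le_mul σ (f := fun θ => ‖a - θ‖⁻¹)
    (Eventually.of_forall fun θ => by positivity) (by fun_prop) hγ0]
  gcongr
  have hsplit : Ioi (0 : ℝ) = Ioc 0 2 ∪ Ioi 2 := (Ioc_union_Ioi_eq_Ioi (by norm_num)).symm
  rw [hsplit]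
  refine (lintegral_union_le _ _ _).trans (add_le_add ?_ ?_)
  · calc _ ≤ ∫⁻ t in Ioc (0 : ℝ) 2, σ univ * ENNReal.ofReal (t ^ (γ - 1)) := by
          refine lintegral_mono fun t => ?_
          gcongr; exact subset_univ _
      _ = _ := by
          rw [lintegral_const_mul' _ _ hσ, lintegral_Ioc_rpow (by norm_num) (by linarith)]
  · calc _ ≤ ∫⁻ t in Ioi (2 : ℝ), C * ENNReal.ofReal (t ^ (γ - d)) := by
          refine setLIntegral_mono' measurableSet_Ioi fun t ht => ?_
          have ht2 : 2 < t := ht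
          have ht0 : 0 < t := by linarith
          have hsub : {θ : sphere (0 : E) 1 | t ≤ ‖a - θ‖⁻¹} ⊆ {θ | ‖a - θ‖ ≤ 1 / t} := by
            intro θ hθ
            have hθ' : t ≤ ‖a - θ‖⁻¹ := hθ
            have hpos : 0 < ‖a - θ‖ := by
              rcases (norm_nonneg (a - (θ : E))).eq_or_lt with h | h
              · rw [← h, inv_zero] at hθ'; linarith
              · exact h
            rw [mem_ofPred_eq, one_div]
            exact (le_inv_comm₀ ht0 hpos).1 hθ'
          calc _ ≤ C * ENNReal.ofReal ((1 / t) ^ (d - 1)) * ENNReal.ofReal (t ^ (γ - 1)) := by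
                gcongr
                refine (measure_mono hsub).trans (hC a _ (by positivity) ?_)
                rw [div_le_div_iff₀ ht0 (by norm_num)]; linarith
            _ = _ := by
                rw [mul_assoc, ← ENNReal.ofReal_mul (by positivity)]
                congr 2
                rw [one_div, inv_pow, ← Real.rpow_natCast, ← Real.rpow_neg ht0.le,
                  ← Real.rpow_add ht0]
                congr 1
                rw [Nat.cast_sub hd]; push_cast; ring
      _ = _ := by
          rw [lintegral_const_mul' _ _ ENNReal.coe_ne_top, ← ofReal_integral_eq_lintegral_ofReal]
          · rw [integral_Ioi_rpow_of_lt (by linarith) (by norm_num)]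
          · exact integrableOn_Ioi_rpow_of_lt (by linarith) (by norm_num)
          · filter_upwards [ae_restrict_mem measurableSet_Ioi] with t ht
            have : (2 : ℝ) < t := ht
            positivity

/-- Here `x` and `y` stand for `|a + θ|` and `|a - θ|`, which differ by at most `2`. If both
exponents are non-positive, the smaller variable can carry the full power `α + β`. If one of them,
say `α`, is positive, then `x^α ≤ y^α + 2^α` by subadditivity, as `α < 1`. Either way only pure
powers of one variable remain. -/
theorem rpow_mul_rpow_le {x y α β : ℝ} (hx : 0 ≤ x) (hy : 0 ≤ y) (hxy : x ≤ y + 2)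
    (hyx : y ≤ x + 2) (hα : α < 1) (hβ : β < 1) (hαβ : α + β ≤ 0) :
    x ^ α * y ^ β ≤ x ^ (α + β) + y ^ (α + β) + (2 * x ^ (min α 0) + 2 * y ^ (min β 0)) := by
  have key : ∀ {x y α β : ℝ}, 0 ≤ x → 0 ≤ y → x ≤ y + 2 → α < 1 → α + β ≤ 0 → 0 < α →
      x ^ α * y ^ β ≤ y ^ (α + β) + 2 * y ^ (min β 0) := by
    intro x y α β hx hy hxy hα hαβ h0
    rw [min_eq_left (by linarith)]
    obtain rfl | hy0 := hy.eq_or_lt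
    · rw [Real.zero_rpow (by linarith : β ≠ 0)]
      have := Real.rpow_nonneg (le_refl (0 : ℝ)) (α + β)
      linarith
    · have h1 : x ^ α ≤ y ^ α + 2 ^ α := (Real.rpow_le_rpow hx hxy h0.le).trans
        (Real.rpow_add_le_add_rpow hy (by norm_num) h0.le hα.le)
      have h2 : (2 : ℝ) ^ α ≤ 2 := by
        calc (2 : ℝ) ^ α ≤ 2 ^ (1 : ℝ) := Real.rpow_le_rpow_of_exponent_le (by norm_num) hα.le
          _ = 2 := Real.rpow_one _
      have h3 : 0 < y ^ β := Real.rpow_pos_of_pos hy0 _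
      rw [Real.rpow_add hy0]
      nlinarith
  have n1 := Real.rpow_nonneg hx (α + β)
  have n2 := Real.rpow_nonneg hy (α + β)
  have n3 := Real.rpow_nonneg hx (min α 0)
  have n4 := Real.rpow_nonneg hy (min β 0)
  rcases lt_or_ge 0 α with h | hα0
  · have := key hx hy hxy hα hαβ h; linarith
  rcases lt_or_ge 0 β with h | hβ0
  · have := key (β := α) hy hx hyx hβ (by linarith) h
    rw [add_comm β α] at this
    linarith [mul_comm (x ^ α) (y ^ β)]
  have key2 : ∀ {x y α β : ℝ}, 0 ≤ x → x ≤ y → α ≤ 0 → β ≤ 0 → x ^ α * y ^ β ≤ x ^ (α + β) + y ^ (α + β) := by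
    intro x y α β hx hxy hα hβ
    have n1 := Real.rpow_nonneg hx (α + β)
    have n2 := Real.rpow_nonneg (hx.trans hxy) (α + β)
    obtain rfl | hx0 := hx.eq_or_lt
    · obtain rfl | hα' := hα.eq_or_lt
      · simp only [Real.rpow_zero, one_mul, zero_add] at n1 ⊢; linarith
      · rw [Real.zero_rpow hα'.ne]; linarith
    · have := Real.rpow_le_rpow_of_nonpos hx0 hxy hβ
      rw [Real.rpow_add hx0]
      nlinarith [Real.rpow_pos_of_pos hx0 α]
  rcases le_total x y with h | h
  · have := key2 hx h hα0 hβ0; linarith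
  · have := key2 hy h hβ0 hα0
    rw [add_comm β α] at this
    linarith [mul_comm (x ^ α) (y ^ β)]

/-- The spherical averages that control the resonant measure of the bilinear estimate. -/
theorem exists_lintegral_sphere_mul_le [Nontrivial E] {α β : ℝ} (hd : 2 ≤ Module.finrank ℝ E)
    (hα : -(Module.finrank ℝ E - 1 : ℝ) < α) (hβ : -(Module.finrank ℝ E - 1 : ℝ) < β)
    (hαβ : α + β = 2 - Module.finrank ℝ E) : ∃ C : ℝ≥0, ∀ a : E,
    ∫⁻ θ : sphere (0 : E) 1, ENNReal.ofReal (‖a + θ‖ ^ α * ‖a - θ‖ ^ β)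
      ∂(volume : Measure E).toSphere ≤ C := by
  have hdR : (2 : ℝ) ≤ Module.finrank ℝ E := by exact_mod_cast hd
  set d : ℝ := ((Module.finrank ℝ E : ℕ) : ℝ)
  set σ := (volume : Measure E).toSphere
  -- The pure powers left by `rpow_mul_rpow_le` have the orders `-(α + β) = d - 2`, `-min α 0` and
  -- `-min β 0`, each below the critical order `d - 1`.
  obtain ⟨C₁, hC₁⟩ := exists_lintegral_sphere_le (E := E) (γ := d - 2) (by linarith) (by linarith)
  obtain ⟨C₂, hC₂⟩ := exists_lintegral_sphere_le (E := E) (γ := -(min α 0)) (by simp)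
    (by rcases le_total α 0 with h | h <;> simp only [h, min_eq_left, min_eq_right] <;> linarith)
  obtain ⟨C₃, hC₃⟩ := exists_lintegral_sphere_le (E := E) (γ := -(min β 0)) (by simp)
    (by rcases le_total β 0 with h | h <;> simp only [h, min_eq_left, min_eq_right] <;> linarith)
  refine ⟨C₁ + C₁ + (2 * C₂ + 2 * C₃), fun a => ?_⟩
  have hneg : ∀ θ : sphere (0 : E) 1, ‖a + θ‖ = ‖-a - θ‖ := fun θ => by
    rw [← norm_neg]; congr 1; abel
  have h2 : (2 : ℝ≥0∞) = ENNReal.ofReal 2 := by norm_num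
  calc _ ≤ ∫⁻ θ : sphere (0 : E) 1, ((ENNReal.ofReal (‖-a - θ‖ ^ (-(d - 2))) +
          ENNReal.ofReal (‖a - θ‖ ^ (-(d - 2)))) +
          (2 * ENNReal.ofReal (‖-a - θ‖ ^ (- -(min α 0))) +
          2 * ENNReal.ofReal (‖a - θ‖ ^ (- -(min β 0))))) ∂σ := by
        refine lintegral_mono fun θ => ?_
        rw [hneg, neg_neg, neg_neg, neg_sub, ← hαβ, h2, ← ENNReal.ofReal_mul (by norm_num),
          ← ENNReal.ofReal_mul (by norm_num), ← ENNReal.ofReal_add (by positivity) (by positivity),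
          ← ENNReal.ofReal_add (by positivity) (by positivity),
          ← ENNReal.ofReal_add (by positivity) (by positivity)]
        refine ENNReal.ofReal_le_ofReal (rpow_mul_rpow_le (norm_nonneg _) (norm_nonneg _) ?_ ?_
          (by linarith) (by linarith) (by linarith))
        · have hθ : ‖(θ : E)‖ = 1 := norm_eq_of_mem_sphere θ
          have := norm_sub_le (-(a - θ)) ((2 : ℝ) • (θ : E))
          rw [norm_neg, norm_smul, hθ] at this
          have e : -(a - (θ : E)) - (2 : ℝ) • (θ : E) = -a - θ := by rw [two_smul]; abel
          rw [e] at this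
          simpa using this
        · have hθ : ‖(θ : E)‖ = 1 := norm_eq_of_mem_sphere θ
          have := norm_sub_le (-(-a - θ)) ((2 : ℝ) • (θ : E))
          rw [norm_neg, norm_smul, hθ] at this
          have e : -(-a - (θ : E)) - (2 : ℝ) • (θ : E) = a - θ := by rw [two_smul]; abel
          rw [e] at this
          simpa using this
    _ = ((∫⁻ θ : sphere (0 : E) 1, ENNReal.ofReal (‖-a - θ‖ ^ (-(d - 2))) ∂σ) +
          ∫⁻ θ : sphere (0 : E) 1, ENNReal.ofReal (‖a - θ‖ ^ (-(d - 2))) ∂σ) +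
          (2 * (∫⁻ θ : sphere (0 : E) 1, ENNReal.ofReal (‖-a - θ‖ ^ (- -(min α 0))) ∂σ) +
          2 * ∫⁻ θ : sphere (0 : E) 1, ENNReal.ofReal (‖a - θ‖ ^ (- -(min β 0))) ∂σ) := by
        rw [lintegral_add_left (by fun_prop), lintegral_add_left (by fun_prop),
          lintegral_add_left (by fun_prop), lintegral_const_mul' _ _ (by norm_num),
          lintegral_const_mul' _ _ (by norm_num)]
    _ ≤ _ := by
        push_cast
        gcongr
        exacts [hC₁ _, hC₁ _, hC₂ _, hC₃ _]

end Sphere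

/-! ### The resonant set of two free waves -/

section Bilinear

open Filter Topology Metric

variable {E : Type*} [NormedAddCommGroup E] [InnerProductSpace ℝ E] [FiniteDimensional ℝ E]
  [MeasurableSpace E] [BorelSpace E]

/-- Substitution `τ = -(4πρ² + b)`: its Jacobian `8πρ` absorbs the weight `ρ`. -/
theorem lintegral_mul_comp_sq_le {h : ℝ → ℝ≥0∞} (b : ℝ) :
    ∫⁻ ρ in Ioi (0 : ℝ), ENNReal.ofReal ρ * h (-(4 * Real.pi * ρ ^ 2 + b)) ≤ ∫⁻ τ, h τ := by
  have hpi := Real.pi_gt_three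
  have h1 := lintegral_image_eq_lintegral_abs_deriv_mul (s := Ioi (0 : ℝ))
    (f := fun ρ => -(4 * Real.pi * ρ ^ 2 + b)) (f' := fun ρ => -(8 * Real.pi * ρ))
    measurableSet_Ioi (fun ρ _ => by
      refine HasDerivAt.hasDerivWithinAt ?_
      have := (((hasDerivAt_pow 2 ρ).const_mul (4 * Real.pi)).add_const b).neg
      exact this.congr_deriv (by push_cast; ring))
    (fun x hx y hy hxy => by
      have hx' : 0 < x := hx
      have hy' : 0 < y := hy
      have : x ^ 2 = y ^ 2 := by
        simp only [neg_inj, add_left_inj] at hxy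
        exact mul_left_cancel₀ (by positivity) hxy
      exact (pow_left_inj₀ hx'.le hy'.le two_ne_zero).1 this) h
  refine le_trans (setLIntegral_mono' measurableSet_Ioi fun ρ hρ => ?_)
    (h1.ge.trans (setLIntegral_le_lintegral _ _))
  have hρ' : 0 < ρ := hρ
  gcongr
  rw [abs_neg, abs_of_pos (by positivity)]
  nlinarith

/-- In polar coordinates `ω = ρθ`, homogeneity extracts `ρ^(α+β)`, and `ρ^(d-1) * ρ^(α+β) = ρ` is
just the weight needed to integrate in the temporal frequency. The angular integral is the spherical
one with pole `a/ρ`, which is why the bound `hC` has to be uniform in the pole. -/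
theorem lintegral_center_le [Nontrivial E] {α β : ℝ} (hαβ : α + β = 2 - Module.finrank ℝ E)
    {C : ℝ≥0}
    (hC : ∀ a : E, ∫⁻ θ : sphere (0 : E) 1, ENNReal.ofReal (‖a + θ‖ ^ α * ‖a - θ‖ ^ β)
      ∂(volume : Measure E).toSphere ≤ C) {h : ℝ → ℝ≥0∞} (hh : Measurable h) (a : E) (b : ℝ) :
    ∫⁻ ω : E, ENNReal.ofReal (‖a + ω‖ ^ α * ‖a - ω‖ ^ β) * h (-(4 * Real.pi * ‖ω‖ ^ 2 + b)) ≤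
      C * ∫⁻ τ, h τ := by
  have hd : 0 < Module.finrank ℝ E := Module.finrank_pos
  rw [lintegral_polar (by fun_prop)]
  calc _ = ∫⁻ θ : sphere (0 : E) 1, (∫⁻ ρ in Ioi (0 : ℝ),
        ENNReal.ofReal (‖ρ⁻¹ • a + θ‖ ^ α * ‖ρ⁻¹ • a - θ‖ ^ β) *
          (ENNReal.ofReal ρ * h (-(4 * Real.pi * ρ ^ 2 + b)))) ∂(volume : Measure E).toSphere := by
        refine lintegral_congr fun θ => setLIntegral_congr_fun measurableSet_Ioi fun ρ hρ => ?_
        have hρ' : 0 < ρ := hρ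
        have hθ : ‖(θ : E)‖ = 1 := norm_eq_of_mem_sphere θ
        have e1 : ‖a + ρ • (θ : E)‖ = ρ * ‖ρ⁻¹ • a + θ‖ := by
          rw [← abs_of_pos hρ', ← Real.norm_eq_abs, ← norm_smul, smul_add, smul_smul,
            Real.norm_eq_abs, abs_of_pos hρ', mul_inv_cancel₀ hρ'.ne', one_smul]
        have e2 : ‖a - ρ • (θ : E)‖ = ρ * ‖ρ⁻¹ • a - θ‖ := by
          rw [← abs_of_pos hρ', ← Real.norm_eq_abs, ← norm_smul, smul_sub, smul_smul,
            Real.norm_eq_abs, abs_of_pos hρ', mul_inv_cancel₀ hρ'.ne', one_smul]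
        have e3 : ‖ρ • (θ : E)‖ = ρ := by rw [norm_smul, hθ, mul_one, Real.norm_of_nonneg hρ'.le]
        rw [e1, e2, e3, ← mul_assoc, ← mul_assoc, ← ENNReal.ofReal_mul (by positivity),
          ← ENNReal.ofReal_mul (by positivity), Real.mul_rpow hρ'.le (norm_nonneg _),
          Real.mul_rpow hρ'.le (norm_nonneg _)]
        congr 2
        have : ρ ^ (Module.finrank ℝ E - 1) * (ρ ^ α * ρ ^ β) = ρ := by
          rw [← Real.rpow_natCast, ← Real.rpow_add hρ', ← Real.rpow_add hρ', hαβ,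
            Nat.cast_sub hd]
          conv_rhs => rw [← Real.rpow_one ρ]
          congr 1; push_cast; ring
        linear_combination (‖ρ⁻¹ • a + θ‖ ^ α * ‖ρ⁻¹ • a - θ‖ ^ β) * this
    _ = ∫⁻ ρ in Ioi (0 : ℝ), (∫⁻ θ : sphere (0 : E) 1,
        ENNReal.ofReal (‖ρ⁻¹ • a + θ‖ ^ α * ‖ρ⁻¹ • a - θ‖ ^ β) *
          (ENNReal.ofReal ρ * h (-(4 * Real.pi * ρ ^ 2 + b))) ∂(volume : Measure E).toSphere) :=
        lintegral_lintegral_swap (by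
          refine Measurable.aemeasurable ?_
          unfold Function.uncurry
          fun_prop)
    _ ≤ ∫⁻ ρ in Ioi (0 : ℝ), C * (ENNReal.ofReal ρ * h (-(4 * Real.pi * ρ ^ 2 + b))) := by
        refine lintegral_mono fun ρ => ?_
        rw [lintegral_mul_const _ (by fun_prop)]
        gcongr
        exact hC _
    _ ≤ _ := by
        rw [lintegral_const_mul' _ _ ENNReal.coe_ne_top]
        exact mul_le_mul' le_rfl (lintegral_mul_comp_sq_le b)

/-- The weighted measure of the resonant set of two Schrödinger waves. -/
theorem lintegral_resonance_le [Nontrivial E] {α β : ℝ} (hαβ : α + β = 2 - Module.finrank ℝ E)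
    {C : ℝ≥0}
    (hC : ∀ a : E, ∫⁻ θ : sphere (0 : E) 1, ENNReal.ofReal (‖a + θ‖ ^ α * ‖a - θ‖ ^ β)
      ∂(volume : Measure E).toSphere ≤ C) {Ψ : ℝ → E → ℝ≥0∞}
    (hΨ : Measurable (Function.uncurry Ψ)) :
    ∫⁻ η, ∫⁻ ζ, ENNReal.ofReal (‖η‖ ^ α * ‖ζ‖ ^ β) *
      Ψ (-(2 * Real.pi * (‖η‖ ^ 2 + ‖ζ‖ ^ 2))) (η + ζ) ≤ C * ∫⁻ ξ, ∫⁻ τ, Ψ τ ξ := by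
  have hΨ' : ∀ {a : E × E → ℝ} {b : E × E → E}, Measurable a → Measurable b →
      Measurable fun z => Ψ (a z) (b z) := fun ha hb => hΨ.comp (ha.prodMk hb)
  calc _ = ∫⁻ η, ∫⁻ ξ, ENNReal.ofReal (‖η‖ ^ α * ‖ξ - η‖ ^ β) *
        Ψ (-(2 * Real.pi * (‖η‖ ^ 2 + ‖ξ - η‖ ^ 2))) ξ := by
        refine lintegral_congr fun η => ?_
        rw [← lintegral_sub_right_eq_self _ η]
        simp
    _ = ∫⁻ ξ, ∫⁻ η, ENNReal.ofReal (‖η‖ ^ α * ‖ξ - η‖ ^ β) *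
        Ψ (-(2 * Real.pi * (‖η‖ ^ 2 + ‖ξ - η‖ ^ 2))) ξ := by
        refine lintegral_lintegral_swap (Measurable.aemeasurable ?_)
        unfold Function.uncurry
        exact Measurable.mul (by fun_prop) (hΨ' (by fun_prop) (by fun_prop))
    -- Centring at `η = ξ/2 + ω`: by the parallelogram law `|η|² + |ξ - η|² = 2|ω|² + |ξ|²/2`, so
    -- the temporal frequency depends on `ω` through `|ω|` alone.
    _ = ∫⁻ ξ, ∫⁻ ω, ENNReal.ofReal (‖(1 / 2 : ℝ) • ξ + ω‖ ^ α * ‖(1 / 2 : ℝ) • ξ - ω‖ ^ β) *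
        Ψ (-(4 * Real.pi * ‖ω‖ ^ 2 + Real.pi * ‖ξ‖ ^ 2)) ξ := by
        refine lintegral_congr fun ξ => ?_
        rw [← lintegral_add_left_eq_self _ ((1 / 2 : ℝ) • ξ)]
        refine lintegral_congr fun ω => ?_
        have e : ξ - ((1 / 2 : ℝ) • ξ + ω) = (1 / 2 : ℝ) • ξ - ω := by
          nth_rw 1 [← one_smul ℝ ξ]
          rw [← sub_sub, ← sub_smul]; norm_num
        rw [e]
        have hp := parallelogram_law_with_norm ℝ ((1 / 2 : ℝ) • ξ) ω
        rw [norm_smul] at hp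
        congr 2
        rw [show ‖(1 / 2 : ℝ)‖ = 1 / 2 by norm_num] at hp
        linear_combination (-2 * Real.pi) * hp
    _ ≤ ∫⁻ ξ, C * ∫⁻ τ, Ψ τ ξ := lintegral_mono fun ξ =>
        lintegral_center_le hαβ hC hΨ.of_uncurry_right _ _
    _ = _ := lintegral_const_mul' _ _ ENNReal.coe_ne_top

/-- Identifies the temporal frequency at which a product of two plane waves oscillates. -/
theorem evol_mul_evol (t : ℝ) (η ζ : E) : evol t η * evol t ζ =
    Real.fourierChar (-(inner ℝ t (-(2 * Real.pi * (‖η‖ ^ 2 + ‖ζ‖ ^ 2))))) := by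
  rw [evol, evol, ← Complex.exp_add, Real.fourierChar_apply]
  congr 1
  rw [RCLike.inner_apply, conj_trivial]
  push_cast; ring

namespace BoundedOnBox

variable {F : ℝ → E → ℂ} {J : Set ℝ} {K : Set E} {M : ℝ}

theorem integrable (h : BoundedOnBox F J K M) : Integrable (Function.uncurry F) := by
  have h1 : IntegrableOn (fun _ : ℝ × E => M) (J ×ˢ K) := by
    refine integrableOn_const ?_
    rw [Measure.volume_eq_prod, Measure.prod_prod]
    exact (ENNReal.mul_lt_top h.left_lt_top h.right_lt_top).ne
  refine ((integrable_indicator_iff (h.measurableSet_left.prod h.measurableSet_right)).2 h1).mono'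
    h.measurable.aestronglyMeasurable (Eventually.of_forall fun z => ?_)
  by_cases hz : z ∈ J ×ˢ K
  · rw [indicator_of_mem hz]; exact h.bound _ _
  · rw [indicator_of_notMem hz]
    simp only [mem_prod, not_and_or] at hz
    rcases hz with hz | hz
    · simp [Function.uncurry, h.zero_left _ hz]
    · simp [Function.uncurry, h.zero_right _ _ hz]

theorem integrable_fourier (h : BoundedOnBox F J K M) (ξ : E) :
    Integrable fun t => 𝓕 (F t) ξ := by
  have hJ : Integrable (J.indicator (fun _ => M * (volume K).toReal)) :=
    (integrable_indicator_iff h.measurableSet_left).2 (integrableOn_const h.left_lt_top.ne)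
  exact hJ.mono' ((stronglyMeasurable_fourier h.measurable).comp_measurable
    (measurable_id.prodMk measurable_const)).aestronglyMeasurable
    (Eventually.of_forall fun t => h.norm_fourier_le t ξ)

/-- When both waves are unfolded, all oscillation falls on `F`. Fubini then collects it into the
space-time Fourier transform of `F`, evaluated where two free waves can interact. -/
theorem integral_mul_freeWave_mul_freeWave (h : BoundedOnBox F J K M) {f g : E → ℂ}
    (hf : Integrable f) (hg : Integrable g) :
    ∫ t, ∫ x, F t x * (freeWave f t x * freeWave g t x) =
      ∫ z : E × E, f z.1 * g z.2 *
        𝓕 (fun t => 𝓕 (F t) (z.1 + z.2)) (-(2 * Real.pi * (‖z.1‖ ^ 2 + ‖z.2‖ ^ 2))) := by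
  set Φ : (ℝ × E) × (E × E) → ℂ := fun p =>
    ((Real.fourierChar (-inner ℝ p.2.1 p.1.2) : ℂ) * evol p.1.1 p.2.1 *
      ((Real.fourierChar (-inner ℝ p.2.2 p.1.2) : ℂ) * evol p.1.1 p.2.2)) *
      (F p.1.1 p.1.2 * (f p.2.1 * g p.2.2)) with hΦ
  have hΦc : Continuous fun p : (ℝ × E) × (E × E) =>
      ((Real.fourierChar (-inner ℝ p.2.1 p.1.2) : ℂ) * evol p.1.1 p.2.1 *
      ((Real.fourierChar (-inner ℝ p.2.2 p.1.2) : ℂ) * evol p.1.1 p.2.2)) := by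
    unfold evol
    have : Continuous fun x : ℝ => (Real.fourierChar x : ℂ) :=
      continuous_subtype_val.comp Real.continuous_fourierChar
    fun_prop
  have hΦi : Integrable Φ (volume.prod volume) := by
    refine (h.integrable.mul_prod (hf.mul_prod hg)).bdd_mul (c := 1) hΦc.aestronglyMeasurable
      (Eventually.of_forall fun p => ?_)
    simp only [norm_mul, norm_evol, Circle.norm_coe, mul_one, le_refl]
  have e1 : ∀ t x, F t x * (freeWave f t x * freeWave g t x) =
      ∫ z : E × E, Φ ((t, x), z) := by
    intro t x
    rw [freeWave, freeWave, Real.fourier_eq, Real.fourier_eq, ← integral_prod_mul,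
      ← integral_const_mul]
    refine integral_congr_ae (Eventually.of_forall fun z => ?_)
    simp only [hΦ, Circle.smul_def, smul_eq_mul]
    ring
  simp only [e1]
  rw [← integral_prod (f := fun z : ℝ × E => ∫ w : E × E, Φ (z, w)) hΦi.integral_prod_left]
  refine (integral_integral_swap (f := fun (z : ℝ × E) (w : E × E) => Φ (z, w)) hΦi).trans ?_
  refine integral_congr_ae ?_
  filter_upwards [hΦi.prod_left_ae] with w hw
  rw [Measure.volume_eq_prod ℝ E, integral_prod _ (by exact hw)]
  rw [Real.fourier_eq, ← integral_const_mul]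
  refine integral_congr_ae (Eventually.of_forall fun t => ?_)
  simp only
  rw [Real.fourier_eq, Circle.smul_def, ← evol_mul_evol, smul_eq_mul, ← integral_const_mul,
    ← integral_const_mul]
  refine integral_congr_ae (Eventually.of_forall fun x => ?_)
  simp only [hΦ, Circle.smul_def, smul_eq_mul]
  rw [inner_add_right, neg_add, AddChar.map_add_eq_mul, Circle.coe_mul,
    real_inner_comm x w.1, real_inner_comm x w.2]
  ring

theorem lintegral_fourier_fourier_sq_le (h : BoundedOnBox F J K M) :
    ∫⁻ ξ, ∫⁻ τ, ‖𝓕 (fun t => 𝓕 (F t) ξ) τ‖ₑ ^ 2 ≤ ∫⁻ t, ∫⁻ x, ‖F t x‖ₑ ^ 2 := by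
  calc _ ≤ ∫⁻ ξ, ∫⁻ t, ‖𝓕 (F t) ξ‖ₑ ^ 2 :=
        lintegral_mono fun ξ => lintegral_fourier_sq_le (h.integrable_fourier ξ)
    _ = ∫⁻ t, ∫⁻ ξ, ‖𝓕 (F t) ξ‖ₑ ^ 2 := by
        refine lintegral_lintegral_swap (Measurable.aemeasurable ?_)
        exact (((stronglyMeasurable_fourier h.measurable).measurable.comp
          measurable_swap).enorm.pow_const 2)
    _ ≤ _ := lintegral_mono fun t => lintegral_fourier_sq_le (h.integrable_right t)

end BoundedOnBox

end Bilinear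

/-! ### The bilinear estimate for free waves -/

section BilinearEstimate

open Filter Topology Metric

variable {E : Type*} [NormedAddCommGroup E] [InnerProductSpace ℝ E] [FiniteDimensional ℝ E]
  [MeasurableSpace E] [BorelSpace E]

theorem measurable_flip {S T : Type*} [MeasurableSpace S] [MeasurableSpace T] {G : S → T → ℂ}
    (h : Measurable fun z : S × T => G z.1 z.2) : Measurable fun z : T × S => G z.2 z.1 :=
  h.comp measurable_swap

theorem BoundedOnBox.measurable_fourier_fourier {F : ℝ → E → ℂ} {J : Set ℝ} {K : Set E} {M : ℝ}
    (h : BoundedOnBox F J K M) :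
    Measurable (fun z : ℝ × E => 𝓕 (fun t => 𝓕 (F t) z.2) z.1) := by
  have h1 : Measurable fun z : E × ℝ => 𝓕 (F z.2) z.1 :=
    measurable_flip (G := fun t ξ => 𝓕 (F t) ξ) (stronglyMeasurable_fourier h.measurable).measurable
  exact measurable_flip (G := fun (ξ : E) (τ : ℝ) => 𝓕 (fun t => 𝓕 (F t) ξ) τ)
    (stronglyMeasurable_fourier (F := fun (ξ : E) (t : ℝ) => 𝓕 (F t) ξ) h1).measurable

/-- Keeps only the three properties of the space-time Fourier transform that the duality argument
needs: measurability, the pairing formula and the `L²` bound. -/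
theorem BoundedOnBox.exists_spacetime_fourier {F : ℝ → E → ℂ} {J : Set ℝ} {K : Set E} {M : ℝ}
    (h : BoundedOnBox F J K M) : ∃ G : ℝ → E → ℂ, Measurable (Function.uncurry G) ∧
      (∀ f g : E → ℂ, Integrable f → Integrable g →
        ∫ t, ∫ x, F t x * (freeWave f t x * freeWave g t x) = ∫ z : E × E, f z.1 * g z.2 *
          G (-(2 * Real.pi * (‖z.1‖ ^ 2 + ‖z.2‖ ^ 2))) (z.1 + z.2)) ∧
      ∫⁻ ξ, ∫⁻ τ, ‖G τ ξ‖ₑ ^ 2 ≤ ∫⁻ t, ∫⁻ x, ‖F t x‖ₑ ^ 2 :=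
  ⟨fun τ ξ => 𝓕 (fun t => 𝓕 (F t) ξ) τ, h.measurable_fourier_fourier,
    fun _ _ hf hg => h.integral_mul_freeWave_mul_freeWave hf hg, h.lintegral_fourier_fourier_sq_le⟩

set_option maxHeartbeats 400000 in
-- Taking `F` to be the conjugate of the product on the box, `X = ∫ |F|²` is the pairing of `F` with
-- the product. Cauchy–Schwarz splits the frequency integrand into `P * Q`: `P²` integrates to the
-- two weighted norms, and `Q²` is the resonance integral, at most `C * X`. The cutoff to a box
-- makes `X` finite, so one factor `X` can be cancelled.
theorem bilinear_box [Nontrivial E] {α β : ℝ} (hαβ : α + β = 2 - Module.finrank ℝ E)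
    {C : ℝ≥0}
    (hC : ∀ a : E, ∫⁻ θ : sphere (0 : E) 1, ENNReal.ofReal (‖a + θ‖ ^ α * ‖a - θ‖ ^ β)
      ∂(volume : Measure E).toSphere ≤ C) {f g : E → ℂ} (hf : Integrable f) (hg : Integrable g)
    {J : Set ℝ} {K : Set E} (hJ : MeasurableSet J) (hK : MeasurableSet K) (hJt : volume J < ∞)
    (hKt : volume K < ∞) :
    ∫⁻ z in J ×ˢ K, ‖freeWave f z.1 z.2 * freeWave g z.1 z.2‖ₑ ^ 2 ≤
      C * ((∫⁻ η, ‖f η‖ₑ ^ 2 * ENNReal.ofReal (‖η‖ ^ (-α))) *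
        ∫⁻ ζ, ‖g ζ‖ₑ ^ 2 * ENNReal.ofReal (‖ζ‖ ^ (-β))) := by
  set W : ℝ × E → ℂ := fun z => freeWave f z.1 z.2 * freeWave g z.1 z.2
  have hW : Measurable W := (measurable_freeWave hf.1).mul (measurable_freeWave hg.1)
  have hJK : MeasurableSet (J ×ˢ K) := hJ.prod hK
  set F : ℝ → E → ℂ := fun t x => (J ×ˢ K).indicator (fun z => (starRingEnd ℂ) (W z)) (t, x)
    with hF
  set M : ℝ := (∫ ξ, ‖f ξ‖) * ∫ ξ, ‖g ξ‖
  have hM : 0 ≤ M := mul_nonneg (integral_nonneg fun _ => norm_nonneg _)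
    (integral_nonneg fun _ => norm_nonneg _)
  have hbox : BoundedOnBox F J K M := by
    refine ⟨?_, hJ, hK, hJt, hKt, ?_, ?_, ?_⟩
    · exact (Complex.continuous_conj.measurable.comp hW).indicator hJK
    · intro t x
      by_cases h : (t, x) ∈ J ×ˢ K
      · simp only [hF, indicator_of_mem h, RCLike.norm_conj, W, norm_mul]
        exact mul_le_mul (norm_freeWave_le _ _ _) (norm_freeWave_le _ _ _) (norm_nonneg _)
          (integral_nonneg fun _ => norm_nonneg _)
      · simpa only [hF, indicator_of_notMem h, norm_zero] using hM
    · intro t ht x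
      exact indicator_of_notMem (fun h => ht h.1) _
    · intro t x hx
      exact indicator_of_notMem (fun h => hx h.2) _
  have hFW : ∀ t x, F t x * W (t, x) = ((‖F t x‖ ^ 2 : ℝ) : ℂ) := by
    intro t x
    by_cases h : (t, x) ∈ J ×ˢ K
    · simp only [hF, indicator_of_mem h, RCLike.norm_conj]
      rw [Complex.conj_mul']; push_cast; rfl
    · simp [hF, indicator_of_notMem h]
  have hFi : Integrable fun z : ℝ × E => ‖F z.1 z.2‖ ^ 2 := by
    have := hbox.integrable.norm.bdd_mul (c := M) hbox.integrable.norm.1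
      (Eventually.of_forall fun z => by rw [norm_norm]; exact hbox.bound _ _)
    refine this.congr (Eventually.of_forall fun z => ?_)
    simp only [Function.uncurry]; ring
  set X : ℝ≥0∞ := ∫⁻ z : ℝ × E, ‖F z.1 z.2‖ₑ ^ 2 with hX
  have hXW : X = ∫⁻ z in J ×ˢ K, ‖W z‖ₑ ^ 2 := by
    rw [hX, ← lintegral_indicator hJK]
    refine lintegral_congr fun z => ?_
    by_cases h : z ∈ J ×ˢ K
    · simp only [hF, indicator_of_mem h, enorm, RCLike.nnnorm_conj]
    · simp [hF, indicator_of_notMem h]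
  have hXR : X = ENNReal.ofReal (∫ z : ℝ × E, ‖F z.1 z.2‖ ^ 2) := by
    rw [ofReal_integral_eq_lintegral_ofReal hFi (Eventually.of_forall fun z => by positivity)]
    refine lintegral_congr fun z => ?_
    rw [ENNReal.ofReal_pow (norm_nonneg _), ofReal_norm]
  have hXt : X ≠ ∞ := by rw [hXR]; exact ENNReal.ofReal_ne_top
  have hXprod : X = ∫⁻ t, ∫⁻ x, ‖F t x‖ₑ ^ 2 := by
    rw [hX, Measure.volume_eq_prod]
    exact lintegral_prod _ (hbox.measurable.enorm.pow_const 2).aemeasurable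
  have hpair : ‖∫ t, ∫ x, F t x * (freeWave f t x * freeWave g t x)‖ₑ = X := by
    have : ∀ t x, F t x * (freeWave f t x * freeWave g t x) = ((‖F t x‖ ^ 2 : ℝ) : ℂ) := hFW
    simp only [this, integral_complex_ofReal]
    rw [← ofReal_norm, Complex.norm_real, Real.norm_of_nonneg (integral_nonneg fun t =>
      integral_nonneg fun x => by positivity), hXR]
    congr 1
    exact (integral_prod (fun z : ℝ × E => ‖F z.1 z.2‖ ^ 2) hFi).symm
  clear_value F X
  obtain ⟨G, hG, hGpair, hGsq⟩ := hbox.exists_spacetime_fourier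
  set A : ℝ≥0∞ := ∫⁻ η, ‖f η‖ₑ ^ 2 * ENNReal.ofReal (‖η‖ ^ (-α))
  set B : ℝ≥0∞ := ∫⁻ ζ, ‖g ζ‖ₑ ^ 2 * ENNReal.ofReal (‖ζ‖ ^ (-β))
  set τ : E × E → ℝ := fun z => -(2 * Real.pi * (‖z.1‖ ^ 2 + ‖z.2‖ ^ 2))
  have hτ : Measurable τ := by fun_prop
  set P : E × E → ℝ≥0∞ := fun z => (‖f z.1‖ₑ * ENNReal.ofReal (‖z.1‖ ^ (-α / 2))) *
    (‖g z.2‖ₑ * ENNReal.ofReal (‖z.2‖ ^ (-β / 2)))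
  set Q : E × E → ℝ≥0∞ := fun z => ENNReal.ofReal (‖z.1‖ ^ (α / 2) * ‖z.2‖ ^ (β / 2)) *
    ‖G (τ z) (z.1 + z.2)‖ₑ
  have hPm : AEMeasurable P (volume.prod volume) := by
    have h1 : AEMeasurable (fun η => ‖f η‖ₑ * ENNReal.ofReal (‖η‖ ^ (-α / 2))) :=
      hf.1.enorm.mul (by fun_prop)
    have h2 : AEMeasurable (fun η => ‖g η‖ₑ * ENNReal.ofReal (‖η‖ ^ (-β / 2))) :=
      hg.1.enorm.mul (by fun_prop)
    exact h1.comp_fst.mul h2.comp_snd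
  have hGm : Measurable fun z : E × E => G (τ z) (z.1 + z.2) :=
    hG.comp (hτ.prodMk (measurable_fst.add measurable_snd))
  have hQm : AEMeasurable Q (volume.prod volume) := by
    refine Measurable.aemeasurable (Measurable.mul (by fun_prop) hGm.enorm)
  have sq : ∀ {x : E} (s : ℝ), ENNReal.ofReal (‖x‖ ^ (s / 2)) ^ 2 = ENNReal.ofReal (‖x‖ ^ s) := by
    intro x s
    rw [← ENNReal.ofReal_pow (Real.rpow_nonneg (norm_nonneg _) _), ← Real.rpow_mul_natCast (norm_nonneg _)]
    congr 2; push_cast; ring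
  have hPI : ∫⁻ z, P z ^ 2 ∂(volume.prod volume) = A * B := by
    have m1 : AEMeasurable fun η => ‖f η‖ₑ ^ 2 * ENNReal.ofReal (‖η‖ ^ (-α)) :=
      (hf.1.enorm.pow_const 2).mul (by fun_prop)
    have m2 : AEMeasurable fun ζ => ‖g ζ‖ₑ ^ 2 * ENNReal.ofReal (‖ζ‖ ^ (-β)) :=
      (hg.1.enorm.pow_const 2).mul (by fun_prop)
    rw [← lintegral_prod_mul m1 m2]
    refine lintegral_congr fun z => ?_
    simp only [P, mul_pow, sq]
  have hQI : ∫⁻ z, Q z ^ 2 ∂(volume.prod volume) ≤ C * X := by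
    rw [lintegral_prod _ (hQm.pow_const 2)]
    calc _ = ∫⁻ η, ∫⁻ ζ, ENNReal.ofReal (‖η‖ ^ α * ‖ζ‖ ^ β) *
          ‖G (-(2 * Real.pi * (‖η‖ ^ 2 + ‖ζ‖ ^ 2))) (η + ζ)‖ₑ ^ 2 := by
          refine lintegral_congr fun η => lintegral_congr fun ζ => ?_
          simp only [Q, τ, mul_pow]
          rw [ENNReal.ofReal_mul (Real.rpow_nonneg (norm_nonneg _) _), mul_pow, sq, sq,
            ENNReal.ofReal_mul (Real.rpow_nonneg (norm_nonneg _) _)]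
      _ ≤ C * ∫⁻ ξ, ∫⁻ τ, ‖G τ ξ‖ₑ ^ 2 :=
          lintegral_resonance_le hαβ hC (Ψ := fun τ ξ => ‖G τ ξ‖ₑ ^ 2) (hG.enorm.pow_const 2)
      _ ≤ _ := by
          rw [hXprod]
          exact mul_le_mul' le_rfl hGsq
  -- The weights in `P` and `Q` are inverse to each other only away from the origin.
  have hne : ∀ᵐ z : E × E ∂(volume.prod volume), z.1 ≠ 0 ∧ z.2 ≠ 0 := by
    have h0 : ∀ᵐ x : E, x ≠ 0 := by simp [ae_iff]
    filter_upwards [Measure.quasiMeasurePreserving_fst.ae h0,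
      Measure.quasiMeasurePreserving_snd.ae h0] with z h1 h2 using ⟨h1, h2⟩
  have hcancel : ∀ {x : E}, x ≠ 0 → ∀ s : ℝ,
      ENNReal.ofReal (‖x‖ ^ (-s / 2)) * ENNReal.ofReal (‖x‖ ^ (s / 2)) = 1 := by
    intro x hx s
    rw [← ENNReal.ofReal_mul (Real.rpow_nonneg (norm_nonneg _) _), ← Real.rpow_add (norm_pos_iff.2 hx)]
    simp [neg_div]
  have hmain : X ≤ (A * B) ^ (1 / 2 : ℝ) * (C * X) ^ (1 / 2 : ℝ) := by
    calc X = ‖∫ z : E × E, f z.1 * g z.2 * G (τ z) (z.1 + z.2)‖ₑ := by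
          rw [← hpair, hGpair f g hf hg]
      _ ≤ ∫⁻ z : E × E, ‖f z.1 * g z.2 * G (τ z) (z.1 + z.2)‖ₑ :=
          enorm_integral_le_lintegral_enorm _
      _ = ∫⁻ z, (P * Q) z ∂(volume.prod volume) := by
          refine lintegral_congr_ae ?_
          filter_upwards [hne] with z hz
          simp only [P, Q, Pi.mul_apply, enorm_mul]
          rw [ENNReal.ofReal_mul (Real.rpow_nonneg (norm_nonneg _) _)]
          calc _ = ‖f z.1‖ₑ * ‖g z.2‖ₑ * ‖G (τ z) (z.1 + z.2)‖ₑ * 1 * 1 := by ring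
            _ = ‖f z.1‖ₑ * ‖g z.2‖ₑ * ‖G (τ z) (z.1 + z.2)‖ₑ *
                (ENNReal.ofReal (‖z.1‖ ^ (-α / 2)) * ENNReal.ofReal (‖z.1‖ ^ (α / 2))) *
                (ENNReal.ofReal (‖z.2‖ ^ (-β / 2)) * ENNReal.ofReal (‖z.2‖ ^ (β / 2))) := by
                rw [hcancel hz.1, hcancel hz.2]
            _ = _ := by ring
      _ ≤ _ := ENNReal.lintegral_mul_le_Lp_mul_Lq _ Real.HolderConjugate.two_two hPm hQm
      _ ≤ _ := by
          simp only [ENNReal.rpow_two]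
          rw [hPI]
          gcongr
  rw [← hXW]
  obtain hX0 | hX0 := eq_or_ne X 0
  · rw [hX0]; exact zero_le
  have h2 : X ^ 2 ≤ (C * (A * B)) * X := by
    calc X ^ 2 ≤ ((A * B) ^ (1 / 2 : ℝ) * (C * X) ^ (1 / 2 : ℝ)) ^ 2 := by gcongr
      _ = _ := by
          rw [mul_pow, ← ENNReal.rpow_mul_natCast, ← ENNReal.rpow_mul_natCast]
          norm_num; ring
  rw [pow_two] at h2
  exact (ENNReal.mul_le_mul_iff_left hX0 hXt).1 h2

/-- The bilinear estimate for free waves with weighted `L²` frequency profiles. -/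
theorem bilinear_freeWave [Nontrivial E] {α β : ℝ} (hαβ : α + β = 2 - Module.finrank ℝ E)
    {C : ℝ≥0}
    (hC : ∀ a : E, ∫⁻ θ : sphere (0 : E) 1, ENNReal.ofReal (‖a + θ‖ ^ α * ‖a - θ‖ ^ β)
      ∂(volume : Measure E).toSphere ≤ C) {f g : E → ℂ} (hf : Integrable f) (hg : Integrable g) :
    ∫⁻ z : ℝ × E, ‖freeWave f z.1 z.2 * freeWave g z.1 z.2‖ₑ ^ 2 ≤
      C * ((∫⁻ η, ‖f η‖ₑ ^ 2 * ENNReal.ofReal (‖η‖ ^ (-α))) *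
        ∫⁻ ζ, ‖g ζ‖ₑ ^ 2 * ENNReal.ofReal (‖ζ‖ ^ (-β))) := by
  set S : ℕ → Set (ℝ × E) := fun k => closedBall 0 k ×ˢ closedBall 0 k
  have hSmono : Monotone S := fun a b hab =>
    prod_mono (closedBall_subset_closedBall (by exact_mod_cast hab))
      (closedBall_subset_closedBall (by exact_mod_cast hab))
  have hSU : ⋃ k, S k = univ := by
    refine eq_univ_of_forall fun z => mem_iUnion.2 ?_
    obtain ⟨k, hk⟩ := exists_nat_ge (max ‖z.1‖ ‖z.2‖)
    exact ⟨k, by simpa using (le_max_left _ _).trans hk, by simpa using (le_max_right _ _).trans hk⟩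
  rw [← setLIntegral_univ, ← hSU, setLIntegral_iUnion_of_directed _ hSmono.directed_le]
  exact iSup_le fun k => bilinear_box hαβ hC hf hg isClosed_closedBall.measurableSet
    isClosed_closedBall.measurableSet measure_closedBall_lt_top measure_closedBall_lt_top

end BilinearEstimate

/-! ### Dyadic chaining of paths of small variation -/

section Atoms

open Filter Topology

variable {V : Type*} [NormedAddCommGroup V] [NormedSpace ℂ V]

/-- Cauchy–Schwarz against the geometric weights `θ^k`; it converts a sum over levels into a sum of
squares at the price of the factor `θ^(-k)`. -/
theorem sq_sum_le_tsum_weighted {θ : ℝ} (h0 : 0 < θ) (h1 : θ < 1) (a : ℕ → ℝ) (N : ℕ) :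
    (∑ k ∈ Finset.range N, a k) ^ 2 ≤
      ∑ k ∈ Finset.range N, ((1 - θ)⁻¹ * (θ ^ k)⁻¹) * a k ^ 2 := by
  have hg : ∑ k ∈ Finset.range N, θ ^ k ≤ (1 - θ)⁻¹ := by
    rw [← tsum_geometric_of_lt_one h0.le h1]
    exact (summable_geometric_of_lt_one h0.le h1).sum_le_tsum _ fun _ _ => by positivity
  calc (∑ k ∈ Finset.range N, a k) ^ 2
      ≤ (∑ k ∈ Finset.range N, θ ^ k) * ∑ k ∈ Finset.range N, (θ ^ k)⁻¹ * a k ^ 2 :=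
        Finset.sum_sq_le_sum_mul_sum_of_sq_le_mul _ (fun k _ => by positivity)
          (fun k _ => by positivity) (fun k _ => le_of_eq (by field_simp))
    _ ≤ (1 - θ)⁻¹ * ∑ k ∈ Finset.range N, (θ ^ k)⁻¹ * a k ^ 2 := by
        gcongr
    _ = _ := by rw [Finset.mul_sum]; simp only [mul_assoc]

/-- A series of quantized increments with geometrically decaying size is dominated by a fixed
square-summable family. -/
theorem exists_atoms_of_increments {θ a B : ℝ} (h0 : 0 < θ) (h1 : θ < 1) (hθa : 2 * a ^ 2 = θ ^ 2)
    {T : Type*} {d : ℕ → ℕ → V} {J : ℕ → T → ℕ} {P : T → V}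
    (hd : ∀ k j, ‖d k j‖ ≤ B * a ^ k) (hd0 : ∀ k j, 2 ^ k < j → d k j = 0)
    (hP : ∀ t, Tendsto (fun N => ∑ k ∈ Finset.range N, d k (J k t)) atTop (𝓝 (P t))) :
    ∃ p : ℕ × ℕ → V, ∑' i, ‖p i‖ₑ ^ 2 ≤ ENNReal.ofReal (2 * ((1 - θ)⁻¹ * B) ^ 2) ∧
      ∀ (L : V →L[ℂ] ℂ) t, ‖L (P t)‖ₑ ^ 2 ≤ ∑' i, ‖L (p i)‖ₑ ^ 2 := by
  have hθ1 : 0 < 1 - θ := by linarith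
  -- Level `k` holds at most `2^k + 1` increments of squared size at most `B² * a^(2k)`. With `2a² =
  -- θ²` their weighted total is a multiple of `θ^(-k) * θ^(2k) = θ^k`, which is summable.
  set c : ℕ → ℝ := fun k => (1 - θ)⁻¹ * (θ ^ k)⁻¹ with hc
  have hc0 : ∀ k, 0 ≤ c k := fun k => by positivity
  set p : ℕ × ℕ → V := fun i => ((√(c i.1) : ℝ) : ℂ) • d i.1 i.2
  have hsq : ∀ k (x : ℂ), ‖((√(c k) : ℝ) : ℂ) * x‖ ^ 2 = c k * ‖x‖ ^ 2 := fun k x => by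
    rw [norm_mul, mul_pow, Complex.norm_real, Real.norm_of_nonneg (Real.sqrt_nonneg _),
      Real.sq_sqrt (hc0 k)]
  refine ⟨p, ?_, fun L t => ?_⟩
  · have hpn : ∀ k j, ‖p (k, j)‖ₑ ^ 2 ≤ ENNReal.ofReal (c k * (B * a ^ k) ^ 2) := fun k j => by
      rw [← ofReal_norm, ← ENNReal.ofReal_pow (norm_nonneg _)]
      refine ENNReal.ofReal_le_ofReal ?_
      rw [norm_smul, mul_pow, Complex.norm_real, Real.norm_of_nonneg (Real.sqrt_nonneg _),
        Real.sq_sqrt (hc0 k)]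
      exact mul_le_mul_of_nonneg_left (pow_le_pow_left₀ (norm_nonneg _) (hd k j) _) (hc0 k)
    have hlev : ∀ k, ∑' j, ‖p (k, j)‖ₑ ^ 2 ≤
        ENNReal.ofReal ((2 * B ^ 2 * (1 - θ)⁻¹) * θ ^ k) := fun k => by
      have hz : ∀ j ∉ Finset.range (2 ^ k + 1), ‖p (k, j)‖ₑ ^ 2 = 0 := fun j hj => by
        have : 2 ^ k < j := by simpa [Finset.mem_range, Nat.lt_succ_iff] using hj
        simp [p, hd0 k j this]
      rw [tsum_eq_sum hz]
      refine (Finset.sum_le_card_nsmul _ _ _ fun j _ => hpn k j).trans ?_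
      rw [Finset.card_range, nsmul_eq_mul, ← ENNReal.ofReal_natCast,
        ← ENNReal.ofReal_mul (by positivity)]
      refine ENNReal.ofReal_le_ofReal ?_
      have h2 : ((2 ^ k + 1 : ℕ) : ℝ) ≤ 2 * 2 ^ k := by
        push_cast; linarith [one_le_pow₀ (one_le_two : (1 : ℝ) ≤ 2) (n := k)]
      have h3 : (2 : ℝ) ^ k * (a ^ k) ^ 2 = θ ^ k * θ ^ k := by
        rw [← pow_mul, mul_comm k 2, pow_mul, ← mul_pow, hθa, ← mul_pow, pow_two]
      have hk : θ ^ k ≠ 0 := by positivity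
      calc _ ≤ 2 * 2 ^ k * (c k * (B * a ^ k) ^ 2) := by
            refine mul_le_mul_of_nonneg_right h2 (mul_nonneg (hc0 k) (sq_nonneg _))
        _ = 2 * B ^ 2 * (1 - θ)⁻¹ * (θ ^ k)⁻¹ * (2 ^ k * (a ^ k) ^ 2) := by simp only [hc]; ring
        _ = _ := by rw [h3]; field_simp
    rw [ENNReal.tsum_prod']
    refine (ENNReal.tsum_le_tsum hlev).trans ?_
    rw [← ENNReal.ofReal_tsum_of_nonneg (fun k => by positivity)
      ((summable_geometric_of_lt_one h0.le h1).mul_left _), tsum_mul_left,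
      tsum_geometric_of_lt_one h0.le h1]
    refine ENNReal.ofReal_le_ofReal (le_of_eq ?_)
    ring
  · have hlim : Tendsto (fun N => ‖L (∑ k ∈ Finset.range N, d k (J k t))‖ₑ ^ 2) atTop
        (𝓝 (‖L (P t)‖ₑ ^ 2)) :=
      ((ENNReal.continuous_pow 2).tendsto _).comp
        (continuous_enorm.tendsto _ |>.comp ((L.continuous.tendsto _).comp (hP t)))
    refine le_of_tendsto hlim (Eventually.of_forall fun N => ?_)
    have hN : ‖L (∑ k ∈ Finset.range N, d k (J k t))‖ ^ 2 ≤
        ∑ k ∈ Finset.range N, ‖L (p (k, J k t))‖ ^ 2 := by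
      rw [map_sum]
      calc _ ≤ (∑ k ∈ Finset.range N, ‖L (d k (J k t))‖) ^ 2 :=
            pow_le_pow_left₀ (norm_nonneg _) (norm_sum_le _ _) _
        _ ≤ _ := sq_sum_le_tsum_weighted h0 h1 _ N
        _ = _ := by
            refine Finset.sum_congr rfl fun k _ => ?_
            simp only [p, map_smul, smul_eq_mul]
            rw [hsq]
    calc ‖L (∑ k ∈ Finset.range N, d k (J k t))‖ₑ ^ 2
        = ENNReal.ofReal (‖L (∑ k ∈ Finset.range N, d k (J k t))‖ ^ 2) := by
          rw [ENNReal.ofReal_pow (norm_nonneg _), ofReal_norm]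
      _ ≤ ENNReal.ofReal (∑ k ∈ Finset.range N, ‖L (p (k, J k t))‖ ^ 2) :=
          ENNReal.ofReal_le_ofReal hN
      _ = ∑ k ∈ Finset.range N, ‖L (p (k, J k t))‖ₑ ^ 2 := by
          rw [ENNReal.ofReal_sum_of_nonneg fun _ _ => by positivity]
          refine Finset.sum_congr rfl fun k _ => ?_
          rw [ENNReal.ofReal_pow (norm_nonneg _), ofReal_norm]
      _ ≤ ∑' k, ‖L (p (k, J k t))‖ₑ ^ 2 := ENNReal.sum_le_tsum _
      _ ≤ ∑' k, ∑' j, ‖L (p (k, j))‖ₑ ^ 2 :=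
          ENNReal.tsum_le_tsum fun k => ENNReal.le_tsum (f := fun j => ‖L (p (k, j))‖ₑ ^ 2) _
      _ = _ := (ENNReal.tsum_prod' (f := fun i => ‖L (p i)‖ₑ ^ 2)).symm

/-- A path of finite `1/κ`-variation with `κ > 1/2` is dominated by a square-summable family. -/
theorem exists_atoms {κ : ℝ} (hκ : 1 / 2 < κ) (hκ1 : κ ≤ 1) :
    ∃ C : ℝ≥0, ∀ (S : Set ℝ) (t₀ : ℝ) (P : ℝ → V) (ω : ℝ → ℝ) (A : ℝ), t₀ ∈ S → 0 ≤ A →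
      (∀ t ∈ S, 0 ≤ ω t ∧ ω t ≤ 1) →
      (∀ t ∈ S, ∀ t' ∈ S, ‖P t - P t'‖ ≤ A * |ω t - ω t'| ^ κ) →
      ∃ p : ℕ × ℕ → V, ∑' i, ‖p i‖ₑ ^ 2 ≤ C * (‖P t₀‖ₑ + ENNReal.ofReal A) ^ 2 ∧
        ∀ (L : V →L[ℂ] ℂ), ∀ t ∈ S, ‖L (P t)‖ₑ ^ 2 ≤ ∑' i, ‖L (p i)‖ₑ ^ 2 := by
  -- Between cells of `ω`-width `2^(-k)` the path moves by about `a^k`. The ratio `θ = 2^(1/2 - κ)`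
  -- is below one exactly because `κ > 1/2`.
  set a : ℝ := 2 ^ (-κ)
  have ha0 : 0 < a := by positivity
  set θ : ℝ := √(2 * a ^ 2)
  have hθ0 : 0 < θ := Real.sqrt_pos.2 (by positivity)
  have hθa : 2 * a ^ 2 = θ ^ 2 := (Real.sq_sqrt (by positivity)).symm
  have ha2 : 2 * a ^ 2 = 2 ^ (1 - 2 * κ) := by
    rw [← Real.rpow_mul_natCast (by norm_num), sub_eq_add_neg, Real.rpow_add (by norm_num),
      Real.rpow_one]
    congr 2; push_cast; ring
  have hθ1 : θ < 1 := by
    rw [Real.sqrt_lt' one_pos, ha2, one_pow]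
    exact Real.rpow_lt_one_of_one_lt_of_neg (by norm_num) (by linarith)
  have ha12 : 1 ≤ 2 * a := by
    have : (2 : ℝ) ^ (-1 : ℝ) ≤ a := Real.rpow_le_rpow_of_exponent_le (by norm_num) (by linarith)
    rw [Real.rpow_neg_one] at this
    linarith
  have hak : ∀ k : ℕ, ((2 : ℝ)⁻¹ ^ k) ^ κ = a ^ k := fun k => by
    rw [← Real.rpow_natCast, ← Real.rpow_mul (by norm_num), Real.inv_rpow (by norm_num),
      ← Real.rpow_neg (by norm_num), ← Real.rpow_mul_natCast (by norm_num)]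
    congr 1; ring
  refine ⟨(2 * ((1 - θ)⁻¹ * 4) ^ 2).toNNReal, fun S t₀ P ω A ht₀ hA hω hP => ?_⟩
  -- A representative time for each dyadic cell `j` of `ω` at level `k`. At level zero it is always
  -- `t₀`, and the required bound is just that `ω` takes values in `[0, 1]`.
  have hR : ∀ k j : ℕ, ∃ r ∈ S, (k = 0 → r = t₀) ∧
      ∀ t ∈ S, ⌊2 ^ k * ω t⌋₊ = j → |ω t - ω r| ≤ 2⁻¹ ^ k := by
    intro k j
    obtain rfl | hk := eq_or_ne k 0
    · refine ⟨t₀, ht₀, fun _ => rfl, fun t ht _ => ?_⟩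
      rw [pow_zero, abs_le]
      constructor <;> linarith [(hω t ht).1, (hω t ht).2, (hω t₀ ht₀).1, (hω t₀ ht₀).2]
    · by_cases h : ∃ r ∈ S, ⌊2 ^ k * ω r⌋₊ = j
      · obtain ⟨r, hr, hrj⟩ := h
        refine ⟨r, hr, fun h => absurd h hk, fun t ht htj => ?_⟩
        have p2 : (0 : ℝ) < 2 ^ k := by positivity
        have b1 := Nat.floor_le (mul_nonneg p2.le (hω t ht).1)
        have b2 := Nat.lt_floor_add_one (2 ^ k * ω t)
        have b3 := Nat.floor_le (mul_nonneg p2.le (hω r hr).1)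
        have b4 := Nat.lt_floor_add_one (2 ^ k * ω r)
        rw [htj] at b1 b2
        rw [hrj] at b3 b4
        rw [inv_pow, ← one_div, le_div_iff₀ p2, ← abs_of_pos p2, ← abs_mul, abs_le]
        constructor <;> nlinarith
      · exact ⟨t₀, ht₀, fun h => absurd h hk, fun t ht htj => absurd ⟨t, ht, htj⟩ h⟩
  choose R hRS hR0 hRω using hR
  set D : ℝ := ‖P t₀‖ + A
  have hD : 0 ≤ D := by positivity
  have hclose : ∀ k, ∀ t ∈ S, ‖P t - P (R k ⌊2 ^ k * ω t⌋₊)‖ ≤ A * a ^ k := fun k t ht => by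
    refine (hP t ht _ (hRS _ _)).trans (mul_le_mul_of_nonneg_left ?_ hA)
    rw [← hak]
    exact Real.rpow_le_rpow (abs_nonneg _) (hRω k _ t ht rfl) (by linarith)
  have hhalf : ∀ k t, ⌊2 ^ (k + 1) * ω t⌋₊ / 2 = ⌊2 ^ k * ω t⌋₊ := fun k t => by
    rw [← Nat.floor_div_ofNat, pow_succ]
    congr 1; ring
  classical
  -- The parent of cell `j` is `j / 2`, so an increment depends only on the cell and not on the
  -- time. This is why each level has so few distinct increments. Level zero contains the single
  -- value `P t₀`.
  set d : ℕ → ℕ → V := fun k j => match k with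
    | 0 => if j = 0 then P t₀ else 0
    | k + 1 => if ∃ t ∈ S, ⌊2 ^ (k + 1) * ω t⌋₊ = j then P (R (k + 1) j) - P (R k (j / 2)) else 0
  set J : ℕ → S → ℕ := fun k t => match k with
    | 0 => 0
    | k + 1 => ⌊2 ^ (k + 1) * ω t⌋₊
  -- An increment is at most `A * a^(k+1) + A * a^k`; since `κ ≤ 1` gives `a ≥ 1/2`, this is at most
  -- `4 * D * a^(k+1)`.
  have hd : ∀ k j, ‖d k j‖ ≤ (4 * D) * a ^ k := by
    intro k j
    rcases k with _ | k
    · simp only [d, pow_zero]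
      split_ifs
      · have := norm_nonneg (P t₀); simp only [D]; linarith
      · rw [norm_zero]; linarith
    · simp only [d]
      split_ifs with h
      · obtain ⟨t, ht, rfl⟩ := h
        rw [hhalf]
        have h1 := hclose (k + 1) t ht
        have h2 := hclose k t ht
        have h3 : A ≤ D := le_add_of_nonneg_left (norm_nonneg _)
        have h4 : a ^ k ≤ 2 * a ^ (k + 1) := by
          rw [pow_succ]; nlinarith [pow_pos ha0 k]
        have h5 : a ^ (k + 1) ≤ 2 * a ^ (k + 1) := by linarith [pow_pos ha0 (k + 1)]
        calc _ ≤ A * a ^ (k + 1) + A * a ^ k := by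
              rw [← sub_sub_sub_cancel_left _ _ (P t)]
              exact (norm_sub_le _ _).trans (by linarith)
          _ ≤ D * (2 * a ^ (k + 1)) + D * (2 * a ^ (k + 1)) := by gcongr
          _ = _ := by ring
      · rw [norm_zero]; positivity
  have hd0 : ∀ k j, 2 ^ k < j → d k j = 0 := by
    intro k j hj
    rcases k with _ | k
    · have : j ≠ 0 := by rintro rfl; simp at hj
      simp [d, this]
    · simp only [d]
      rw [if_neg]
      rintro ⟨t, ht, rfl⟩
      have : ⌊2 ^ (k + 1) * ω t⌋₊ ≤ 2 ^ (k + 1) := by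
        refine Nat.floor_le_of_le ?_
        push_cast
        nlinarith [(hω t ht).2, pow_pos (zero_lt_two : (0 : ℝ) < 2) (k + 1)]
      omega
  have hsum : ∀ (t : S) N, ∑ k ∈ Finset.range (N + 1), d k (J k t) = P (R N ⌊2 ^ N * ω t⌋₊) := by
    intro t N
    induction N with
    | zero => simp [d, J, hR0 0 _ rfl]
    | succ N ih =>
      rw [Finset.sum_range_succ, ih]
      simp only [d, J]
      rw [if_pos ⟨t, t.2, rfl⟩, hhalf]
      abel
  have hlim : ∀ t : S, Tendsto (fun N => ∑ k ∈ Finset.range N, d k (J k t)) atTop (𝓝 (P t)) := by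
    intro t
    rw [← tendsto_add_atTop_iff_nat 1]
    simp only [hsum]
    rw [tendsto_iff_norm_sub_tendsto_zero]
    have ha1 : a < 1 := Real.rpow_lt_one_of_one_lt_of_neg (by norm_num) (by linarith)
    have := (tendsto_pow_atTop_nhds_zero_of_lt_one ha0.le ha1).const_mul A
    rw [mul_zero] at this
    refine squeeze_zero (fun _ => norm_nonneg _) (fun N => ?_) this
    rw [norm_sub_rev]
    exact hclose N t t.2
  obtain ⟨p, hp, hpL⟩ := exists_atoms_of_increments hθ0 hθ1 hθa (P := fun t : S => P t) hd hd0 hlim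
  refine ⟨p, hp.trans (le_of_eq ?_), fun L t ht => hpL L ⟨t, ht⟩⟩
  rw [← ofReal_norm, ← ENNReal.ofReal_add (norm_nonneg _) hA, ← ENNReal.ofReal_pow hD,
    ENNReal.ofNNReal_toNNReal, ← ENNReal.ofReal_mul (by positivity)]
  congr 1; ring

end Atoms

/-! ### Completeness of the Schwartz space and uniform boundedness -/

section SchwartzComplete

open Filter Topology Uniformity
open scoped ContDiff

variable {D : Type*} [NormedAddCommGroup D] [NormedSpace ℝ D]

theorem exists_tsum_schwartz {f : ℕ → 𝓢(D, ℂ)}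
    (hf : ∀ k n, Summable fun j => SchwartzMap.seminorm ℂ k n (f j)) :
    ∃ S : 𝓢(D, ℂ), (∀ x, S x = ∑' j, f j x) ∧
      ∀ k n, SchwartzMap.seminorm ℂ k n S ≤ ∑' j, SchwartzMap.seminorm ℂ k n (f j) := by
  have hd : ∀ (n : ℕ) (j : ℕ) (x : D),
      ‖iteratedFDeriv ℝ n (f j) x‖ ≤ SchwartzMap.seminorm ℂ 0 n (f j) := fun n j x =>
    SchwartzMap.norm_iteratedFDeriv_le_seminorm ℂ (f j) n x
  have hsmooth : ContDiff ℝ ∞ fun x => ∑' j, f j x :=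
    contDiff_tsum (v := fun n j => SchwartzMap.seminorm ℂ 0 n (f j))
      (fun j => (f j).smooth ⊤) (fun n _ => hf 0 n) (fun n j x _ => hd n j x)
  have hbound : ∀ k n (x : D), ‖x‖ ^ k * ‖iteratedFDeriv ℝ n (fun x => ∑' j, f j x) x‖ ≤
      ∑' j, SchwartzMap.seminorm ℂ k n (f j) := by
    intro k n x
    have hs : Summable fun j => ‖iteratedFDeriv ℝ n (f j) x‖ :=
      Summable.of_nonneg_of_le (fun _ => norm_nonneg _) (fun j => hd n j x) (hf 0 n)
    have he := iteratedFDeriv_tsum_apply (𝕜 := ℝ) (N := ⊤) (f := fun j => (f j : D → ℂ))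
      (v := fun n j => SchwartzMap.seminorm ℂ 0 n (f j))
      (fun j => (f j).smooth ⊤) (fun n _ => hf 0 n) (fun n j x _ => hd n j x) (k := n) le_top x
    rw [he]
    calc ‖x‖ ^ k * ‖∑' j, iteratedFDeriv ℝ n (f j) x‖
        ≤ ‖x‖ ^ k * ∑' j, ‖iteratedFDeriv ℝ n (f j) x‖ := by
          gcongr; exact norm_tsum_le_tsum_norm hs
      _ = ∑' j, ‖x‖ ^ k * ‖iteratedFDeriv ℝ n (f j) x‖ := tsum_mul_left.symm
      _ ≤ _ := (hs.mul_left _).tsum_le_tsum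
          (fun j => SchwartzMap.le_seminorm ℂ k n (f j) x) (hf k n)
  refine ⟨⟨fun x => ∑' j, f j x, hsmooth, fun k n => ⟨_, hbound k n⟩⟩, fun x => rfl, fun k n => ?_⟩
  exact SchwartzMap.seminorm_le_bound ℂ k n _ (tsum_nonneg fun j => apply_nonneg _ _)
    (hbound k n)

theorem exists_tendsto_sum_schwartz {f : ℕ → 𝓢(D, ℂ)}
    (hf : ∀ k n, Summable fun j => SchwartzMap.seminorm ℂ k n (f j)) :
    ∃ S : 𝓢(D, ℂ), Tendsto (fun N => ∑ j ∈ Finset.range N, f j) atTop (𝓝 S) := by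
  obtain ⟨S, hS, -⟩ := exists_tsum_schwartz hf
  refine ⟨S, ((schwartz_withSeminorms ℂ D ℂ).tendsto_nhds_atTop _ _).2 fun i ε hε => ?_⟩
  have htail := tendsto_sum_nat_add fun j => SchwartzMap.seminorm ℂ i.1 i.2 (f j)
  obtain ⟨N₀, hN₀⟩ := eventually_atTop.1 (htail.eventually (gt_mem_nhds hε))
  refine ⟨N₀, fun N hN => lt_of_le_of_lt ?_ (hN₀ N hN)⟩
  obtain ⟨R, hR, hRb⟩ := exists_tsum_schwartz (f := fun j => f (j + N))
    (fun k n => (summable_nat_add_iff N).2 (hf k n))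
  have e : ∑ j ∈ Finset.range N, f j - S = -R := by
    ext x
    have hsx : Summable fun j => f j x := by
      refine Summable.of_norm_bounded (hf 0 0) fun j => ?_
      exact SchwartzMap.norm_le_seminorm ℂ (f j) x
    have h1 := hsx.sum_add_tsum_nat_add N
    rw [sub_apply, neg_apply, hS, hR, sum_apply, ← h1]
    ring
  rw [e, SchwartzMap.schwartzSeminormFamily_apply, map_neg_eq_map]
  exact hRb i.1 i.2

/-- Completeness is what the Banach–Steinhaus theorem needs. The uniformity is countably generated,
so it suffices to treat sequences whose increments decay geometrically in growing sets of seminorms;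
for each fixed seminorm these increments are summable. -/
instance : CompleteSpace 𝓢(D, ℂ) := by
  have : (𝓤 𝓢(D, ℂ)).IsCountablyGenerated := IsUniformAddGroup.uniformity_countably_generated
  set p := schwartzSeminormFamily ℂ D ℂ
  have hp : WithSeminorms p := schwartz_withSeminorms ℂ D ℂ
  set s : ℕ → Finset (ℕ × ℕ) := fun N => Finset.range N ×ˢ Finset.range N
  have hnhds : ∀ N, {φ : 𝓢(D, ℂ) | (s N).sup p φ < (1 / 2) ^ N} ∈ 𝓝 (0 : 𝓢(D, ℂ)) := fun N =>
    by
      have := (hp.tendsto_nhds' id 0).1 tendsto_id (s N) ((1 / 2) ^ N) (by positivity)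
      simp only [id, sub_zero] at this
      exact this
  refine UniformSpace.complete_of_convergent_controlled_sequences
    (fun N => {z : 𝓢(D, ℂ) × 𝓢(D, ℂ) | (s N).sup p (z.2 - z.1) < (1 / 2) ^ N}) (fun N => ?_)
    fun u hu => ?_
  · rw [uniformity_eq_comap_nhds_zero]
    exact preimage_mem_comap (hnhds N)
  · have hsum : ∀ k n, Summable fun j => SchwartzMap.seminorm ℂ k n (u (j + 1) - u j) := by
      intro k n
      refine Summable.of_norm_bounded_eventually_nat summable_geometric_two ?_
      refine eventually_atTop.2 ⟨max k n + 1, fun j hj => ?_⟩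
      rw [Real.norm_of_nonneg (apply_nonneg _ _)]
      have h1 := hu j j (j + 1) le_rfl (Nat.le_succ j)
      have h2 : p (k, n) ≤ (s j).sup p := Finset.le_sup (f := p) (by
        simp only [s, Finset.mem_product, Finset.mem_range]
        constructor <;> omega)
      exact (h2 _).trans (le_of_lt h1)
    obtain ⟨S, hS⟩ := exists_tendsto_sum_schwartz hsum
    refine ⟨S + u 0, ?_⟩
    have : ∀ N, u N = ∑ j ∈ Finset.range N, (u (j + 1) - u j) + u 0 := fun N => by
      rw [Finset.sum_range_sub]; abel
    exact (hS.add_const (u 0)).congr fun N => (this N).symm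

/-- The uniform boundedness principle for functionals on the Schwartz space. -/
theorem exists_seminorm_bound {ι : Type*} {T : ι → 𝓢(D, ℂ) →L[ℂ] ℂ}
    (hT : ∀ φ, ∃ C : ℝ, ∀ i, ‖T i φ‖ ≤ C) :
    ∃ (s : Finset (ℕ × ℕ)) (C : ℝ≥0), ∀ i φ,
      ‖T i φ‖ ≤ C * (s.sup (schwartzSeminormFamily ℂ D ℂ)) φ := by
  have : (𝓤 𝓢(D, ℂ)).IsCountablyGenerated := IsUniformAddGroup.uniformity_countably_generated
  have hBS : UniformEquicontinuous ((↑) ∘ T : ι → 𝓢(D, ℂ) → ℂ) :=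
    (norm_withSeminorms ℂ ℂ).banach_steinhaus fun k φ => by
      obtain ⟨C, hC⟩ := hT φ
      exact ⟨C, by rintro _ ⟨i, rfl⟩; exact hC i⟩
  obtain ⟨q, hq, hTq⟩ := ((norm_withSeminorms ℂ ℂ).uniformEquicontinuous_iff_exists_continuous_seminorm
    (fun i => (T i).toLinearMap)).1 hBS 0
  obtain ⟨s, C, -, hC⟩ := Seminorm.bound_of_continuous (schwartz_withSeminorms ℂ D ℂ) q hq
  exact ⟨s, C, fun i φ => (hTq i φ).trans (hC φ)⟩

end SchwartzComplete

/-! ### The free evolution acting on Schwartz functions -/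

section Multipliers

open Filter Topology
open scoped ContDiff

variable {E : Type*} [NormedAddCommGroup E] [InnerProductSpace ℝ E] [FiniteDimensional ℝ E]
  [MeasurableSpace E] [BorelSpace E]

/-- Each derivative of the transform is the transform of a moment of `f`, hence bounded. -/
theorem hasTemperateGrowth_fourier {f : ℝ → ℂ} (hf : ∀ n : ℕ, Integrable fun x => x ^ n • f x) :
    (𝓕 f).HasTemperateGrowth := by
  have hf' : ∀ n : ℕ, Integrable fun x => ‖x‖ ^ n * ‖f x‖ := fun n => by
    refine (hf n).norm.congr (Eventually.of_forall fun x => ?_)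
    simp
  refine ⟨Real.contDiff_fourier fun n _ => hf' n, fun n =>
    ⟨0, ∫ x : ℝ, ‖(-2 * Real.pi * Complex.I * x : ℂ) ^ n • f x‖, fun x => ?_⟩⟩
  rw [norm_iteratedFDeriv_eq_norm_iteratedDeriv,
    Real.iteratedDeriv_fourier (N := ⊤) (fun n _ => hf n) le_top, pow_zero, mul_one]
  exact norm_fourier_le _ x

/-- The density on `[0, 1]` of the Taylor remainder of the exponential. -/
def taylorDensity (θ : ℝ) : ℂ := (Ioc (0 : ℝ) 1).indicator (fun θ => ((1 - θ : ℝ) : ℂ)) θ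

theorem hasTemperateGrowth_fourier_taylorDensity : (𝓕 taylorDensity).HasTemperateGrowth := by
  refine hasTemperateGrowth_fourier fun n => ?_
  have h1 : IntegrableOn (fun θ : ℝ => θ ^ n • ((1 - θ : ℝ) : ℂ)) (Ioc 0 1) :=
    (Continuous.integrableOn_Icc (by fun_prop)).mono_set Ioc_subset_Icc_self
  refine ((integrable_indicator_iff measurableSet_Ioc).2 h1).congr
    (Eventually.of_forall fun θ => ?_)
  by_cases h : θ ∈ Ioc (0 : ℝ) 1 <;> simp [taylorDensity, h]

/-- Integral form of the second-order Taylor remainder. It is written as a Fourier transform of a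
compactly supported density so that its temperate growth follows from `hasTemperateGrowth_fourier`.
-/
theorem exp_eq_taylor (x : ℝ) : Complex.exp (x * Complex.I) =
    1 + x * Complex.I - x ^ 2 * 𝓕 taylorDensity (-(x / (2 * Real.pi))) := by
  obtain rfl | hx := eq_or_ne x 0
  · simp
  have hpi := Real.pi_ne_zero
  have hxI : (x : ℂ) * Complex.I ≠ 0 := by simp [hx]
  have hint : 𝓕 taylorDensity (-(x / (2 * Real.pi))) =
      ∫ θ in (0 : ℝ)..1, (1 - θ : ℂ) * Complex.exp (θ * (x * Complex.I)) := by
    rw [Real.fourier_eq', intervalIntegral.integral_of_le zero_le_one, ← integral_indicator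
      measurableSet_Ioc]
    refine integral_congr_ae (Eventually.of_forall fun θ => ?_)
    by_cases h : θ ∈ Ioc (0 : ℝ) 1
    · simp only [taylorDensity, h, indicator_of_mem, smul_eq_mul]
      rw [mul_comm]
      congr 1
      · push_cast; rfl
      · congr 1
        rw [RCLike.inner_apply, conj_trivial]
        have : (-2 * Real.pi * (-(x / (2 * Real.pi)) * θ)) = θ * x := by field_simp
        rw [this]; push_cast; ring
    · simp [taylorDensity, h]
  have hFTC : ∫ θ in (0 : ℝ)..1, (1 - θ : ℂ) * Complex.exp (θ * (x * Complex.I)) =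
      ((1 - (1 : ℝ) : ℂ) / (x * Complex.I) + 1 / (x * Complex.I) ^ 2) *
        Complex.exp ((1 : ℝ) * (x * Complex.I)) -
      ((1 - (0 : ℝ) : ℂ) / (x * Complex.I) + 1 / (x * Complex.I) ^ 2) *
        Complex.exp ((0 : ℝ) * (x * Complex.I)) := by
    refine intervalIntegral.integral_eq_sub_of_hasDerivAt (f := fun θ : ℝ =>
      ((1 - θ : ℂ) / (x * Complex.I) + 1 / (x * Complex.I) ^ 2) *
        Complex.exp (θ * (x * Complex.I))) (fun θ _ => ?_)
      (Continuous.intervalIntegrable (by fun_prop) _ _)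
    have h1 : HasDerivAt (fun θ : ℝ => (1 - θ : ℂ) / (x * Complex.I) + 1 / (x * Complex.I) ^ 2)
        (-1 / (x * Complex.I)) θ :=
      (((hasDerivAt_const θ (1 : ℂ)).sub Complex.ofRealCLM.hasDerivAt).div_const _ |>.add_const _).congr_deriv
        (by simp)
    have h2 : HasDerivAt (fun θ : ℝ => Complex.exp (θ * (x * Complex.I)))
        (Complex.exp (θ * (x * Complex.I)) * (1 * (x * Complex.I))) θ :=
      (Complex.ofRealCLM.hasDerivAt.mul_const _).cexp
    refine (h1.mul h2).congr_deriv ?_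
    have hx' : (x : ℂ) ≠ 0 := by exact_mod_cast hx
    have hI := Complex.I_ne_zero
    field_simp
    ring
  rw [hint, hFTC]
  have hx' : (x : ℂ) ≠ 0 := by exact_mod_cast hx
  push_cast
  simp only [zero_mul, Complex.exp_zero, one_mul, sub_self, zero_div, zero_add, sub_zero, mul_one]
  field_simp
  rw [Complex.I_sq]
  ring

theorem hasTemperateGrowth_fst_mul_norm_sq (c : ℝ) :
    (fun z : ℝ × E => c * z.1 * ‖z.2‖ ^ 2).HasTemperateGrowth := by
  have h1 : (fun z : ℝ × E => z.1).HasTemperateGrowth :=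
    (ContinuousLinearMap.fst ℝ ℝ E).hasTemperateGrowth
  have h2 : (fun z : ℝ × E => ‖z.2‖ ^ 2).HasTemperateGrowth :=
    (Function.hasTemperateGrowth_norm_sq E).comp
      (ContinuousLinearMap.snd ℝ ℝ E).hasTemperateGrowth
  exact ((Function.HasTemperateGrowth.const c).mul h1).mul h2

/-- The symbol of the second-order remainder of the free evolution. -/
def evolRemainder (η : ℝ) (ξ : E) : ℂ := 𝓕 taylorDensity (-(2 * Real.pi) * η * ‖ξ‖ ^ 2)

theorem hasTemperateGrowth_evolRemainder :
    (fun z : ℝ × E => evolRemainder z.1 z.2).HasTemperateGrowth :=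
  hasTemperateGrowth_fourier_taylorDensity.comp (hasTemperateGrowth_fst_mul_norm_sq _)

/-- The symbol of minus the Laplacian. -/
def lapSymbol (ξ : E) : ℂ := ((4 * Real.pi ^ 2 * ‖ξ‖ ^ 2 : ℝ) : ℂ)

theorem evol_eq_taylor (η : ℝ) (ξ : E) : evol η ξ =
    1 + Complex.I * η * lapSymbol ξ - η ^ 2 * (lapSymbol ξ * lapSymbol ξ * evolRemainder η ξ) := by
  rw [evol, exp_eq_taylor, lapSymbol, evolRemainder]
  have : -(4 * Real.pi ^ 2 * η * ‖ξ‖ ^ 2 / (2 * Real.pi)) = -(2 * Real.pi) * η * ‖ξ‖ ^ 2 := by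
    have := Real.pi_ne_zero
    field_simp; ring
  rw [this]; push_cast; ring

theorem hasTemperateGrowth_lapSymbol : (lapSymbol : E → ℂ).HasTemperateGrowth := by
  have h1 : (fun ξ : E => 4 * Real.pi ^ 2 * ‖ξ‖ ^ 2).HasTemperateGrowth :=
    (Function.HasTemperateGrowth.const _).mul (Function.hasTemperateGrowth_norm_sq E)
  exact Function.Complex.hasTemperateGrowth_ofReal.comp h1

theorem hasTemperateGrowth_comp_prodMk {D : Type*} [NormedAddCommGroup D]
    [NormedSpace ℝ D] {G : ℝ × D → ℂ} (hG : G.HasTemperateGrowth) (η : ℝ) :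
    (fun ξ => G (η, ξ)).HasTemperateGrowth := by
  have h : (fun ξ : D => ((η, 0) : ℝ × D) + ContinuousLinearMap.inr ℝ ℝ D ξ).HasTemperateGrowth :=
    (Function.HasTemperateGrowth.const _).add (ContinuousLinearMap.inr ℝ ℝ D).hasTemperateGrowth
  have := hG.comp h
  refine cast ?_ this
  congr 1
  funext ξ
  simp

theorem hasTemperateGrowth_evol (t : ℝ) : (evol t : E → ℂ).HasTemperateGrowth := by
  have h1 : (evolRemainder t : E → ℂ).HasTemperateGrowth :=
    hasTemperateGrowth_comp_prodMk hasTemperateGrowth_evolRemainder t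
  have h2 := hasTemperateGrowth_lapSymbol (E := E)
  have h3 : (fun ξ : E => 1 + Complex.I * t * lapSymbol ξ -
      t ^ 2 * (lapSymbol ξ * lapSymbol ξ * evolRemainder t ξ)).HasTemperateGrowth :=
    ((Function.HasTemperateGrowth.const _).add ((Function.HasTemperateGrowth.const _).mul h2)).sub
      ((Function.HasTemperateGrowth.const _).mul ((h2.mul h2).mul h1))
  refine cast ?_ h3
  congr 1
  funext ξ
  exact (evol_eq_taylor t ξ).symm

/-- Temperate growth of `G` in both variables jointly gives polynomial bounds on the `ξ`-derivatives
that are uniform for `|η| ≤ 1`; the rest is the Leibniz rule. The uniformity in `η` is what makes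
the Taylor expansion of the evolution valid in the Schwartz topology. -/
theorem exists_seminorm_smul_le {D : Type*} [NormedAddCommGroup D] [NormedSpace ℝ D]
    {G : ℝ × D → ℂ} (hG : G.HasTemperateGrowth) (φ : 𝓢(D, ℂ)) (s : Finset (ℕ × ℕ)) :
    ∃ C : ℝ, 0 ≤ C ∧ ∀ η : ℝ, |η| ≤ 1 → (s.sup (schwartzSeminormFamily ℂ D ℂ))
      (SchwartzMap.smulLeftCLM ℂ (fun ξ => G (η, ξ)) φ) ≤ C := by
  have key : ∀ i : ℕ × ℕ, ∃ C : ℝ, 0 ≤ C ∧ ∀ η : ℝ, |η| ≤ 1 →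
      SchwartzMap.seminorm ℂ i.1 i.2 (SchwartzMap.smulLeftCLM ℂ (fun ξ => G (η, ξ)) φ) ≤ C := by
    rintro ⟨k, n⟩
    obtain ⟨l, B, hB, hGB⟩ := hG.norm_iteratedFDeriv_le_uniform n
    set p : ℕ → ℕ → ℝ := fun k n => SchwartzMap.seminorm ℂ k n φ
    have hp : ∀ k n, 0 ≤ p k n := fun k n => apply_nonneg _ _
    refine ⟨∑ i ∈ Finset.range (n + 1), (n.choose i : ℝ) *
      (B * (2 ^ (l - 1) * (2 ^ l * p k (n - i) + p (k + l) (n - i)))), Finset.sum_nonneg fun i _ =>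
        by have := hp k (n - i); have := hp (k + l) (n - i); positivity, fun η hη => ?_⟩
    refine SchwartzMap.seminorm_le_bound ℂ k n _ (Finset.sum_nonneg fun i _ =>
        by have := hp k (n - i); have := hp (k + l) (n - i); positivity) fun x => ?_
    have hGη := hasTemperateGrowth_comp_prodMk hG η
    rw [SchwartzMap.smulLeftCLM_apply hGη]
    simp only [smul_eq_mul]
    have hDG : ∀ i ≤ n, ‖iteratedFDeriv ℝ i (fun ξ => G (η, ξ)) x‖ ≤ B * (2 + ‖x‖) ^ l := by
      intro i hi
      have e1 : (fun ξ => G (η, ξ)) =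
          (fun z => G ((η, 0) + z)) ∘ (ContinuousLinearMap.inr ℝ ℝ D) := by
        funext ξ; simp
      have hGt : ContDiff ℝ ∞ (fun z => G ((η, 0) + z)) := hG.1.comp (contDiff_const.add contDiff_id)
      rw [e1, ContinuousLinearMap.iteratedFDeriv_comp_right _ hGt x (mod_cast le_top),
        iteratedFDeriv_comp_add_left']
      refine (ContinuousMultilinearMap.norm_compContinuousLinearMap_le _ _).trans ?_
      have h1 : ∏ _j : Fin i, ‖ContinuousLinearMap.inr ℝ ℝ D‖ ≤ 1 :=
        Finset.prod_le_one (fun _ _ => norm_nonneg _)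
          fun _ _ => ContinuousLinearMap.norm_inr_le_one ℝ ℝ D
      have h2 : (1 : ℝ) + ‖((η, 0) + ContinuousLinearMap.inr ℝ ℝ D x : ℝ × D)‖ ≤ 2 + ‖x‖ := by
        simp only [ContinuousLinearMap.inr_apply, Prod.mk_add_mk, add_zero, zero_add, Prod.norm_mk,
          Real.norm_eq_abs]
        have : max |η| ‖x‖ ≤ 1 + ‖x‖ :=
          max_le (by linarith [norm_nonneg x]) (by linarith)
        linarith
      calc _ ≤ ‖iteratedFDeriv ℝ i G ((η, 0) + ContinuousLinearMap.inr ℝ ℝ D x)‖ * 1 :=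
            mul_le_mul_of_nonneg_left h1 (norm_nonneg _)
        _ ≤ B * (1 + ‖((η, 0) + ContinuousLinearMap.inr ℝ ℝ D x : ℝ × D)‖) ^ l := by
            rw [mul_one]; exact hGB i hi _
        _ ≤ _ := by gcongr
    have hpow : (2 + ‖x‖) ^ l ≤ 2 ^ (l - 1) * (2 ^ l + ‖x‖ ^ l) :=
      add_pow_le (by norm_num) (norm_nonneg _) l
    calc _ ≤ ‖x‖ ^ k * ∑ i ∈ Finset.range (n + 1), (n.choose i : ℝ) *
          ‖iteratedFDeriv ℝ i (fun ξ => G (η, ξ)) x‖ * ‖iteratedFDeriv ℝ (n - i) φ x‖ := by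
          gcongr
          exact norm_iteratedFDeriv_mul_le hGη.1 (φ.smooth ⊤) x (mod_cast le_top)
      _ = ∑ i ∈ Finset.range (n + 1), (n.choose i : ℝ) *
          (‖iteratedFDeriv ℝ i (fun ξ => G (η, ξ)) x‖ *
            (‖x‖ ^ k * ‖iteratedFDeriv ℝ (n - i) φ x‖)) := by
          rw [Finset.mul_sum]
          exact Finset.sum_congr rfl fun i _ => by ring
      _ ≤ _ := by
          refine Finset.sum_le_sum fun i hi => ?_
          rw [Finset.mem_range_succ_iff] at hi
          have h1 := SchwartzMap.le_seminorm ℂ k (n - i) φ x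
          have h2 := SchwartzMap.le_seminorm ℂ (k + l) (n - i) φ x
          refine mul_le_mul_of_nonneg_left ?_ (by positivity)
          calc _ ≤ (B * (2 ^ (l - 1) * (2 ^ l + ‖x‖ ^ l))) *
                (‖x‖ ^ k * ‖iteratedFDeriv ℝ (n - i) φ x‖) := by
                gcongr
                exact (hDG i hi).trans (by gcongr)
            _ = B * (2 ^ (l - 1) * (2 ^ l * (‖x‖ ^ k * ‖iteratedFDeriv ℝ (n - i) φ x‖) +
                ‖x‖ ^ (k + l) * ‖iteratedFDeriv ℝ (n - i) φ x‖)) := by rw [pow_add]; ring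
            _ ≤ _ := by gcongr
  choose C hC0 hC using key
  refine ⟨∑ i ∈ s, C i, Finset.sum_nonneg fun i _ => hC0 i, fun η hη => ?_⟩
  refine Seminorm.finset_sup_apply_le (Finset.sum_nonneg fun i _ => hC0 i) fun i hi => ?_
  exact (hC i η hη).trans (Finset.single_le_sum (fun i _ => hC0 i) hi)

/-- The free evolution on the Fourier side, acting on Schwartz functions. -/
def evolS (t : ℝ) : 𝓢(E, ℂ) →L[ℂ] 𝓢(E, ℂ) := SchwartzMap.smulLeftCLM ℂ (evol t)

theorem evolS_apply (t : ℝ) (ψ : 𝓢(E, ℂ)) (ξ : E) : evolS t ψ ξ = evol t ξ * ψ ξ := by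
  rw [evolS, SchwartzMap.smulLeftCLM_apply_apply (hasTemperateGrowth_evol t), smul_eq_mul]

theorem evolS_add (s t : ℝ) (ψ : 𝓢(E, ℂ)) : evolS (s + t) ψ = evolS s (evolS t ψ) := by
  ext ξ
  rw [evolS_apply, evolS_apply, evolS_apply, evol_add, mul_assoc]

theorem evolS_zero (ψ : 𝓢(E, ℂ)) : evolS 0 ψ = ψ := by
  ext ξ
  rw [evolS_apply, evol_zero, one_mul]

/-- Minus the Laplacian on the Fourier side. -/
def lapS : 𝓢(E, ℂ) →L[ℂ] 𝓢(E, ℂ) := SchwartzMap.smulLeftCLM ℂ lapSymbol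

theorem lapS_apply (ψ : 𝓢(E, ℂ)) (ξ : E) : lapS ψ ξ = lapSymbol ξ * ψ ξ := by
  rw [lapS, SchwartzMap.smulLeftCLM_apply_apply hasTemperateGrowth_lapSymbol, smul_eq_mul]

theorem evolS_eq_taylor (η : ℝ) (ψ : 𝓢(E, ℂ)) : evolS η ψ = ψ + (Complex.I * η) • lapS ψ -
    ((η : ℂ) ^ 2) • SchwartzMap.smulLeftCLM ℂ (evolRemainder η) (lapS (lapS ψ)) := by
  have h1 : (evolRemainder η : E → ℂ).HasTemperateGrowth :=
    hasTemperateGrowth_comp_prodMk hasTemperateGrowth_evolRemainder η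
  ext ξ
  rw [evolS_apply, evol_eq_taylor, sub_apply, add_apply, smul_apply, smul_apply,
    SchwartzMap.smulLeftCLM_apply_apply h1, lapS_apply, lapS_apply,
    lapS_apply]
  simp only [smul_eq_mul]
  ring

/-- First-order expansion of the free evolution in the Schwartz topology. -/
theorem exists_seminorm_evolS_sub_le (ψ : 𝓢(E, ℂ)) (s : Finset (ℕ × ℕ)) :
    ∃ C : ℝ, 0 ≤ C ∧ ∀ η : ℝ, |η| ≤ 1 → (s.sup (schwartzSeminormFamily ℂ E ℂ))
      (evolS η ψ - ψ - (Complex.I * η) • lapS ψ) ≤ C * η ^ 2 := by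
  obtain ⟨C, hC0, hC⟩ := exists_seminorm_smul_le hasTemperateGrowth_evolRemainder (lapS (lapS ψ)) s
  refine ⟨C, hC0, fun η hη => ?_⟩
  have e : evolS η ψ - ψ - (Complex.I * η) • lapS ψ =
      -(((η : ℂ) ^ 2) • SchwartzMap.smulLeftCLM ℂ (evolRemainder η) (lapS (lapS ψ))) := by
    rw [evolS_eq_taylor]; abel
  rw [e, map_neg_eq_map, map_smul_eq_mul, norm_pow, Complex.norm_real, Real.norm_eq_abs, sq_abs,
    mul_comm]
  exact mul_le_mul_of_nonneg_right (hC η hη) (sq_nonneg _)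

theorem exists_seminorm_evolS_sub_self_le (ψ : 𝓢(E, ℂ)) (s : Finset (ℕ × ℕ)) :
    ∃ C : ℝ, 0 ≤ C ∧ ∀ η : ℝ, |η| ≤ 1 → (s.sup (schwartzSeminormFamily ℂ E ℂ))
      (evolS η ψ - ψ) ≤ C * |η| := by
  obtain ⟨C, hC0, hC⟩ := exists_seminorm_evolS_sub_le ψ s
  set p := s.sup (schwartzSeminormFamily ℂ E ℂ)
  refine ⟨C + p (lapS ψ), by positivity, fun η hη => ?_⟩
  have h1 := map_add_le_add p (evolS η ψ - ψ - (Complex.I * η) • lapS ψ) ((Complex.I * η) • lapS ψ)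
  rw [sub_add_cancel, map_smul_eq_mul, norm_mul, Complex.norm_I, one_mul, Complex.norm_real,
    Real.norm_eq_abs] at h1
  have h2 : η ^ 2 ≤ |η| := by
    rw [← sq_abs]; nlinarith [abs_nonneg η]
  nlinarith [hC η hη]

end Multipliers

/-! ### Duhamel's formula in the interaction picture -/

section Duhamel

open Filter Topology

variable {n : ℕ}

theorem laplacian_apply_fourier (S : 𝓢'(Space n, ℂ)) (φ : 𝓢(Space n, ℂ)) :
    (Δ S) (𝓕 φ) = -(𝓕 S) (lapS φ) := by
  rw [← TemperedDistribution.fourier_apply, TemperedDistribution.laplacian_eq_fourierMultiplierCLM]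
  have e : lapS φ = ((4 * Real.pi ^ 2 : ℝ) : ℂ) •
      SchwartzMap.smulLeftCLM ℂ (fun x : Space n => Complex.ofReal (‖x‖ ^ 2)) φ := by
    ext ξ
    rw [lapS_apply, smul_apply, SchwartzMap.smulLeftCLM_apply_apply (by fun_prop), lapSymbol]
    simp only [smul_eq_mul]
    push_cast; ring
  rw [e, map_smul, TemperedDistribution.fourierMultiplierCLM_apply, ← Complex.coe_smul,
    FourierTransform.fourier_smul, FourierTransform.fourier_fourierInv_eq]
  rw [smul_apply, TemperedDistribution.smulLeftCLM_apply_apply]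
  simp only [smul_eq_mul]
  push_cast; ring

variable {I : Set ℝ} {U F : ℝ → 𝓢'(Space n, ℂ)}

theorem SolvesForced.fourier (h : SolvesForced I U F) (φ : 𝓢(Space n, ℂ)) {a b : ℝ} (ha : a ∈ I)
    (hb : b ∈ I) :
    IntervalIntegrable (fun s => 𝓕 (U s) (lapS φ)) volume a b ∧
    IntervalIntegrable (fun s => 𝓕 (F s) φ) volume a b ∧
    𝓕 (U b) φ - 𝓕 (U a) φ = -Complex.I * (∫ s in a..b, 𝓕 (U s) (lapS φ)) -
      Complex.I * ∫ s in a..b, 𝓕 (F s) φ := by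
  obtain ⟨h1, h2, h3⟩ := h (𝓕 φ) a ha b hb
  simp only [laplacian_apply_fourier] at h1 h3
  rw [intervalIntegral.integral_neg] at h3
  refine ⟨by convert h1.neg using 1; funext s; simp, h2, ?_⟩
  simp only [TemperedDistribution.fourier_apply] at h3 ⊢
  linear_combination (-Complex.I) * h3 + (U b (𝓕 φ) - U a (𝓕 φ)) * Complex.I_sq

theorem SolvesForced.continuousOn (h : SolvesForced I U F) (φ : 𝓢(Space n, ℂ)) {a b : ℝ}
    (hab : a ≤ b) (hI : Icc a b ⊆ I) : ContinuousOn (fun s => 𝓕 (U s) φ) (Icc a b) := by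
  have ha : a ∈ I := hI (left_mem_Icc.2 hab)
  have hb : b ∈ I := hI (right_mem_Icc.2 hab)
  obtain ⟨h1, h2, -⟩ := h.fourier φ ha hb
  have c1 := intervalIntegral.continuousOn_primitive_interval' h1 left_mem_uIcc
  have c2 := intervalIntegral.continuousOn_primitive_interval' h2 left_mem_uIcc
  rw [uIcc_of_le hab] at c1 c2
  refine ((((continuousOn_const (c := -Complex.I)).mul c1).sub
    ((continuousOn_const (c := Complex.I)).mul c2)).add
    (continuousOn_const (c := 𝓕 (U a) φ))).congr fun s hs => ?_
  have := (h.fourier φ ha (hI hs)).2.2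
  change 𝓕 (U s) φ = -Complex.I * (∫ x in a..s, 𝓕 (U x) (lapS φ)) -
    Complex.I * (∫ x in a..s, 𝓕 (F x) φ) + 𝓕 (U a) φ
  linear_combination this

/-- On compact time intervals the solution is uniformly bounded by a Schwartz seminorm. -/
theorem SolvesForced.exists_seminorm_bound (h : SolvesForced I U F) {a b : ℝ}
    (hab : a ≤ b) (hI : Icc a b ⊆ I) : ∃ (s : Finset (ℕ × ℕ)) (C : ℝ≥0), ∀ t ∈ Icc a b, ∀ φ,
      ‖𝓕 (U t) φ‖ ≤ C * (s.sup (schwartzSeminormFamily ℂ (Space n) ℂ)) φ := by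
  have hbd : ∀ φ, ∃ C : ℝ, ∀ t : Icc a b, ‖𝓕 (U t) φ‖ ≤ C := fun φ => by
    obtain ⟨C, hC⟩ := isCompact_Icc.exists_bound_of_continuousOn (h.continuousOn φ hab hI)
    exact ⟨C, fun t => hC t t.2⟩
  obtain ⟨s, C, hC⟩ := BilinearStrichartz.exists_seminorm_bound
    (T := fun t : Icc a b => (𝓕 (U t) : 𝓢(Space n, ℂ) →L[ℂ] ℂ)) hbd
  exact ⟨s, C, fun t ht φ => hC ⟨t, ht⟩ φ⟩

theorem lapS_evolS (t : ℝ) (ψ : 𝓢(Space n, ℂ)) : lapS (evolS t ψ) = evolS t (lapS ψ) := by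
  ext ξ
  rw [lapS_apply, evolS_apply, evolS_apply, lapS_apply]; ring

/-- The interaction picture of the solution varies by at most the integral of the forcing. -/
theorem SolvesForced.norm_evolS_sub_le (h : SolvesForced I U F) {a b : ℝ} (hab : a ≤ b)
    (hI : Icc a b ⊆ I) {ψ : 𝓢(Space n, ℂ)} {N κ : ℝ → ℝ} (hN : IntervalIntegrable N volume a b)
    (hN0 : ∀ s, 0 ≤ N s) (hκ : Continuous κ)
    (hF : ∀ᵐ s ∂volume.restrict (Icc a b), ∀ t, ‖𝓕 (F s) (evolS t ψ)‖ ≤ N s * κ t) :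
    ‖𝓕 (U b) (evolS b ψ) - 𝓕 (U a) (evolS a ψ)‖ ≤ ∫ s in a..b, N s * κ s := by
  obtain ⟨S, C₀, hC₀⟩ := h.exists_seminorm_bound hab hI
  set p := S.sup (schwartzSeminormFamily ℂ (Space n) ℂ)
  set g : ℝ → ℂ := fun t => 𝓕 (U t) (evolS t ψ) with hg
  have hshift : ∀ t z, evolS z ψ = evolS (z - t) (evolS t ψ) := fun t z => by
    rw [← evolS_add, sub_add_cancel]
  have hmul : ∀ {t x : ℝ} {φ : 𝓢(Space n, ℂ)}, t ∈ Icc a b → p φ ≤ x → ‖𝓕 (U t) φ‖ ≤ C₀ * x :=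
    fun ht hx => (hC₀ _ ht _).trans (mul_le_mul_of_nonneg_left hx C₀.2)
  -- Both the solution and the test function move with time. For a fixed test function continuity is
  -- known; the motion of the test function is controlled by the seminorm bound that holds uniformly
  -- over the solution on `[a, b]`.
  have hgc : ContinuousOn g (Icc a b) := by
    intro t ht
    obtain ⟨C, hC0, hC⟩ := exists_seminorm_evolS_sub_self_le (evolS t ψ) S
    have c1 : ContinuousWithinAt (fun z => 𝓕 (U z) (evolS t ψ)) (Icc a b) t :=
      h.continuousOn _ hab hI t ht
    have c2 : Tendsto (fun z => 𝓕 (U z) (evolS z ψ - evolS t ψ)) (𝓝[Icc a b] t) (𝓝 0) := by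
      refine squeeze_zero_norm' (a := fun z => C₀ * (C * |z - t|)) ?_ ?_
      · have hnear : ∀ᶠ z in 𝓝[Icc a b] t, |z - t| ≤ 1 :=
          nhdsWithin_le_nhds (by
            filter_upwards [Metric.closedBall_mem_nhds t one_pos] with z hz
            simpa [Real.dist_eq] using hz)
        filter_upwards [hnear, self_mem_nhdsWithin] with z hz1 hz2
        rw [hshift t z]
        exact hmul hz2 (hC _ hz1)
      · have : Continuous fun z : ℝ => C₀ * (C * |z - t|) := by fun_prop
        have h0 := (this.tendsto t).mono_left (nhdsWithin_le_nhds (s := Icc a b))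
        simpa using h0
    have := c2.add c1
    rw [zero_add] at this
    refine this.congr fun z => ?_
    simp only [hg]
    rw [map_sub, sub_add_cancel]
  -- The forcing is only integrable in time, so `g` need not be differentiable everywhere.
  -- Subtracting the primitive of `N * (κ + ε')` from `‖g t - g a‖` leaves a continuous function
  -- whose upper right slope is never positive, and the mean value inequality with slack `ε`
  -- applies.
  have hmain : ∀ ε' : ℝ, 0 < ε' → ∀ ε : ℝ, 0 < ε →
      ‖g b - g a‖ ≤ (∫ s in a..b, N s * (κ s + ε')) + ε * (b - a) := by
    intro ε' hε' ε hε
    have hNκ : ∀ ρ : ℝ, IntervalIntegrable (fun s => N s * (κ s + ρ)) volume a b := fun ρ =>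
      hN.mul_continuousOn (by fun_prop)
    set f : ℝ → ℝ := fun t => ‖g t - g a‖ - ∫ s in a..t, N s * (κ s + ε') with hf
    have hfc : ContinuousOn f (Icc a b) := by
      refine (hgc.sub continuousOn_const).norm.sub ?_
      have := intervalIntegral.continuousOn_primitive_interval' (hNκ ε') left_mem_uIcc
      rwa [uIcc_of_le hab] at this
    have hslope : ∀ t ∈ Ico a b, ∀ r, (0 : ℝ) < r → ∃ᶠ z in 𝓝[>] t, slope f t z < r := by
      intro t ht r hr
      refine Eventually.frequently ?_
      have htI : t ∈ Icc a b := ⟨ht.1, ht.2.le⟩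
      obtain ⟨C₁, hC₁0, hC₁⟩ := exists_seminorm_evolS_sub_le (evolS t ψ) S
      obtain ⟨C₂, hC₂0, hC₂⟩ := exists_seminorm_evolS_sub_self_le (lapS (evolS t ψ)) S
      have hz1 : ∀ᶠ z in 𝓝[>] t, z < b ∧ z ≤ t + 1 :=
        nhdsWithin_le_nhds ((gt_mem_nhds ht.2).and (ge_mem_nhds (by linarith)))
      obtain ⟨ρ, hρ, hκρ⟩ := Metric.continuousAt_iff.1 (hκ.continuousAt (x := t)) (ε' / 2) (by linarith)
      have hUc := h.continuousOn (lapS (evolS t ψ)) hab hI t htI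
      obtain ⟨ρ', hρ', hUρ⟩ := Metric.continuousWithinAt_iff.1 hUc (r / 2) (by linarith)
      have hz2 : ∀ᶠ z in 𝓝[>] t, z < t + ρ ∧ z < t + ρ' :=
        nhdsWithin_le_nhds ((gt_mem_nhds (by linarith)).and (gt_mem_nhds (by linarith)))
      have hz3 : ∀ᶠ z in 𝓝[>] t, (C₀ * C₁ + C₀ * C₂) * (z - t) < r / 2 := by
        have : Continuous fun z : ℝ => (C₀ * C₁ + C₀ * C₂) * (z - t) := by fun_prop
        refine nhdsWithin_le_nhds (this.continuousAt.eventually (gt_mem_nhds ?_))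
        simp only [sub_self, mul_zero]; linarith
      filter_upwards [hz1, hz2, hz3, self_mem_nhdsWithin] with z ⟨hzb, hz1⟩ ⟨hzρ, hzρ'⟩ hzr htz
      have htz : t < z := htz
      have hη : 0 < z - t := by linarith
      have hηa : |z - t| ≤ 1 := by rw [abs_of_pos hη]; linarith
      have hzI : z ∈ Icc a b := ⟨ht.1.trans htz.le, hzb.le⟩
      have hsubI : Icc t z ⊆ Icc a b := Icc_subset_Icc ht.1 hzb.le
      obtain ⟨i1, i2, i3⟩ := h.fourier (evolS z ψ) (hI htI) (hI hzI)
      have hdist : ∀ s ∈ Icc t z, dist s t < ρ ∧ dist s t < ρ' := fun s hs => by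
        rw [Real.dist_eq, abs_of_nonneg (by linarith [hs.1])]
        constructor <;> linarith [hs.2]
      have hAterm : ‖(∫ s in t..z, 𝓕 (U s) (lapS (evolS z ψ))) -
          ((z - t : ℝ) : ℂ) * 𝓕 (U t) (lapS (evolS t ψ))‖ ≤
          (C₀ * (C₂ * (z - t)) + r / 2) * (z - t) := by
        have e : ((z - t : ℝ) : ℂ) * 𝓕 (U t) (lapS (evolS t ψ)) =
            ∫ s in t..z, 𝓕 (U t) (lapS (evolS t ψ)) := by
          rw [intervalIntegral.integral_const]; simp
        rw [e, ← intervalIntegral.integral_sub i1 (intervalIntegrable_const)]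
        refine (intervalIntegral.norm_integral_le_of_norm_le_const (C := C₀ * (C₂ * (z - t)) + r / 2)
          fun s hs => ?_).trans_eq (by rw [abs_of_pos hη])
        rw [uIoc_of_le htz.le] at hs
        have hs' : s ∈ Icc t z := ⟨hs.1.le, hs.2⟩
        have e1 : 𝓕 (U s) (lapS (evolS z ψ)) - 𝓕 (U t) (lapS (evolS t ψ)) =
            𝓕 (U s) (evolS (z - t) (lapS (evolS t ψ)) - lapS (evolS t ψ)) +
            (𝓕 (U s) (lapS (evolS t ψ)) - 𝓕 (U t) (lapS (evolS t ψ))) := by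
          rw [map_sub, hshift t z, lapS_evolS]; ring
        rw [e1]
        refine (norm_add_le _ _).trans (add_le_add ?_ ?_)
        · have := hC₂ (z - t) hηa
          rw [abs_of_pos hη] at this
          exact hmul (hsubI hs') this
        · rw [← dist_eq_norm]
          exact (hUρ (hsubI hs') (hdist s hs').2).le
      -- The test function is frozen at the endpoint `z` while the bound is wanted at the running
      -- time `s`; the margin `ε'` covers the difference of `κ z` and `κ s`.
      have hFterm : ‖∫ s in t..z, 𝓕 (F s) (evolS z ψ)‖ ≤ ∫ s in t..z, N s * (κ s + ε') := by
        refine intervalIntegral.norm_integral_le_of_norm_le htz.le ?_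
          ((hNκ ε').mono_set (by rw [uIcc_of_le htz.le, uIcc_of_le hab]; exact hsubI))
        have hF' : ∀ᵐ s ∂volume.restrict (Icc t z), ∀ t, ‖𝓕 (F s) (evolS t ψ)‖ ≤ N s * κ t :=
          ae_restrict_of_ae_restrict_of_subset hsubI hF
        filter_upwards [(ae_restrict_iff' measurableSet_Icc).1 hF'] with s hs hsz
        have hs' : s ∈ Icc t z := ⟨hsz.1.le, hsz.2⟩
        refine (hs hs' z).trans (mul_le_mul_of_nonneg_left ?_ (hN0 s))
        have d1 := hκρ (hdist s hs').1
        have d2 := hκρ (hdist z (right_mem_Icc.2 htz.le)).1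
        rw [Real.dist_eq, abs_lt] at d1 d2
        linarith [d1.1, d2.2]
      have hRterm : ‖𝓕 (U t) (evolS z ψ - evolS t ψ - (Complex.I * (z - t : ℝ)) • lapS (evolS t ψ))‖ ≤
          C₀ * (C₁ * (z - t) ^ 2) := by
        rw [hshift t z]
        exact hmul htI (hC₁ _ hηa)
      -- The interaction picture at work: the first-order change of the test function cancels the
      -- Laplacian term of the equation, and what remains is a continuity error, the forcing and a
      -- quadratic Taylor remainder.
      have hgz : g z - g t = -Complex.I * ((∫ s in t..z, 𝓕 (U s) (lapS (evolS z ψ))) -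
          ((z - t : ℝ) : ℂ) * 𝓕 (U t) (lapS (evolS t ψ))) -
          Complex.I * (∫ s in t..z, 𝓕 (F s) (evolS z ψ)) +
          𝓕 (U t) (evolS z ψ - evolS t ψ - (Complex.I * (z - t : ℝ)) • lapS (evolS t ψ)) := by
        rw [map_sub, map_sub, map_smul, smul_eq_mul]
        simp only [hg]
        linear_combination i3
      have hgz' : ‖g z - g t‖ ≤ (C₀ * (C₂ * (z - t)) + r / 2) * (z - t) +
          (∫ s in t..z, N s * (κ s + ε')) + C₀ * (C₁ * (z - t) ^ 2) := by
        rw [hgz]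
        refine (norm_add_le _ _).trans (add_le_add ((norm_sub_le _ _).trans (add_le_add ?_ ?_)) hRterm)
        · rw [norm_mul, norm_neg, Complex.norm_I, one_mul]; exact hAterm
        · rw [norm_mul, Complex.norm_I, one_mul]; exact hFterm
      have hfz : f z - f t ≤ ((C₀ * C₁ + C₀ * C₂) * (z - t) + r / 2) * (z - t) := by
        have hadd : ∫ s in a..z, N s * (κ s + ε') =
            (∫ s in a..t, N s * (κ s + ε')) + ∫ s in t..z, N s * (κ s + ε') := by
          refine (intervalIntegral.integral_add_adjacent_intervals ?_ ?_).symm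
          · exact (hNκ ε').mono_set (by
              rw [uIcc_of_le ht.1, uIcc_of_le hab]; exact Icc_subset_Icc le_rfl ht.2.le)
          · exact (hNκ ε').mono_set (by rw [uIcc_of_le htz.le, uIcc_of_le hab]; exact hsubI)
        have htri : ‖g z - g a‖ ≤ ‖g z - g t‖ + ‖g t - g a‖ := norm_sub_le_norm_sub_add_norm_sub _ _ _
        simp only [hf, hadd]
        nlinarith
      rw [slope_def_field, div_lt_iff₀ hη]
      refine hfz.trans_lt (mul_lt_mul_of_pos_right ?_ hη)
      linarith
    have := image_le_of_liminf_slope_right_lt_deriv_boundary' (f' := fun _ => 0) hfc hslope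
      (B := fun t => ε * (t - a)) (B' := fun _ => ε) (by simp [hf]) (by fun_prop)
      (fun x _ => by
        simpa using (((hasDerivAt_id x).sub_const a).const_mul ε).hasDerivWithinAt)
      (fun x _ _ => hε) (right_mem_Icc.2 hab)
    simp only [hf] at this
    linarith
  have hlim : Tendsto (fun ε : ℝ => (∫ s in a..b, N s * κ s) + ε * (∫ s in a..b, N s) + ε * (b - a))
      (𝓝[>] 0) (𝓝 ((∫ s in a..b, N s * κ s) + 0 * (∫ s in a..b, N s) + 0 * (b - a))) := by
    refine Tendsto.mono_left (Continuous.tendsto ?_ 0) nhdsWithin_le_nhds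
    fun_prop
  simp only [zero_mul, add_zero] at hlim
  refine ge_of_tendsto hlim ?_
  filter_upwards [self_mem_nhdsWithin] with ε hε
  refine (hmain ε hε ε hε).trans_eq ?_
  congr 1
  rw [← intervalIntegral.integral_const_mul, ← intervalIntegral.integral_add
    (hN.mul_continuousOn hκ.continuousOn) (hN.const_mul ε)]
  refine intervalIntegral.integral_congr fun s _ => ?_
  ring

end Duhamel

/-! ### Fractional derivatives tested on the Fourier side -/

section Weighted

open Filter Topology

variable {n : ℕ}

/-- The function `|ξ|^{-s} φ(ξ)`. -/
def unweight (s : ℝ) (φ : Space n → ℂ) (ξ : Space n) : ℂ := ((‖ξ‖ ^ (-s) : ℝ) : ℂ) * φ ξ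

theorem norm_unweight_le (s : ℝ) {φ ψ : Space n → ℂ} {ξ : Space n} (h : ‖φ ξ‖ ≤ ‖ψ ξ‖) :
    ‖unweight s φ ξ‖ ≤ ‖unweight s ψ ξ‖ := by
  simp only [unweight, norm_mul]; gcongr

theorem measurable_unweight (s : ℝ) {φ : Space n → ℂ} (hφ : Measurable φ) :
    Measurable (unweight s φ) := by
  unfold unweight; fun_prop

theorem integrable_rpow_mul_schwartz (hn : 1 ≤ n) {τ : ℝ} (hτ : τ < n) (φ : 𝓢(Space n, ℂ)) :
    Integrable (fun ξ : Space n => ‖ξ‖ ^ (-τ) * ‖φ ξ‖) := by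
  have hm : Measurable (fun ξ : Space n => ‖ξ‖ ^ (-τ) * ‖φ ξ‖) := by
    have := φ.continuous.measurable
    fun_prop
  obtain ⟨C, -, hC⟩ := φ.decay 0 0
  have hC : ∀ ξ, ‖φ ξ‖ ≤ C := fun ξ => by simpa using hC ξ
  rw [← integrableOn_univ, ← union_compl_self (Metric.ball (0 : Space n) 1)]
  refine IntegrableOn.union ?_ ?_
  · refine integrableOn_ball_of_norm_le_rpow (C := C) (α := τ) (by simpa using hn)
      (by simpa using hτ) (Eventually.of_forall fun ξ => ?_) hm.aestronglyMeasurable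
    rw [norm_mul, norm_norm, Real.norm_of_nonneg (by positivity), mul_comm]
    exact mul_le_mul_of_nonneg_right (hC ξ) (by positivity)
  · refine Integrable.mono' (φ.integrable_pow_mul volume ⌈-τ⌉₊).integrableOn
      hm.aestronglyMeasurable ?_
    filter_upwards [ae_restrict_mem Metric.isOpen_ball.measurableSet.compl] with ξ hξ
    have hξ1 : 1 ≤ ‖ξ‖ := by simpa using hξ
    rw [Real.norm_of_nonneg (by positivity)]
    refine mul_le_mul_of_nonneg_right ?_ (norm_nonneg _)
    rw [← Real.rpow_natCast]
    exact Real.rpow_le_rpow_of_exponent_le hξ1 (Nat.le_ceil _)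

theorem norm_unweight (s : ℝ) (φ : Space n → ℂ) (ξ : Space n) :
    ‖unweight s φ ξ‖ = ‖ξ‖ ^ (-s) * ‖φ ξ‖ := by
  rw [unweight, norm_mul, Complex.norm_real, Real.norm_of_nonneg (by positivity)]

theorem integrable_unweight (hn : 1 ≤ n) {s : ℝ} (hs : 2 * s < n) (φ : 𝓢(Space n, ℂ)) :
    Integrable (unweight s φ) := by
  have hn' : (1 : ℝ) ≤ n := by exact_mod_cast hn
  rw [← integrable_norm_iff (measurable_unweight s φ.continuous.measurable).aestronglyMeasurable]
  simp only [norm_unweight]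
  exact integrable_rpow_mul_schwartz hn (by linarith) φ

/-- The condition `2s < n` makes `|ξ|^(-2s)` integrable at the origin; elsewhere the Schwartz decay
suffices. -/
theorem memLp_unweight (hn : 1 ≤ n) {s : ℝ} (hs : 2 * s < n) (φ : 𝓢(Space n, ℂ)) :
    MemLp (unweight s φ) 2 := by
  have hm := (measurable_unweight s φ.continuous.measurable)
  rw [memLp_two_iff_integrable_sq_norm hm.aestronglyMeasurable]
  obtain ⟨C, -, hC⟩ := φ.decay 0 0
  have hC : ∀ ξ, ‖φ ξ‖ ≤ C := fun ξ => by simpa using hC ξ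
  refine ((integrable_rpow_mul_schwartz hn hs φ).const_mul C).mono'
    (hm.norm.pow_const 2).aestronglyMeasurable (Eventually.of_forall fun ξ => ?_)
  rw [Real.norm_of_nonneg (by positivity), norm_unweight, mul_pow, ← Real.rpow_natCast,
    ← Real.rpow_mul (norm_nonneg _)]
  have : -s * ((2 : ℕ) : ℝ) = -(2 * s) := by push_cast; ring
  rw [this]
  have h0 : 0 ≤ ‖ξ‖ ^ (-(2 * s)) := by positivity
  have h1 := hC ξ
  have h2 := norm_nonneg (φ ξ)
  nlinarith [mul_le_mul_of_nonneg_right h1 h2]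

/-- Smooth compactly supported cutoffs that vanish near the origin exhaust the complement of the
origin. -/
theorem exists_cutoff (n : ℕ) : ∃ χ : ℕ → Space n → ℝ, (∀ k, ContDiff ℝ ((⊤ : ℕ∞) : WithTop ℕ∞) (χ k)) ∧
    (∀ k, HasCompactSupport (χ k)) ∧ (∀ k, χ k =ᶠ[𝓝 0] 0) ∧ (∀ k ξ, |χ k ξ| ≤ 1) ∧
    ∀ ξ ≠ 0, ∀ᶠ k in atTop, χ k ξ = 1 := by
  let f : ℕ → ContDiffBump (0 : Space n) := fun k =>
    ⟨k + 1, k + 2, by positivity, by linarith⟩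
  let g : ℕ → ContDiffBump (0 : Space n) := fun k =>
    ⟨1 / (2 * (k + 1)), 1 / (k + 1), by positivity, by
      apply one_div_lt_one_div_of_lt <;> linarith [(Nat.cast_nonneg k : (0 : ℝ) ≤ k)]⟩
  refine ⟨fun k ξ => f k ξ * (1 - g k ξ), fun k => ?_, fun k => ?_, fun k => ?_, fun k ξ => ?_,
    fun ξ hξ => ?_⟩
  · exact (f k).contDiff.mul (contDiff_const.sub (g k).contDiff)
  · exact (f k).hasCompactSupport.mul_right
  · filter_upwards [(g k).eventuallyEq_one] with ξ hξ
    simp [hξ]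
  · have h1 := (f k).nonneg (x := ξ)
    have h2 := (f k).le_one (x := ξ)
    have h3 := (g k).nonneg (x := ξ)
    have h4 := (g k).le_one (x := ξ)
    rw [abs_le]; constructor <;> nlinarith
  · have hpos : 0 < ‖ξ‖ := norm_pos_iff.2 hξ
    obtain ⟨N, hN⟩ := exists_nat_gt ‖ξ‖
    obtain ⟨M, hM⟩ := exists_nat_gt (1 / ‖ξ‖)
    filter_upwards [eventually_ge_atTop N, eventually_ge_atTop M] with k hkN hkM
    have hkN' : (N : ℝ) ≤ k := by exact_mod_cast hkN
    have hkM' : (M : ℝ) ≤ k := by exact_mod_cast hkM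
    have e1 : f k ξ = 1 := (f k).one_of_mem_closedBall (by
      rw [mem_closedBall_zero_iff]; change ‖ξ‖ ≤ (k : ℝ) + 1; linarith)
    have e2 : g k ξ = 0 := (g k).zero_of_le_dist (by
      rw [dist_zero_right]; change 1 / ((k : ℝ) + 1) ≤ ‖ξ‖
      rw [div_le_iff₀ (by positivity)]
      rw [div_lt_iff₀ hpos] at hM
      nlinarith)
    rw [e1, e2]; norm_num

/-- Products with bump functions are integrable, hence measurable, and `g` is the pointwise limit of
such products. -/
theorem RepresentedBy.aestronglyMeasurable {T : 𝓢'(Space n, ℂ)} {g : Space n → ℂ}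
    (h : RepresentedBy T g) : AEStronglyMeasurable g volume := by
  let f : ℕ → ContDiffBump (0 : Space n) := fun k =>
    ⟨k + 1, k + 2, by positivity, by linarith⟩
  have hf : ∀ k, AEStronglyMeasurable (fun x => (f k x : ℂ) * g x) volume := fun k => by
    have h₁ : HasCompactSupport (Complex.ofRealCLM ∘ f k) := (f k).hasCompactSupport.comp_left rfl
    have h₂ : ContDiff ℝ ((⊤ : ℕ∞) : WithTop ℕ∞) (Complex.ofRealCLM ∘ f k) := Complex.ofRealCLM.contDiff.comp (f k).contDiff
    exact (h (h₁.toSchwartzMap h₂)).1.1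
  refine aestronglyMeasurable_of_tendsto_ae atTop hf (Eventually.of_forall fun x => ?_)
  refine tendsto_const_nhds.congr' ?_
  obtain ⟨N, hN⟩ := exists_nat_gt ‖x‖
  filter_upwards [eventually_ge_atTop N] with k hkN
  have hkN' : (N : ℝ) ≤ k := by exact_mod_cast hkN
  have e1 : f k x = 1 := (f k).one_of_mem_closedBall (by
    rw [mem_closedBall_zero_iff]; change ‖x‖ ≤ (k : ℝ) + 1; linarith)
  simp [e1]

theorem RepresentedBy.locallyIntegrable {T : 𝓢'(Space n, ℂ)} {g : Space n → ℂ}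
    (h : RepresentedBy T g) : LocallyIntegrable g volume := by
  rw [locallyIntegrable_iff]
  intro K hK
  obtain ⟨R, hR0, hR⟩ := hK.isBounded.exists_pos_norm_lt
  let f : ContDiffBump (0 : Space n) := ⟨R, R + 1, hR0, by linarith⟩
  have h₁ : HasCompactSupport (Complex.ofRealCLM ∘ f) := f.hasCompactSupport.comp_left rfl
  have h₂ : ContDiff ℝ ((⊤ : ℕ∞) : WithTop ℕ∞) (Complex.ofRealCLM ∘ f) := Complex.ofRealCLM.contDiff.comp f.contDiff
  have := (h (h₁.toSchwartzMap h₂)).1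
  refine this.integrableOn.congr_fun (fun x hx => ?_) hK.measurableSet
  have e1 : f x = 1 := f.one_of_mem_closedBall (by
    rw [mem_closedBall_zero_iff]; exact (hR x hx).le)
  change ((f x : ℝ) : ℂ) * g x = g x
  simp [e1]

/-- With `X` the `L²` norm, `|f|^ρ ≤ (M + X)^(ρ-2) * |f|²`. This crude bound needs no conjugate
exponent and serves for finiteness and for passing to limits. -/
theorem eLpNorm_le_add {α : Type*} [MeasurableSpace α] {μ : Measure α} {f : α → ℂ} {r : ℝ≥0∞}
    (hr : 2 ≤ r) (hr' : r ≠ ∞) {M : ℝ≥0∞} (hM : ∀ x, ‖f x‖ₑ ≤ M) :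
    eLpNorm f r μ ≤ M + eLpNorm f 2 μ := by
  obtain ⟨ρ, rfl⟩ : ∃ ρ : ℝ, r = ENNReal.ofReal ρ := ⟨r.toReal, (ENNReal.ofReal_toReal hr').symm⟩
  have hρ : 2 ≤ ρ := by
    rw [show (2 : ℝ≥0∞) = ENNReal.ofReal 2 by norm_num, ENNReal.ofReal_le_ofReal_iff'] at hr
    rcases hr with h | h <;> linarith
  rw [eLpNorm_real f (by linarith)]
  set X := eLpNorm f 2 μ
  by_cases hX : M + X = ∞
  · rw [hX]; exact le_top
  have hint : ∫⁻ x, ‖f x‖ₑ ^ ρ ∂μ ≤ (M + X) ^ ρ := by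
    calc ∫⁻ x, ‖f x‖ₑ ^ ρ ∂μ ≤ ∫⁻ x, (M + X) ^ (ρ - 2) * ‖f x‖ₑ ^ 2 ∂μ := by
          refine lintegral_mono fun x => ?_
          have e : ‖f x‖ₑ ^ ρ = ‖f x‖ₑ ^ (ρ - 2) * ‖f x‖ₑ ^ 2 := by
            rw [← ENNReal.rpow_natCast, ← ENNReal.rpow_add_of_nonneg _ _ (by linarith) (by norm_num)]
            congr 1; push_cast; ring
          rw [e]
          exact mul_le_mul' (ENNReal.rpow_le_rpow ((hM x).trans le_self_add) (by linarith)) le_rfl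
      _ = (M + X) ^ (ρ - 2) * ∫⁻ x, ‖f x‖ₑ ^ 2 ∂μ :=
          lintegral_const_mul' _ _ (ENNReal.rpow_ne_top_of_nonneg (by linarith) hX)
      _ ≤ (M + X) ^ (ρ - 2) * (M + X) ^ 2 := by
          rw [← eLpNorm_two_sq]; gcongr; exact le_add_self
      _ = (M + X) ^ ρ := by
          rw [← ENNReal.rpow_natCast, ← ENNReal.rpow_add_of_nonneg _ _ (by linarith) (by norm_num)]
          congr 1; push_cast; ring
  calc (∫⁻ x, ‖f x‖ₑ ^ ρ ∂μ) ^ (1 / ρ) ≤ ((M + X) ^ ρ) ^ (1 / ρ) := by gcongr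
    _ = M + X := by
      rw [← ENNReal.rpow_mul, mul_one_div_cancel (by linarith), ENNReal.rpow_one]

theorem eLpNorm_fourier_le {f : Space n → ℂ} (hf : Integrable f) {r : ℝ≥0∞} (hr : 2 ≤ r)
    (hr' : r ≠ ∞) : eLpNorm (𝓕 f) r ≤ eLpNorm f 1 + eLpNorm f 2 := by
  refine (eLpNorm_le_add hr hr' (M := eLpNorm f 1) fun x => ?_).trans ?_
  · rw [eLpNorm_one_eq_lintegral_enorm, ← ofReal_integral_norm_eq_lintegral_enorm hf, ← ofReal_norm]
    exact ENNReal.ofReal_le_ofReal (norm_fourier_le f x)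
  · gcongr
    rw [← ENNReal.pow_le_pow_left_iff two_ne_zero, eLpNorm_two_sq, eLpNorm_two_sq]
    exact lintegral_fourier_sq_le hf

/-- A test function that vanishes near the origin stays smooth and compactly supported after
division by `|ξ|^s`. The factors `|ξ|^s` and `|ξ|^(-s)` then cancel, and the pairing with `𝓕 T`
becomes a pairing with `g`. -/
theorem IsFracDeriv.fourier_apply_eq {s : ℝ} {T : 𝓢'(Space n, ℂ)} {g : Space n → ℂ}
    (h : IsFracDeriv s T g) {χ : Space n → ℝ}
    (hχc : HasCompactSupport χ) (hχ0 : χ =ᶠ[𝓝 0] 0) (φ ψ : 𝓢(Space n, ℂ))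
    (hψ : ∀ ξ, ψ ξ = χ ξ * φ ξ) : ∃ ρ : 𝓢(Space n, ℂ), (∀ ξ, ρ ξ = unweight s ψ ξ) ∧
      𝓕 T ψ = ∫ x, 𝓕 (ρ : Space n → ℂ) x * g x := by
  obtain ⟨a, S, ha, hS, hSa⟩ := h
  have hψ0 : (ψ : Space n → ℂ) =ᶠ[𝓝 0] 0 := by
    filter_upwards [hχ0] with ξ hξ; simp [hψ, hξ]
  have hsm : ContDiff ℝ ((⊤ : ℕ∞) : WithTop ℕ∞) (unweight s ψ) := by
    rw [contDiff_iff_contDiffAt]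
    intro ξ
    by_cases hξ : ξ = 0
    · subst hξ
      refine (contDiffAt_const (c := (0 : ℂ))).congr_of_eventuallyEq ?_
      filter_upwards [hψ0] with ξ hξ
      simp [unweight, hξ]
    · refine ContDiffAt.mul ?_ (ψ.smooth ⊤).contDiffAt
      refine Complex.ofRealCLM.contDiff.contDiffAt.comp ξ ?_
      exact (contDiffAt_norm ℝ hξ).rpow_const_of_ne (norm_ne_zero_iff.2 hξ)
  have hcs : HasCompactSupport (unweight s ψ) := by
    refine HasCompactSupport.mul_left ?_
    refine hχc.mono fun ξ hξ => ?_
    rw [Function.mem_support] at hξ ⊢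
    rintro h0
    exact hξ (by simp [hψ, h0])
  refine ⟨hcs.toSchwartzMap hsm, fun ξ => rfl, ?_⟩
  set ρ := hcs.toSchwartzMap hsm
  have hρ : ∀ ξ, ρ ξ = unweight s ψ ξ := fun ξ => rfl
  have e1 : 𝓕 T ψ = 𝓕 S ρ := by
    rw [(ha ψ).2, (hSa ρ).2]
    refine integral_congr_ae (Eventually.of_forall fun ξ => ?_)
    simp only [hρ, unweight]
    by_cases hξ : ξ = 0
    · subst hξ
      simp [hψ0.self_of_nhds]
    · have : ‖ξ‖ ^ (-s) * ‖ξ‖ ^ s = 1 := by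
        rw [← Real.rpow_add (norm_pos_iff.2 hξ)]; simp
      have : ((‖ξ‖ ^ (-s) : ℝ) : ℂ) * ((‖ξ‖ ^ s : ℝ) : ℂ) = 1 := by exact_mod_cast this
      linear_combination (-(ψ ξ * a ξ)) * this
  rw [e1, TemperedDistribution.fourier_apply, (hS _).2, SchwartzMap.fourier_coe]

theorem tendsto_eLpNorm_of_dominated {α ι : Type*} [MeasurableSpace α] {μ : Measure α} {l : Filter ι}
    [l.IsCountablyGenerated] {p : ℝ≥0∞} (hp : 1 ≤ p) (hpt : p ≠ ∞) {f : ι → α → ℂ} {G : α → ℂ}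
    (hG : MemLp G p μ) (hf : ∀ i, AEStronglyMeasurable (f i) μ)
    (hle : ∀ i, ∀ᵐ x ∂μ, ‖f i x‖ ≤ ‖G x‖) (hlim : ∀ᵐ x ∂μ, Tendsto (fun i => f i x) l (𝓝 0)) :
    Tendsto (fun i => eLpNorm (f i) p μ) l (𝓝 0) := by
  have hp0 : 0 < p.toReal := ENNReal.toReal_pos (by positivity) hpt
  have hui : Tendsto (fun i => ∫⁻ x, ‖f i x‖ₑ ^ p.toReal ∂μ) l (𝓝 (∫⁻ _, 0 ∂μ)) := by
    refine tendsto_lintegral_filter_of_dominated_convergence' (fun x => ‖G x‖ₑ ^ p.toReal)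
      (Eventually.of_forall fun i => (hf i).enorm.pow_const _)
      (Eventually.of_forall fun i => ?_) ?_ ?_
    · filter_upwards [hle i] with x hx
      exact ENNReal.rpow_le_rpow (enorm_le_iff_norm_le.2 hx) hp0.le
    · exact (lintegral_rpow_enorm_lt_top_of_eLpNorm_lt_top (by positivity) hpt hG.2).ne
    · filter_upwards [hlim] with x hx
      have := (hx.enorm).ennrpow_const p.toReal
      simpa [hp0] using this
  simp only [eLpNorm_eq_lintegral_rpow_enorm_toReal (show p ≠ 0 by positivity) hpt]
  have := hui.ennrpow_const (1 / p.toReal)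
  simpa [hp0] using this

theorem fourier_sub_of_integrable {f g : Space n → ℂ} (hf : Integrable f) (hg : Integrable g) :
    𝓕 (f - g) = 𝓕 f - 𝓕 g := by
  funext x
  simp only [Real.fourier_eq, Pi.sub_apply, smul_sub]
  exact integral_sub (Real.fourierIntegral_convergent_iff x |>.2 hf)
    (Real.fourierIntegral_convergent_iff x |>.2 hg)

theorem enorm_integral_mul_le {α 𝕜 : Type*} [RCLike 𝕜] [MeasurableSpace α] {μ : Measure α}
    {f g : α → 𝕜}
    (hf : AEStronglyMeasurable f μ) (hg : AEStronglyMeasurable g μ) (p r : ℝ≥0∞)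
    [ENNReal.HolderConjugate p r] :
    ‖∫ x, f x * g x ∂μ‖ₑ ≤ eLpNorm g p μ * eLpNorm f r μ := by
  refine (enorm_integral_le_lintegral_enorm _).trans ?_
  rw [← eLpNorm_one_eq_lintegral_enorm]
  have := eLpNorm_smul_le_mul_eLpNorm (p := p) (q := r) (r := 1) hf hg
  simp only [mul_comm (f _)]
  exact this

/-- For test functions cut off near the origin this is Hölder's inequality after `fourier_apply_eq`.
The cutoff is removed on the left by dominated convergence, as `𝓕 T` is a function. On the right the
weighted test functions converge in `L¹` and in `L²`, hence their transforms converge in `L^r`. -/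
theorem IsFracDeriv.enorm_fourier_le (hn : 1 ≤ n) {s : ℝ} (hs : 2 * s < n) {T : 𝓢'(Space n, ℂ)}
    {g : Space n → ℂ} (h : IsFracDeriv s T g) {p r : ℝ≥0∞} [ENNReal.HolderConjugate p r]
    (hr : 2 ≤ r) (hr' : r ≠ ∞) (hg : eLpNorm g p ≠ ∞) (φ : 𝓢(Space n, ℂ)) :
    ‖𝓕 T φ‖ₑ ≤ eLpNorm g p * eLpNorm (𝓕 (unweight s φ)) r := by
  have : Nonempty (Fin n) := ⟨⟨0, hn⟩⟩
  obtain ⟨χ, hχ, hχc, hχ0, hχ1, hχl⟩ := exists_cutoff n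
  have hgm : AEStronglyMeasurable g volume := by
    obtain ⟨a, S, -, hS, -⟩ := h
    exact hS.aestronglyMeasurable
  have hcut : ∀ k, ∃ ψ : 𝓢(Space n, ℂ), ∀ ξ, ψ ξ = χ k ξ * φ ξ := fun k => by
    have h₁ : HasCompactSupport (fun ξ => (χ k ξ : ℂ) * φ ξ) :=
      ((hχc k).comp_left (g := Complex.ofReal) (by simp)).mul_right
    have h₂ : ContDiff ℝ ((⊤ : ℕ∞) : WithTop ℕ∞) (fun ξ => (χ k ξ : ℂ) * φ ξ) :=
      (Complex.ofRealCLM.contDiff.comp (hχ k)).mul (φ.smooth ⊤)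
    exact ⟨h₁.toSchwartzMap h₂, fun ξ => rfl⟩
  choose ψ hψ using hcut
  have hne : ∀ᵐ ξ : Space n, ξ ≠ 0 := by simp [ae_iff, measure_singleton]
  have hψle : ∀ k ξ, ‖ψ k ξ‖ ≤ ‖φ ξ‖ := fun k ξ => by
    rw [hψ, norm_mul, Complex.norm_real]
    exact mul_le_of_le_one_left (norm_nonneg _) (hχ1 k ξ)
  have hψlim : ∀ ξ ≠ 0, ∀ᶠ k in atTop, ψ k ξ = φ ξ := fun ξ hξ => by
    filter_upwards [hχl ξ hξ] with k hk
    simp [hψ, hk]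
  have hlhs : Tendsto (fun k => 𝓕 T (ψ k)) atTop (𝓝 (𝓕 T φ)) := by
    obtain ⟨a, S, ha, -, -⟩ := h
    simp only [fun ψ => (ha ψ).2]
    refine tendsto_integral_of_dominated_convergence (fun ξ => ‖φ ξ * a ξ‖) (fun k => (ha _).1.1)
      (ha φ).1.norm (fun k => Eventually.of_forall fun ξ => ?_) ?_
    · rw [norm_mul, norm_mul]
      exact mul_le_mul_of_nonneg_right (hψle k ξ) (norm_nonneg _)
    · filter_upwards [hne] with ξ hξ
      refine tendsto_const_nhds.congr' ?_
      filter_upwards [hψlim ξ hξ] with k hk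
      rw [hk]
  set W := unweight s φ
  have hW1 : Integrable W := integrable_unweight hn hs φ
  have hW2 : MemLp W 2 := memLp_unweight hn hs φ
  have hWk : ∀ k, Integrable (unweight s (ψ k)) := fun k => integrable_unweight hn hs _
  have hdiff : ∀ (p : ℝ≥0∞), 1 ≤ p → p ≠ ∞ → MemLp W p →
      Tendsto (fun k => eLpNorm (unweight s (ψ k) - W) p volume) atTop (𝓝 0) := by
    intro p hp hpt hWp
    refine tendsto_eLpNorm_of_dominated hp hpt (hWp.const_mul 2) (fun k => (hWk k).1.sub hW1.1)
      (fun k => Eventually.of_forall fun ξ => ?_) ?_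
    · rw [norm_mul, Complex.norm_ofNat, two_mul]
      exact (norm_sub_le _ _).trans (by
        gcongr
        exact norm_unweight_le s (hψle k ξ))
    · filter_upwards [hne] with ξ hξ
      refine tendsto_const_nhds.congr' ?_
      filter_upwards [hψlim ξ hξ] with k hk
      simp [W, unweight, hk]
  have hbound : ∀ k, ‖𝓕 T (ψ k)‖ₑ ≤ eLpNorm g p * (eLpNorm (𝓕 W) r +
      (eLpNorm (unweight s (ψ k) - W) 1 + eLpNorm (unweight s (ψ k) - W) 2)) := fun k => by
    obtain ⟨ρ, hρ, hρT⟩ := h.fourier_apply_eq (hχc k) (hχ0 k) φ (ψ k) (hψ k)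
    have hρ' : (ρ : Space n → ℂ) = unweight s (ψ k) := funext hρ
    rw [hρT, hρ']
    refine (enorm_integral_mul_le (continuous_fourier (hWk k)).aestronglyMeasurable hgm p r).trans ?_
    gcongr
    have e : 𝓕 (unweight s (ψ k)) = 𝓕 W + 𝓕 (unweight s (ψ k) - W) := by
      rw [fourier_sub_of_integrable (hWk k) hW1, add_sub_cancel]
    rw [e]
    refine (eLpNorm_add_le (continuous_fourier hW1).aestronglyMeasurable
      (continuous_fourier ((hWk k).sub hW1)).aestronglyMeasurable (le_trans (by norm_num) hr)).trans ?_
    gcongr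
    exact eLpNorm_fourier_le ((hWk k).sub hW1) hr hr'
  have hrhs : Tendsto (fun k => eLpNorm g p * (eLpNorm (𝓕 W) r +
      (eLpNorm (unweight s (ψ k) - W) 1 + eLpNorm (unweight s (ψ k) - W) 2))) atTop
      (𝓝 (eLpNorm g p * (eLpNorm (𝓕 W) r + (0 + 0)))) :=
    ENNReal.Tendsto.const_mul (tendsto_const_nhds.add
      ((hdiff 1 le_rfl (by norm_num) (memLp_one_iff_integrable.2 hW1)).add
        (hdiff 2 (by norm_num) (by norm_num) hW2))) (Or.inr hg)
  simp only [add_zero] at hrhs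
  exact le_of_tendsto_of_tendsto' hlhs.enorm hrhs hbound

end Weighted

/-! ### Atoms for curves of functionals -/

section Functionals

open Filter Topology

variable {X L : Type*} [AddCommGroup X] [Module ℂ X] [NormedAddCommGroup L] [NormedSpace ℂ L]

/-- A curve of functionals of small variation is dominated by countably many functionals. -/
theorem exists_functional_atoms {κ : ℝ} (hκ : 1 / 2 < κ) (hκ1 : κ ≤ 1) {e : X →ₗ[ℂ] L}
    (he : Function.Injective e) :
    ∃ C : ℝ≥0, ∀ (S : Set ℝ) (t₀ : ℝ)
      (Φ : ℝ → X →ₗ[ℂ] ℂ) (ω : ℝ → ℝ) (a A : ℝ), t₀ ∈ S → 0 ≤ a → 0 ≤ A →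
      (∀ t ∈ S, 0 ≤ ω t ∧ ω t ≤ 1) → (∀ x, ‖Φ t₀ x‖ ≤ a * ‖e x‖) →
      (∀ t ∈ S, ∀ t' ∈ S, ∀ x, ‖Φ t x - Φ t' x‖ ≤ A * |ω t - ω t'| ^ κ * ‖e x‖) →
      ∃ p : ℕ × ℕ → StrongDual ℂ L, ∑' i, ‖p i‖ₑ ^ 2 ≤ C * (ENNReal.ofReal a + ENNReal.ofReal A) ^ 2 ∧
        ∀ t ∈ S, ∀ x, ‖Φ t x‖ₑ ^ 2 ≤ ∑' i, ‖p i (e x)‖ₑ ^ 2 := by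
  obtain ⟨C, hC⟩ := exists_atoms (V := StrongDual ℂ (LinearMap.range e)) hκ hκ1
  refine ⟨C, fun S t₀ Φ ω a A ht₀ ha hA hω h0 hΦ => ?_⟩
  have hΦbd : ∀ t ∈ S, ∀ x, ‖Φ t x‖ ≤ (a + A * |ω t - ω t₀| ^ κ) * ‖e x‖ := fun t ht x => by
    have h1 := hΦ t ht t₀ ht₀ x
    have h2 := h0 x
    have h3 : ‖Φ t x‖ ≤ ‖Φ t x - Φ t₀ x‖ + ‖Φ t₀ x‖ := by
      simpa using norm_add_le (Φ t x - Φ t₀ x) (Φ t₀ x)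
    linarith
  set σ := LinearEquiv.ofInjective e he
  have hσ : ∀ y : LinearMap.range e, e (σ.symm y) = y := fun y => by
    exact congrArg Subtype.val (σ.apply_symm_apply y)
  have hσ' : ∀ x, σ.symm ⟨e x, LinearMap.mem_range_self e x⟩ = x := fun x => he (hσ _)
  -- As `e` is injective, `Φ t` can be read as a functional on the range of `e`, and the hypotheses
  -- make it bounded there in the norm of `L`.
  have hex : ∀ t, ∃ P : StrongDual ℂ (LinearMap.range e), t ∈ S → ∀ y, P y = Φ t (σ.symm y) := by
    intro t
    by_cases ht : t ∈ S
    · refine ⟨(Φ t ∘ₗ σ.symm.toLinearMap).mkContinuous (a + A * |ω t - ω t₀| ^ κ) fun y => ?_,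
        fun _ y => rfl⟩
      have := hΦbd t ht (σ.symm y)
      rw [hσ] at this
      exact this
    · exact ⟨0, fun h => absurd h ht⟩
  choose P hP using hex
  obtain ⟨p, hp1, hp2⟩ := hC S t₀ P ω A ht₀ hA hω fun t ht t' ht' => by
    refine ContinuousLinearMap.opNorm_le_bound _ (by positivity) fun y => ?_
    rw [sub_apply, hP t ht, hP t' ht']
    have := hΦ t ht t' ht' (σ.symm y)
    rwa [hσ] at this
  have hP0 : ‖P t₀‖ₑ ≤ ENNReal.ofReal a := by
    rw [← ofReal_norm]
    refine ENNReal.ofReal_le_ofReal (ContinuousLinearMap.opNorm_le_bound _ ha fun y => ?_)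
    rw [hP t₀ ht₀]
    have := h0 (σ.symm y)
    rwa [hσ] at this
  -- The atoms live on the range of `e`; Hahn–Banach extends them to `L` without increasing their
  -- norms.
  choose q hq1 hq2 using fun i => exists_extension_norm_eq (LinearMap.range e) (p i)
  refine ⟨q, ?_, fun t ht x => ?_⟩
  · have : ∀ i, ‖q i‖ₑ = ‖p i‖ₑ := fun i => enorm_eq_iff_norm_eq.2 (hq2 i)
    simp only [this]
    refine hp1.trans ?_
    gcongr
  · have := hp2 (ContinuousLinearMap.apply ℂ ℂ ⟨e x, LinearMap.mem_range_self e x⟩) t ht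
    simp only [ContinuousLinearMap.apply_apply, hP t ht, hσ'] at this
    refine this.trans_eq (tsum_congr fun i => ?_)
    rw [← hq1]

/-- Riesz representation in the bilinear pairing of `L²`. -/
theorem exists_integral_representation {α : Type*} [MeasurableSpace α] {μ : Measure α}
    (p : StrongDual ℂ (Lp ℂ 2 μ)) : ∃ f : α → ℂ, MemLp f 2 μ ∧ eLpNorm f 2 μ = ‖p‖ₑ ∧
      ∀ (g : α → ℂ) (hg : MemLp g 2 μ), p (hg.toLp g) = ∫ x, f x * g x ∂μ := by
  set F := (InnerProductSpace.toDual ℂ (Lp ℂ 2 μ)).symm p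
  have hF : MemLp (F : α → ℂ) 2 μ := Lp.memLp F
  refine ⟨fun x => starRingEnd ℂ (F x), hF.star, ?_, fun g hg => ?_⟩
  · have e1 : eLpNorm (fun x => starRingEnd ℂ (F x)) 2 μ = eLpNorm F 2 μ :=
      eLpNorm_congr_norm_ae (Eventually.of_forall fun x => by simp)
    rw [e1, ← Lp.enorm_def, ← ofReal_norm, ← ofReal_norm, LinearIsometryEquiv.norm_map]
  · rw [← InnerProductSpace.toDual_symm_apply, L2.inner_def]
    refine integral_congr_ae ?_
    filter_upwards [hg.coeFn_toLp] with x hx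
    rw [hx, RCLike.inner_apply, mul_comm]

end Functionals

/-! ### The time modulus of the forcing -/

section Modulus

/-- `ω` is the normalised distribution function of `h^ρ` on `I`, so the norm over `[t, t']` is the
full norm times the increment of `ω` to the power `1/ρ`. Increments are at most one, so the exponent
may be lowered to `κ`, which can then be the same for all `ρ` in question. -/
theorem exists_modulus (h : ℝ → ℝ≥0∞) (I : Set ℝ) {ρ κ : ℝ} (hρ : 0 < ρ) (hκ0 : 0 ≤ κ)
    (hκ : κ ≤ 1 / ρ)
    (hfin : eLpNorm h (ENNReal.ofReal ρ) (volume.restrict I) ≠ ∞) :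
    ∃ ω : ℝ → ℝ, (∀ t, 0 ≤ ω t ∧ ω t ≤ 1) ∧ ∀ t t', t ≤ t' → Icc t t' ⊆ I →
      eLpNorm h (ENNReal.ofReal ρ) (volume.restrict (Icc t t')) ≤
        eLpNorm h (ENNReal.ofReal ρ) (volume.restrict I) * ENNReal.ofReal (|ω t' - ω t| ^ κ) := by
  simp only [eLpNorm_enn h hρ] at hfin ⊢
  set X := ∫⁻ t in I, h t ^ ρ with hX
  have hXt : X ≠ ∞ := fun h0 => hfin (by rw [h0, ENNReal.top_rpow_of_pos (by positivity)])
  by_cases hX0 : X = 0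
  · refine ⟨fun _ => 0, fun t => by simp, fun t t' _ hI => ?_⟩
    have : ∫⁻ s in Icc t t', h s ^ ρ = 0 := le_antisymm (hX0 ▸ lintegral_mono_set hI) zero_le
    rw [this, ENNReal.zero_rpow_of_pos (by positivity)]
    exact zero_le
  have hle : ∀ t, ∫⁻ s in I ∩ Iic t, h s ^ ρ ≤ X := fun t => lintegral_mono_set inter_subset_left
  refine ⟨fun t => ((∫⁻ s in I ∩ Iic t, h s ^ ρ) / X).toReal, fun t => ⟨by positivity, ?_⟩,
    fun t t' htt hI => ?_⟩
  · refine ENNReal.toReal_le_of_le_ofReal zero_le_one ?_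
    rw [ENNReal.ofReal_one]
    exact ENNReal.div_le_of_le_mul (by simpa using hle t)
  · set Y := ∫⁻ s in Icc t t', h s ^ ρ with hY
    have hYX : Y ≤ X := lintegral_mono_set hI
    have hadd : ∫⁻ s in I ∩ Iic t', h s ^ ρ = (∫⁻ s in I ∩ Iic t, h s ^ ρ) + Y := by
      rw [hY, setLIntegral_congr Ioc_ae_eq_Icc.symm, ← lintegral_union measurableSet_Ioc]
      · congr 2
        ext s
        simp only [mem_inter_iff, mem_Iic, mem_union, mem_Ioc]
        constructor
        · rintro ⟨h1, h2⟩
          rcases le_or_gt s t with h3 | h3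
          · exact Or.inl ⟨h1, h3⟩
          · exact Or.inr ⟨h3, h2⟩
        · rintro (⟨h1, h2⟩ | ⟨h1, h2⟩)
          · exact ⟨h1, h2.trans htt⟩
          · exact ⟨hI ⟨h1.le, h2⟩, h2⟩
      · rw [Set.disjoint_left]
        rintro s ⟨-, h1⟩ ⟨h2, -⟩
        exact absurd h1 (not_le.2 h2)
    have hω : ((∫⁻ s in I ∩ Iic t', h s ^ ρ) / X).toReal - ((∫⁻ s in I ∩ Iic t, h s ^ ρ) / X).toReal =
        (Y / X).toReal := by
      have h1 : (∫⁻ s in I ∩ Iic t, h s ^ ρ) / X ≠ ∞ :=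
        ENNReal.div_ne_top ((hle t).trans_lt (lt_top_iff_ne_top.2 hXt)).ne hX0
      have h2 : Y / X ≠ ∞ := ENNReal.div_ne_top (hYX.trans_lt (lt_top_iff_ne_top.2 hXt)).ne hX0
      rw [hadd, ENNReal.add_div, ENNReal.toReal_add h1 h2]; ring
    have hYX1 : Y / X ≤ 1 := ENNReal.div_le_of_le_mul (by simpa using hYX)
    rw [hω, abs_of_nonneg (by positivity), ← ENNReal.ofReal_rpow_of_nonneg (by positivity) hκ0,
      ENNReal.ofReal_toReal (ne_top_of_le_ne_top ENNReal.one_ne_top hYX1)]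
    calc Y ^ (1 / ρ) = (X * (Y / X)) ^ (1 / ρ) := by rw [ENNReal.mul_div_cancel hX0 hXt]
      _ = X ^ (1 / ρ) * (Y / X) ^ (1 / ρ) := ENNReal.mul_rpow_of_nonneg _ _ (by positivity)
      _ ≤ X ^ (1 / ρ) * (Y / X) ^ κ :=
        mul_le_mul' le_rfl (ENNReal.rpow_le_rpow_of_exponent_ge hYX1 hκ)

end Modulus

/-! ### Increments of the interaction picture -/

section Increments

open Filter Topology

variable {n : ℕ}

theorem aemeasurable_eLpNorm_slice {α β : Type*} [MeasurableSpace α] [MeasurableSpace β]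
    {μ : Measure α} {ν : Measure β} [SFinite ν] {H : α → β → ℂ}
    (hH : AEStronglyMeasurable (Function.uncurry H) (μ.prod ν)) {p : ℝ≥0∞} (hp : p ≠ 0)
    (hpt : p ≠ ∞) : AEMeasurable (fun t => eLpNorm (H t) p ν) μ := by
  have hmeas : Measurable fun t => eLpNorm (fun x => hH.mk _ (t, x)) p ν := by
    simp only [eLpNorm_eq_lintegral_rpow_enorm_toReal hp hpt]
    exact (hH.stronglyMeasurable_mk.measurable.enorm.pow_const
      p.toReal).lintegral_prod_right'.pow_const _
  refine ⟨_, hmeas, ?_⟩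
  filter_upwards [Measure.ae_ae_of_ae_prod hH.ae_eq_mk] with t ht
  exact eLpNorm_congr_ae ht

theorem eLpNorm_fourier_ne_top {f : Space n → ℂ} (hf : Integrable f) (hf2 : MemLp f 2)
    {r : ℝ≥0∞} (hr : 2 ≤ r) (hr' : r ≠ ∞) : eLpNorm (𝓕 f) r ≠ ∞ :=
  ((eLpNorm_fourier_le hf hr hr').trans_lt
    (ENNReal.add_lt_top.2 ⟨(memLp_one_iff_integrable.2 hf).2, hf2.2⟩)).ne

theorem eLpNorm_fourier_le_add {f g : Space n → ℂ} (hf : Integrable f) (hg : Integrable g)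
    {r : ℝ≥0∞} (hr : 2 ≤ r) (hr' : r ≠ ∞) : eLpNorm (𝓕 f) r ≤
      eLpNorm (𝓕 g) r + (eLpNorm (f - g) 1 + eLpNorm (f - g) 2) := by
  have h0 : 𝓕 f = 𝓕 g + 𝓕 (f - g) := by
    rw [fourier_sub_of_integrable hf hg, add_sub_cancel]
  have h1 : eLpNorm (𝓕 g + 𝓕 (f - g)) r ≤ eLpNorm (𝓕 g) r + eLpNorm (𝓕 (f - g)) r :=
    eLpNorm_add_le (continuous_fourier hg).aestronglyMeasurable
      (continuous_fourier (hf.sub hg)).aestronglyMeasurable (le_trans (by norm_num) hr)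
  have h2 := eLpNorm_fourier_le (hf.sub hg) hr hr'
  rw [h0]
  exact h1.trans (add_le_add_right h2 _)

/-- Differences of the norms are controlled by `L¹` and `L²` differences of the profiles, to which
dominated convergence applies. It supplies the continuous factor `κ` in the Duhamel bound. -/
theorem continuous_eLpNorm_fourier {m : ℝ → Space n → ℂ} {W : Space n → ℂ}
    (hm : ∀ t, AEStronglyMeasurable (m t) volume) (hle : ∀ t ξ, ‖m t ξ‖ ≤ ‖W ξ‖)
    (hc : ∀ ξ, Continuous fun t => m t ξ) (hW : Integrable W) (hW2 : MemLp W 2)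
    {r : ℝ≥0∞} (hr : 2 ≤ r) (hr' : r ≠ ∞) :
    Continuous fun t => (eLpNorm (𝓕 (m t)) r).toReal := by
  rw [continuous_iff_continuousAt]
  intro t₀
  have hint : ∀ t, Integrable (m t) := fun t => hW.mono (hm t) (Eventually.of_forall (hle t))
  have hint2 : ∀ t, MemLp (m t) 2 := fun t => hW2.mono (hm t) (Eventually.of_forall (hle t))
  have hfin := fun t => eLpNorm_fourier_ne_top (hint t) (hint2 t) hr hr'
  have hdom : ∀ p : ℝ≥0∞, 1 ≤ p → p ≠ ∞ → MemLp W p → Tendsto (fun t =>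
      eLpNorm (m t - m t₀) p) (𝓝 t₀) (𝓝 0) := by
    intro p hp hpt hWp
    refine tendsto_eLpNorm_of_dominated hp hpt (hWp.const_mul 2) (fun t => (hm t).sub (hm t₀))
      (fun t => Eventually.of_forall fun ξ => ?_) (Eventually.of_forall fun ξ => ?_)
    · rw [norm_mul, Complex.norm_ofNat, two_mul]
      exact (norm_sub_le _ _).trans (add_le_add (hle t ξ) (hle t₀ ξ))
    · simpa using ((hc ξ).tendsto t₀).sub_const (m t₀ ξ)
  have hD := (hdom 1 le_rfl (by norm_num) (memLp_one_iff_integrable.2 hW)).add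
      (hdom 2 (by norm_num) (by norm_num) hW2)
  have hDfin : ∀ t, eLpNorm (m t - m t₀) 1 + eLpNorm (m t - m t₀) 2 ≠ ∞ := fun t =>
    (ENNReal.add_lt_top.2 ⟨(memLp_one_iff_integrable.2 ((hint t).sub (hint t₀))).2,
      ((hint2 t).sub (hint2 t₀)).2⟩).ne
  rw [add_zero] at hD
  have hDlim := (ENNReal.tendsto_toReal ENNReal.zero_ne_top).comp hD
  rw [ENNReal.toReal_zero] at hDlim
  refine tendsto_iff_dist_tendsto_zero.2 (squeeze_zero (fun _ => dist_nonneg) (fun t => ?_) hDlim)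
  have a1 := eLpNorm_fourier_le_add (hint t) (hint t₀) hr hr'
  have a2 := eLpNorm_fourier_le_add (hint t₀) (hint t) hr hr'
  rw [eLpNorm_sub_comm (m t₀), eLpNorm_sub_comm (m t₀)] at a2
  have b1 := ENNReal.toReal_mono (ENNReal.add_ne_top.2 ⟨hfin t₀, hDfin t⟩) a1
  have b2 := ENNReal.toReal_mono (ENNReal.add_ne_top.2 ⟨hfin t, hDfin t⟩) a2
  rw [ENNReal.toReal_add (hfin _) (hDfin _)] at b1 b2
  rw [Real.dist_eq, abs_le, Function.comp_apply]
  constructor <;> linarith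

theorem memLp_evol_mul {W : Space n → ℂ} {p : ℝ≥0∞} (hW : MemLp W p) (t : ℝ) :
    MemLp (fun ξ => evol t ξ * W ξ) p :=
  hW.congr_norm ((continuous_evol_right t).aestronglyMeasurable.mul hW.1)
    (Eventually.of_forall fun ξ => by rw [norm_mul, norm_evol, one_mul])

theorem eLpNorm_freeWave_ne_top {W : Space n → ℂ} (hW : Integrable W) (hW2 : MemLp W 2)
    {r : ℝ≥0∞} (hr : 2 ≤ r) (hr' : r ≠ ∞) (t : ℝ) : eLpNorm (freeWave W t) r ≠ ∞ :=
  eLpNorm_fourier_ne_top (integrable_evol_mul hW t) (memLp_evol_mul hW2 t) hr hr'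

theorem continuous_eLpNorm_freeWave {W : Space n → ℂ} (hW : Integrable W) (hW2 : MemLp W 2)
    {r : ℝ≥0∞} (hr : 2 ≤ r) (hr' : r ≠ ∞) :
    Continuous fun t => (eLpNorm (freeWave W t) r).toReal := by
  refine continuous_eLpNorm_fourier (m := fun t ξ => evol t ξ * W ξ)
    (fun t => (integrable_evol_mul hW t).1)
    (fun t ξ => by rw [norm_mul, norm_evol, one_mul]) (fun ξ => ?_) hW hW2 hr hr'
  exact (continuous_evol.comp (Continuous.prodMk_left ξ)).mul continuous_const

theorem unweight_evolS (s t : ℝ) (ψ : 𝓢(Space n, ℂ)) :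
    unweight s (evolS t ψ) = fun ξ => evol t ξ * unweight s ψ ξ := by
  funext ξ
  simp only [unweight, evolS_apply]; ring

theorem fourier_unweight_evolS (s t : ℝ) (ψ : 𝓢(Space n, ℂ)) :
    𝓕 (unweight s (evolS t ψ)) = freeWave (unweight s ψ) t := by
  rw [unweight_evolS]; rfl

theorem eLpNorm_toReal {α : Type*} [MeasurableSpace α] {μ : Measure α} {h : α → ℝ≥0∞}
    (hh : ∀ᵐ x ∂μ, h x ≠ ∞) (q : ℝ≥0∞) : eLpNorm (fun x => (h x).toReal) q μ = eLpNorm h q μ := by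
  refine eLpNorm_congr_enorm_ae ?_
  filter_upwards [hh] with x hx
  rw [Real.enorm_of_nonneg ENNReal.toReal_nonneg, ENNReal.ofReal_toReal hx, enorm_eq_self]

variable {I : Set ℝ} {U F : ℝ → 𝓢'(Space n, ℂ)}

/-- The interaction picture of the solution has bounded variation in the sense of the dual
Strichartz estimate. -/
theorem SolvesForced.enorm_evolS_sub_le (hn : 1 ≤ n) {s : ℝ} (hs : 2 * s < n)
    (h : SolvesForced I U F) {H : ℝ → Space n → ℂ}
    (hH : AEStronglyMeasurable (Function.uncurry H) ((volume.restrict I).prod volume))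
    (hFH : ∀ᵐ t ∂volume.restrict I, IsFracDeriv s (F t) (H t)) {p r p' q : ℝ≥0∞}
    [ENNReal.HolderConjugate p r] [ENNReal.HolderConjugate p' q] (hr : 2 ≤ r) (hr' : r ≠ ∞)
    (hp : p ≠ ∞) (hp' : p' ≠ ∞) (hfin : mixedNorm I p' p H ≠ ∞) {a b : ℝ} (hab : a ≤ b)
    (hI : Icc a b ⊆ I) (ψ : 𝓢(Space n, ℂ)) :
    ‖𝓕 (U b) (evolS b ψ) - 𝓕 (U a) (evolS a ψ)‖ₑ ≤
      eLpNorm (fun t => eLpNorm (H t) p volume) p' (volume.restrict (Icc a b)) *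
        eLpNorm (fun t => eLpNorm (freeWave (unweight s ψ) t) r volume) q volume := by
  have hp1 : 1 ≤ p := ENNReal.HolderConjugate.one_le p r
  have hp1' : 1 ≤ p' := ENNReal.HolderConjugate.one_le p' q
  have hW := integrable_unweight hn hs ψ
  have hW2 := memLp_unweight hn hs ψ
  set W := unweight s ψ
  set h₀ : ℝ → ℝ≥0∞ := fun t => eLpNorm (H t) p volume
  have hm : AEMeasurable h₀ (volume.restrict I) :=
    aemeasurable_eLpNorm_slice hH (by positivity) hp
  have hft : ∀ᵐ t ∂volume.restrict I, h₀ t ≠ ∞ := by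
    have h1 := lintegral_rpow_enorm_lt_top_of_eLpNorm_lt_top (by positivity) hp'
      (lt_top_iff_ne_top.2 hfin)
    filter_upwards [ae_lt_top' (hm.enorm.pow_const _) h1.ne] with t ht h0
    have : 0 < p'.toReal := ENNReal.toReal_pos (by positivity) hp'
    simp [h₀] at h0 ht
    simp [h0, this] at ht
  set N : ℝ → ℝ := fun t => (h₀ t).toReal
  set κ : ℝ → ℝ := fun t => (eLpNorm (freeWave W t) r).toReal
  have hκfin := eLpNorm_freeWave_ne_top hW hW2 hr hr'
  have hκ : Continuous κ := continuous_eLpNorm_freeWave hW hW2 hr hr'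
  have hsub : volume.restrict (Icc a b) ≤ volume.restrict I := Measure.restrict_mono hI le_rfl
  have hNm : AEStronglyMeasurable N (volume.restrict (Icc a b)) :=
    (hm.mono_measure hsub).ennreal_toReal.aestronglyMeasurable
  have hN : MemLp N p' (volume.restrict (Icc a b)) := by
    refine ⟨hNm, ?_⟩
    rw [eLpNorm_toReal (ae_mono hsub hft)]
    exact (eLpNorm_mono_measure _ hsub).trans_lt (lt_top_iff_ne_top.2 hfin)
  have hNi : IntervalIntegrable N volume a b := by
    rw [intervalIntegrable_iff_integrableOn_Icc_of_le hab]
    exact hN.integrable hp1'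
  -- Hölder in space at each time bounds the pairing with the forcing by `N` at the forcing time
  -- times `κ` at the evolution time. Duhamel evaluates both at the same time, and Hölder in time
  -- finishes.
  have key := h.norm_evolS_sub_le hab hI (ψ := ψ) hNi (fun _ => ENNReal.toReal_nonneg) hκ (by
    filter_upwards [ae_mono hsub hft, ae_mono hsub hFH] with t ht hd τ
    have := hd.enorm_fourier_le hn hs hr hr' ht (evolS τ ψ)
    rw [fourier_unweight_evolS] at this
    have := ENNReal.toReal_mono (ENNReal.mul_ne_top ht (hκfin τ)) this
    rwa [toReal_enorm, ENNReal.toReal_mul] at this)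
  rw [← ofReal_norm]
  refine (ENNReal.ofReal_le_ofReal key).trans ((Real.ofReal_le_enorm _).trans ?_)
  rw [intervalIntegral.integral_of_le hab, Measure.restrict_congr_set Ioc_ae_eq_Icc,
    ← eLpNorm_toReal (ae_mono hsub hft),
    ← eLpNorm_toReal (Eventually.of_forall hκfin)]
  simp only [mul_comm (N _)]
  refine (enorm_integral_mul_le hκ.aestronglyMeasurable hNm p' q).trans ?_
  exact mul_le_mul' le_rfl (eLpNorm_mono_measure _ Measure.restrict_le_self)

theorem IsFracDeriv.enorm_fourier_evolS_le (hn : 1 ≤ n) {s : ℝ} (hs : 2 * s < n) {T : 𝓢'(Space n, ℂ)}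
    {g : Space n → ℂ} (h : IsFracDeriv s T g) (hg : eLpNorm g 2 ≠ ∞) (t : ℝ) (ψ : 𝓢(Space n, ℂ)) :
    ‖𝓕 T (evolS t ψ)‖ₑ ≤ eLpNorm g 2 * eLpNorm (unweight s ψ) 2 := by
  refine (h.enorm_fourier_le hn hs (p := 2) le_rfl (by norm_num) hg (evolS t ψ)).trans ?_
  refine mul_le_mul' le_rfl ?_
  rw [eLpNorm_fourier_two (integrable_unweight hn hs _) (memLp_unweight hn hs _), unweight_evolS]
  exact (eLpNorm_congr_norm_ae (Eventually.of_forall fun ξ => by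
    rw [norm_mul, norm_evol, one_mul])).le

/-- The map `ψ ↦ |ξ|^{-s} ψ` from Schwartz functions to `L²`. -/
def unweightLp (hn : 1 ≤ n) {s : ℝ} (hs : 2 * s < n) :
    𝓢(Space n, ℂ) →ₗ[ℂ] Lp ℂ 2 (volume : Measure (Space n)) where
  toFun ψ := (memLp_unweight hn hs ψ).toLp
  map_add' ψ φ := by
    rw [← MemLp.toLp_add]
    congr 1
    funext ξ
    simp only [unweight, Pi.add_apply, add_apply]; ring
  map_smul' c ψ := by
    rw [RingHom.id_apply, ← MemLp.toLp_const_smul]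
    congr 1
    funext ξ
    simp only [unweight, Pi.smul_apply, smul_apply, smul_eq_mul]; ring

theorem unweightLp_injective (hn : 1 ≤ n) {s : ℝ} (hs : 2 * s < n) :
    Function.Injective (unweightLp hn hs) := by
  have : Nonempty (Fin n) := ⟨⟨0, hn⟩⟩
  intro ψ φ h
  have hae : unweight s ψ =ᵐ[volume] unweight s φ := (MemLp.toLp_eq_toLp_iff (memLp_unweight hn hs ψ) (memLp_unweight hn hs φ)).1 h
  have hne : ∀ᵐ ξ : Space n, ξ ≠ 0 := by simp [ae_iff, measure_singleton]
  have : (ψ : Space n → ℂ) =ᵐ[volume] φ := by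
    filter_upwards [hae, hne] with ξ h1 h2
    have h3 : ((‖ξ‖ ^ (-s) : ℝ) : ℂ) ≠ 0 := by
      have : 0 < ‖ξ‖ ^ (-s) := Real.rpow_pos_of_pos (norm_pos_iff.2 h2) _
      exact_mod_cast this.ne'
    exact mul_left_cancel₀ h3 h1
  exact DFunLike.coe_injective (Continuous.ae_eq_iff_eq volume ψ.continuous φ.continuous |>.1 this)

end Increments

/-! ### Domination of solutions by free waves -/

section Atoms

variable {n : ℕ}

/-- A time-dependent distribution with finite norms is dominated, at all times, by a fixed
square-summable family of free waves. -/
theorem exists_freeWave_atoms (hn : 2 ≤ n) {q₀ : ℝ≥0∞} (hq₀ : 2 < q₀) {s : ℝ} (hs : 2 * s < n) :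
    ∃ C : ℝ≥0, ∀ q r : ℝ≥0∞, Admissible n q r → q₀ ≤ q → ∀ I : Set ℝ, I.OrdConnected → ∀ t₀ ∈ I,
      ∀ (U : ℝ → 𝓢'(Space n, ℂ)) (M : ℝ≥0∞), sobolevNorm s (U t₀) +
        forcingNorm I s (ENNReal.conjExponent q) (ENNReal.conjExponent r) U < M →
      ∃ p : ℕ × ℕ → Space n → ℂ, (∀ i, MemLp (p i) 2) ∧ ∑' i, eLpNorm (p i) 2 ^ 2 ≤ C * M ^ 2 ∧
        ∀ t ∈ I, ∀ φ, ‖𝓕 (U t) φ‖ₑ ^ 2 ≤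
          ∑' i, ‖∫ ξ, p i ξ * unweight s (evolS (-t) φ) ξ‖ₑ ^ 2 := by
  have hn1 : 1 ≤ n := by omega
  obtain ⟨C₁, hC₁⟩ := strichartz hn hq₀
  -- The variation exponent of a pair is `1/q' = 1 - 1/q ≥ κ`, so one `κ` serves all `q ≥ q₀`; it
  -- exceeds `1/2` because `q₀ > 2`.
  set κ : ℝ := 1 - q₀⁻¹.toReal with hκdef
  have hq₀' : q₀⁻¹.toReal < 1 / 2 := by
    have : q₀⁻¹ < 2⁻¹ := ENNReal.inv_lt_inv.2 hq₀
    have := (ENNReal.toReal_lt_toReal (ne_top_of_lt this) (by norm_num)).2 this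
    simpa using this
  have hκ : 1 / 2 < κ := by linarith
  have hκ1 : κ ≤ 1 := by linarith [ENNReal.toReal_nonneg (a := q₀⁻¹)]
  obtain ⟨C₂, hC₂⟩ := exists_functional_atoms hκ hκ1 (unweightLp_injective hn1 hs)
  refine ⟨C₂ * (1 + C₁) ^ 2, fun q r hqr hq I hI t₀ ht₀ U M hM => ?_⟩
  have hq2 : 2 < q := hq₀.trans_le hq
  have hq1 : 1 ≤ q := le_trans (by norm_num) hqr.1
  have hr1 : 1 ≤ r := le_trans (by norm_num) hqr.2.1
  have hr' : r ≠ ∞ := by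
    rcases hqr.cases hn hq2 with ⟨-, h⟩ | ⟨x, y, -, h, -⟩ <;> simp [h]
  have : ENNReal.HolderConjugate (ENNReal.conjExponent q) q :=
    (ENNReal.HolderConjugate.conjExponent hq1).symm
  have : ENNReal.HolderConjugate (ENNReal.conjExponent r) r :=
    (ENNReal.HolderConjugate.conjExponent hr1).symm
  have hconj : ∀ {x : ℝ≥0∞}, 2 ≤ x → ENNReal.conjExponent x ≠ ∞ := fun {x} hx => by
    rw [ENNReal.conjExponent]
    refine ENNReal.add_ne_top.2 ⟨ENNReal.one_ne_top, ENNReal.inv_ne_top.2 ?_⟩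
    exact (tsub_pos_of_lt (lt_of_lt_of_le (by norm_num) hx)).ne'
  have hpt := hconj hqr.2.1
  have hpt' := hconj hqr.1
  have hinv := ENNReal.HolderConjugate.inv_add_inv_eq_one (ENNReal.conjExponent q) q
  set p' := ENNReal.conjExponent q
  set p := ENNReal.conjExponent r
  have hp1' : 1 ≤ p' := ENNReal.HolderConjugate.one_le p' q
  have hρ : 0 < p'.toReal := ENNReal.toReal_pos (by positivity) hpt'
  have hκρ : κ ≤ 1 / p'.toReal := by
    have h1 : p'⁻¹ ≠ ∞ := ENNReal.inv_ne_top.2 (by positivity)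
    have h2 : q⁻¹ ≠ ∞ := ENNReal.inv_ne_top.2 (by positivity)
    have h3 := congrArg ENNReal.toReal hinv
    rw [ENNReal.toReal_add h1 h2, ENNReal.toReal_one, ENNReal.toReal_inv p'] at h3
    have h4 : q⁻¹.toReal ≤ q₀⁻¹.toReal := ENNReal.toReal_mono
      (ENNReal.inv_ne_top.2 (by positivity)) (ENNReal.inv_le_inv.2 hq)
    rw [one_div]
    linarith
  -- Both norms are infima over representatives and need not be attained; half of the room below `M`
  -- is given to each.
  obtain ⟨ε, hε, hεM⟩ := ENNReal.lt_iff_exists_add_pos_lt.1 hM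
  have hfin := ne_top_of_lt hM
  rw [ENNReal.add_ne_top] at hfin
  have hε2 : ((ε / 2 : ℝ≥0) : ℝ≥0∞) ≠ 0 := by
    simpa using hε.ne'
  have hg0 := ENNReal.lt_add_right hfin.1 hε2
  have hH0 := ENNReal.lt_add_right hfin.2 hε2
  conv_lhs at hg0 => rw [sobolevNorm]
  conv_lhs at hH0 => rw [forcingNorm]
  simp only [iInf_lt_iff] at hg0 hH0
  obtain ⟨g, hg, hgM⟩ := hg0
  obtain ⟨F, H, hUF, hHm, hFH, hHM⟩ := hH0
  have hgt := ne_top_of_lt hgM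
  have hHt := ne_top_of_lt hHM
  have hsum : eLpNorm g 2 volume + mixedNorm I p' p H ≤ M := by
    refine ((add_le_add hgM.le hHM.le).trans_eq ?_).trans hεM.le
    rw [add_add_add_comm, ← ENNReal.coe_add, add_halves]
  have hρ' : ENNReal.ofReal p'.toReal = p' := ENNReal.ofReal_toReal hpt'
  obtain ⟨ω, hω01, hω⟩ := exists_modulus (fun t => eLpNorm (H t) p volume) I hρ (by linarith) hκρ
    (by rw [hρ']; exact hHt)
  rw [hρ'] at hω
  -- The solution in the interaction picture, constant in time for a free solution.
  let Φ : ℝ → 𝓢(Space n, ℂ) →ₗ[ℂ] ℂ := fun t =>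
    ((𝓕 (U t) : 𝓢(Space n, ℂ) →L[ℂ] ℂ).comp (evolS t)).toLinearMap
  have hΦ : ∀ t ψ, Φ t ψ = 𝓕 (U t) (evolS t ψ) := fun t ψ => rfl
  have hnorm : ∀ ψ, ‖unweightLp hn1 hs ψ‖ = (eLpNorm (unweight s ψ) 2).toReal := fun ψ =>
    Lp.norm_toLp _ (memLp_unweight hn1 hs ψ)
  have hWt : ∀ ψ : 𝓢(Space n, ℂ), eLpNorm (unweight s ψ) 2 ≠ ∞ := fun ψ =>
    (memLp_unweight hn1 hs ψ).2.ne
  -- Duhamel, then Strichartz for the test wave and the modulus `ω` for the forcing on `[t, t']`.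
  have hinc : ∀ t ∈ I, ∀ t' ∈ I, t ≤ t' → ∀ ψ, ‖Φ t' ψ - Φ t ψ‖ ≤
      C₁ * (mixedNorm I p' p H).toReal * |ω t' - ω t| ^ κ * ‖unweightLp hn1 hs ψ‖ := by
    intro t ht t' ht' htt ψ
    have hsub : Icc t t' ⊆ I := hI.out ht ht'
    have h1 := hUF.enorm_evolS_sub_le (q := q) hn1 hs hHm hFH hqr.2.1 hr' hpt hpt' hHt htt hsub ψ
    have h2 := h1.trans (mul_le_mul' (hω t t' htt hsub)
      (hC₁ q r hqr hq _ (integrable_unweight hn1 hs ψ)))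
    have h3 := ENNReal.toReal_mono (ENNReal.mul_ne_top (ENNReal.mul_ne_top hHt ENNReal.ofReal_ne_top)
      (ENNReal.mul_ne_top ENNReal.coe_ne_top (hWt ψ))) h2
    rw [toReal_enorm, ENNReal.toReal_mul, ENNReal.toReal_mul, ENNReal.toReal_mul,
      ENNReal.toReal_ofReal (by positivity), ← hnorm, ENNReal.coe_toReal] at h3
    rw [hΦ, hΦ]
    refine h3.trans_eq ?_
    rw [mixedNorm]
    ring
  obtain ⟨π, hπ1, hπ2⟩ := hC₂ I t₀ Φ ω (eLpNorm g 2).toReal (C₁ * (mixedNorm I p' p H).toReal) ht₀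
    ENNReal.toReal_nonneg (by positivity) (fun t _ => hω01 t) (fun ψ => by
      have h2 := hg.enorm_fourier_evolS_le hn1 hs hgt t₀ ψ
      have h3 := ENNReal.toReal_mono (ENNReal.mul_ne_top hgt (hWt ψ)) h2
      rwa [toReal_enorm, ENNReal.toReal_mul, ← hnorm] at h3)
    (fun t ht t' ht' ψ => by
      rcases le_total t t' with h | h
      · have := hinc t ht t' ht' h ψ
        rwa [norm_sub_rev, abs_sub_comm] at this
      · exact hinc t' ht' t ht h ψ)
  choose f hf1 hf2 hf3 using fun i => exists_integral_representation (π i)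
  refine ⟨f, hf1, ?_, fun t ht φ => ?_⟩
  · simp only [hf2]
    refine hπ1.trans ?_
    rw [ENNReal.ofReal_mul C₁.coe_nonneg, ENNReal.ofReal_toReal hgt, ENNReal.ofReal_toReal hHt,
      ENNReal.ofReal_coe_nnreal]
    push_cast
    rw [mul_assoc, ← mul_pow]
    refine mul_le_mul' le_rfl (pow_le_pow_left' ?_ 2)
    refine le_trans ?_ (mul_le_mul' le_rfl hsum)
    rw [add_mul, one_mul, mul_add]
    exact add_le_add le_self_add le_add_self
  -- Evolving the test function backward undoes the interaction picture at time `t`.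
  · have := hπ2 t ht (evolS (-t) φ)
    rw [hΦ, ← evolS_add, add_neg_cancel, evolS_zero] at this
    refine this.trans_eq (tsum_congr fun i => ?_)
    congr 2
    exact hf3 i _ (memLp_unweight hn1 hs (evolS (-t) φ))

end Atoms

/-! ### Mollification and summation over pairs of free waves -/

section Mollification

open Filter Topology

variable {n : ℕ}

/-- The translate `y ↦ η (x - y)` of a normalised bump function. -/
theorem exists_schwartz_translate (η : ContDiffBump (0 : Space n)) :
    ∃ (R : 𝓢(Space n, ℂ)) (ψ : Space n → 𝓢(Space n, ℂ)),
      (∀ y, R y = (η.normed volume y : ℂ)) ∧ ∀ x y, ψ x y = (η.normed volume (x - y) : ℂ) := by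
  have h₁ : HasCompactSupport (η.normed volume) := η.hasCompactSupport_normed
  have h₂ : ContDiff ℝ ((⊤ : ℕ∞) : WithTop ℕ∞) (η.normed volume) := η.contDiff_normed
  have h₃ : HasCompactSupport (fun y => (η.normed volume y : ℂ)) :=
    h₁.comp_left (g := Complex.ofReal) (by simp)
  have h₄ : ContDiff ℝ ((⊤ : ℕ∞) : WithTop ℕ∞) (fun y => (η.normed volume y : ℂ)) :=
    Complex.ofRealCLM.contDiff.comp h₂
  refine ⟨h₃.toSchwartzMap h₄, fun x => HasCompactSupport.toSchwartzMap
    (f := fun y => (η.normed volume (x - y) : ℂ)) ?_ ?_, fun y => rfl, fun x y => rfl⟩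
  · exact h₃.comp_isClosedEmbedding (Homeomorph.subLeft x).isClosedEmbedding
  · exact h₄.comp (contDiff_const.sub contDiff_id)

theorem fourierInv_translate {R ψ : 𝓢(Space n, ℂ)} {x : Space n} (h : ∀ y, ψ y = R (x - y))
    (ξ : Space n) : (𝓕⁻ ψ) ξ = Complex.exp ((2 * Real.pi * inner ℝ x ξ : ℝ) * Complex.I) * (𝓕 R) ξ := by
  rw [SchwartzMap.fourierInv_coe, SchwartzMap.fourier_coe, Real.fourierInv_eq', Real.fourier_eq',
    ← integral_const_mul,
    ← integral_sub_left_eq_self (fun y => Complex.exp (↑(2 * Real.pi * inner ℝ y ξ) * Complex.I) • ψ y)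
      volume x]
  refine integral_congr_ae (Eventually.of_forall fun y => ?_)
  simp only [smul_eq_mul]
  rw [h, sub_sub_cancel, ← mul_assoc, ← Complex.exp_add, inner_sub_left]
  congr 2
  push_cast; ring

/-- The inverse transform of a translated mollifier is a modulation of a fixed profile, so testing
an atom against it evaluates a free wave. The modulation has the sign opposite to the Fourier
kernel, hence the point `-x`. -/
theorem integral_mul_unweight_translate {s t : ℝ} {R ψ : 𝓢(Space n, ℂ)} {x : Space n}
    (h : ∀ y, ψ y = R (x - y)) (p : Space n → ℂ) :
    ∫ ξ, p ξ * unweight s (evolS t (𝓕⁻ ψ)) ξ =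
      freeWave (fun ξ => p ξ * unweight s (𝓕 R : 𝓢(Space n, ℂ)) ξ) t (-x) := by
  rw [freeWave, Real.fourier_eq']
  refine integral_congr_ae (Eventually.of_forall fun ξ => ?_)
  simp only [unweight, evolS_apply, smul_eq_mul, fourierInv_translate h, inner_neg_right]
  rw [real_inner_comm]
  have : (-2 * Real.pi * -inner ℝ ξ x : ℝ) = 2 * Real.pi * inner ℝ ξ x := by ring
  rw [this]; ring

variable {I : Set ℝ} {U V : ℝ → 𝓢'(Space n, ℂ)} {u v : ℝ → Space n → ℂ}

/-- Away from the origin `|ξ|^(2s)` undoes the weight of `unweight`, and `|φ| ≤ 1`; the mollifier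
therefore costs nothing in the weighted norm. -/
theorem lintegral_mul_unweight_sq_le {s : ℝ} {φ : Space n → ℂ} (hφ : ∀ ξ, ‖φ ξ‖ ≤ 1)
    (p : Space n → ℂ) :
    ∫⁻ ξ, ‖p ξ * unweight s φ ξ‖ₑ ^ 2 * ENNReal.ofReal (‖ξ‖ ^ (2 * s)) ≤ eLpNorm p 2 ^ 2 := by
  rw [eLpNorm_two_sq]
  refine lintegral_mono fun ξ => ?_
  have h1 : ‖unweight s φ ξ‖ₑ ^ 2 * ENNReal.ofReal (‖ξ‖ ^ (2 * s)) ≤ 1 := by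
    rw [← ofReal_norm, ← ENNReal.ofReal_pow (norm_nonneg _), ← ENNReal.ofReal_mul (by positivity),
      ← ENNReal.ofReal_one]
    refine ENNReal.ofReal_le_ofReal ?_
    rw [norm_unweight, mul_pow, ← Real.rpow_natCast (‖ξ‖ ^ (-s)), ← Real.rpow_mul (norm_nonneg _)]
    have h2 : ‖ξ‖ ^ (-s * ((2 : ℕ) : ℝ)) * ‖ξ‖ ^ (2 * s) ≤ 1 := by
      rcases (norm_nonneg ξ).eq_or_lt with h0 | h0
      · rw [← h0]
        by_cases hs : s = 0
        · simp [hs]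
        · rw [Real.zero_rpow (x := 2 * s) (by simpa using hs), mul_zero]; exact zero_le_one
      · rw [← Real.rpow_add h0]
        have : -s * ((2 : ℕ) : ℝ) + 2 * s = 0 := by push_cast; ring
        rw [this, Real.rpow_zero]
    have h3 : ‖φ ξ‖ ^ 2 ≤ 1 := pow_le_one₀ (norm_nonneg _) (hφ ξ)
    calc _ = (‖ξ‖ ^ (-s * ((2 : ℕ) : ℝ)) * ‖ξ‖ ^ (2 * s)) * ‖φ ξ‖ ^ 2 := by ring
      _ ≤ 1 * 1 := by gcongr
      _ = 1 := one_mul 1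
  rw [enorm_mul, mul_pow, mul_assoc]
  exact mul_le_of_le_one_right zero_le h1

/-- The square sum over a family of products of free waves. -/
theorem lintegral_tsum_tsum_freeWave_le [Nontrivial (Space n)] {s₁ s₂ : ℝ} {C : ℝ≥0}
    (hαβ : -(2 * s₁) + -(2 * s₂) = 2 - Module.finrank ℝ (Space n))
    (hC : ∀ a : Space n, ∫⁻ θ : Metric.sphere (0 : Space n) 1,
      ENNReal.ofReal (‖a + θ‖ ^ (-(2 * s₁)) * ‖a - θ‖ ^ (-(2 * s₂)))
      ∂(volume : Measure (Space n)).toSphere ≤ C) {ι : Type*} [Countable ι]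
    {f g : ι → Space n → ℂ} (hf : ∀ i, Integrable (f i)) (hg : ∀ i, Integrable (g i)) :
    ∫⁻ z : ℝ × Space n, (∑' i, ‖freeWave (f i) (-z.1) (-z.2)‖ₑ ^ 2) *
        ∑' j, ‖freeWave (g j) (-z.1) (-z.2)‖ₑ ^ 2 ≤
      C * ((∑' i, ∫⁻ ξ, ‖f i ξ‖ₑ ^ 2 * ENNReal.ofReal (‖ξ‖ ^ (2 * s₁))) *
        ∑' j, ∫⁻ ξ, ‖g j ξ‖ₑ ^ 2 * ENNReal.ofReal (‖ξ‖ ^ (2 * s₂))) := by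
  have hfm : ∀ i, Measurable fun z : ℝ × Space n => freeWave (f i) z.1 z.2 := fun i =>
    measurable_freeWave (hf i).1
  have hgm : ∀ i, Measurable fun z : ℝ × Space n => freeWave (g i) z.1 z.2 := fun i =>
    measurable_freeWave (hg i).1
  -- The free waves are evaluated at `(-t, -x)`; reflecting space-time preserves the integral.
  have hneg : ∀ G : ℝ × Space n → ℝ≥0∞, ∫⁻ z : ℝ × Space n, G (-z) = ∫⁻ z, G z := fun G =>
    (((Measure.measurePreserving_neg (volume : Measure ℝ)).prod (Measure.measurePreserving_neg
      (volume : Measure (Space n)))).lintegral_comp_emb (MeasurableEquiv.neg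
        (ℝ × Space n)).measurableEmbedding G)
  have e := hneg fun z => (∑' i, ‖freeWave (f i) z.1 z.2‖ₑ ^ 2) *
        ∑' j, ‖freeWave (g j) z.1 z.2‖ₑ ^ 2
  refine e.trans_le ?_
  simp only [← ENNReal.tsum_mul_right, ← ENNReal.tsum_mul_left]
  rw [lintegral_tsum fun i => by
    refine (Measurable.tsum fun j => ?_).aemeasurable
    exact ((hfm j).enorm.pow_const 2).mul ((hgm i).enorm.pow_const 2)]
  refine ENNReal.tsum_le_tsum fun i => ?_
  rw [lintegral_tsum fun j => by
    exact (((hfm j).enorm.pow_const 2).mul ((hgm i).enorm.pow_const 2)).aemeasurable]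
  refine ENNReal.tsum_le_tsum fun j => ?_
  have := bilinear_freeWave hαβ hC (hf j) (hg i)
  simp only [neg_neg] at this
  refine le_trans (le_of_eq (lintegral_congr fun z => ?_)) this
  rw [enorm_mul, mul_pow]

/-- At almost every time `U t` is locally integrable, and its pairings with the translates are
convolutions with bumps whose inner and outer radii are comparable. Lebesgue differentiation gives
convergence almost everywhere. -/
theorem IsSlabFunction.exists_mollification (hu : IsSlabFunction I U u) (k : ℕ → ContDiffBump (0 : Space n))
    (hk : Tendsto (fun i => (k i).rOut) atTop (𝓝 0)) (hk2 : ∀ i, (k i).rOut ≤ 2 * (k i).rIn)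
    {ψ : ℕ → Space n → 𝓢(Space n, ℂ)}
    (hψ : ∀ i x y, ψ i x y = ((k i).normed volume (x - y) : ℂ)) :
    ∀ᵐ t ∂volume.restrict I, ∀ᵐ x : Space n, Tendsto (fun i => U t (ψ i x)) atTop (𝓝 (u t x)) := by
  filter_upwards [hu.represented] with t ht
  filter_upwards [ContDiffBump.ae_convolution_tendsto_right_of_locallyIntegrable hk
    (Eventually.of_forall hk2) ht.locallyIntegrable] with x hx
  refine hx.congr fun i => ?_
  rw [convolution_eq_swap, (ht _).2]
  refine integral_congr_ae (Eventually.of_forall fun y => ?_)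
  simp only [hψ, ContinuousLinearMap.lsmul_apply, Complex.real_smul]

/-- The domination holds on the Fourier side, so it is used for the inverse transform of the
translated mollifier. -/
theorem enorm_apply_le_of_atoms {s : ℝ} {R ψ : 𝓢(Space n, ℂ)} {x : Space n}
    (h : ∀ y, ψ y = R (x - y)) {p : ℕ × ℕ → Space n → ℂ} {t : ℝ}
    (hp : ∀ φ, ‖𝓕 (U t) φ‖ₑ ^ 2 ≤ ∑' i, ‖∫ ξ, p i ξ * unweight s (evolS (-t) φ) ξ‖ₑ ^ 2) :
    ‖U t ψ‖ₑ ^ 2 ≤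
      ∑' i, ‖freeWave (fun ξ => p i ξ * unweight s (𝓕 R : 𝓢(Space n, ℂ)) ξ) (-t) (-x)‖ₑ ^ 2 := by
  have := hp (𝓕⁻ ψ)
  rw [TemperedDistribution.fourier_apply, FourierTransform.fourier_fourierInv_eq] at this
  simpa only [integral_mul_unweight_translate h] using this

theorem norm_fourier_normed_le (η : ContDiffBump (0 : Space n)) {R : 𝓢(Space n, ℂ)}
    (hR : ∀ y, R y = (η.normed volume y : ℂ)) (ξ : Space n) : ‖(𝓕 R : 𝓢(Space n, ℂ)) ξ‖ ≤ 1 := by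
  rw [SchwartzMap.fourier_coe]
  refine (norm_fourier_le _ ξ).trans_eq ?_
  simp only [hR, Complex.norm_real, Real.norm_of_nonneg (η.nonneg_normed _)]
  exact η.integral_normed

/-- The bilinear estimate for distributions dominated by families of free waves. -/
theorem lintegral_mul_sq_le_of_atoms [Nontrivial (Space n)] (hn : 1 ≤ n) {s₁ s₂ : ℝ}
    (hs₁ : 2 * s₁ < n) (hs₂ : 2 * s₂ < n) {C : ℝ≥0}
    (hαβ : -(2 * s₁) + -(2 * s₂) = 2 - Module.finrank ℝ (Space n))
    (hC : ∀ a : Space n, ∫⁻ θ : Metric.sphere (0 : Space n) 1,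
      ENNReal.ofReal (‖a + θ‖ ^ (-(2 * s₁)) * ‖a - θ‖ ^ (-(2 * s₂)))
      ∂(volume : Measure (Space n)).toSphere ≤ C)
    (hu : IsSlabFunction I U u) (hv : IsSlabFunction I V v) {p π : ℕ × ℕ → Space n → ℂ}
    (hp : ∀ i, MemLp (p i) 2) (hπ : ∀ i, MemLp (π i) 2)
    (hpU : ∀ t ∈ I, ∀ φ, ‖𝓕 (U t) φ‖ₑ ^ 2 ≤
      ∑' i, ‖∫ ξ, p i ξ * unweight s₁ (evolS (-t) φ) ξ‖ₑ ^ 2)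
    (hπV : ∀ t ∈ I, ∀ φ, ‖𝓕 (V t) φ‖ₑ ^ 2 ≤
      ∑' i, ‖∫ ξ, π i ξ * unweight s₂ (evolS (-t) φ) ξ‖ₑ ^ 2) (hI : MeasurableSet I) :
    ∫⁻ t in I, (∫⁻ x, ‖u t x * v t x‖ₑ ^ 2) ≤
      C * ((∑' i, eLpNorm (p i) 2 ^ 2) * ∑' i, eLpNorm (π i) 2 ^ 2) := by
  let k : ℕ → ContDiffBump (0 : Space n) := fun i =>
    ⟨1 / (2 * (i + 1)), 1 / (i + 1), by positivity, by
      apply one_div_lt_one_div_of_lt <;> linarith [(Nat.cast_nonneg i : (0 : ℝ) ≤ i)]⟩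
  have hk : Tendsto (fun i => (k i).rOut) atTop (𝓝 0) := tendsto_one_div_add_atTop_nhds_zero_nat
  have hk2 : ∀ i, (k i).rOut ≤ 2 * (k i).rIn := fun i => by
    change 1 / ((i : ℝ) + 1) ≤ 2 * (1 / (2 * ((i : ℝ) + 1)))
    refine le_of_eq ?_
    field_simp
  choose R ψ hR hψ using fun i => exists_schwartz_translate (k i)
  clear_value k
  have hψR : ∀ i x y, ψ i x y = R i (x - y) := fun i x y => by rw [hψ, hR]
  set f : ℕ → ℕ × ℕ → Space n → ℂ := fun l i ξ =>
    p i ξ * unweight s₁ (𝓕 (R l) : 𝓢(Space n, ℂ)) ξ with hf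
  set g : ℕ → ℕ × ℕ → Space n → ℂ := fun l i ξ =>
    π i ξ * unweight s₂ (𝓕 (R l) : 𝓢(Space n, ℂ)) ξ with hg
  have hfi : ∀ l i, Integrable (f l i) := fun l i => (hp i).integrable_mul (memLp_unweight hn hs₁ _)
  have hgi : ∀ l i, Integrable (g l i) := fun l i => (hπ i).integrable_mul (memLp_unweight hn hs₂ _)
  have hfle : ∀ l i, ∫⁻ ξ, ‖f l i ξ‖ₑ ^ 2 * ENNReal.ofReal (‖ξ‖ ^ (2 * s₁)) ≤ eLpNorm (p i) 2 ^ 2 :=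
    fun l i => lintegral_mul_unweight_sq_le (norm_fourier_normed_le (k l) (hR l)) _
  have hgle : ∀ l i, ∫⁻ ξ, ‖g l i ξ‖ₑ ^ 2 * ENNReal.ofReal (‖ξ‖ ^ (2 * s₂)) ≤ eLpNorm (π i) 2 ^ 2 :=
    fun l i => lintegral_mul_unweight_sq_le (norm_fourier_normed_le (k l) (hR l)) _
  have hUf : ∀ l, ∀ t ∈ I, ∀ x, ‖U t (ψ l x)‖ₑ ^ 2 ≤ ∑' i, ‖freeWave (f l i) (-t) (-x)‖ₑ ^ 2 :=
    fun l t ht x => enorm_apply_le_of_atoms (hψR l x) (hpU t ht)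
  have hVg : ∀ l, ∀ t ∈ I, ∀ x, ‖V t (ψ l x)‖ₑ ^ 2 ≤ ∑' i, ‖freeWave (g l i) (-t) (-x)‖ₑ ^ 2 :=
    fun l t ht x => enorm_apply_le_of_atoms (hψR l x) (hπV t ht)
  clear_value f g
  set S : ℕ → ℝ × Space n → ℝ≥0∞ := fun l z => (∑' i, ‖freeWave (f l i) (-z.1) (-z.2)‖ₑ ^ 2) *
        ∑' j, ‖freeWave (g l j) (-z.1) (-z.2)‖ₑ ^ 2 with hS
  have hSm : ∀ l, Measurable (S l) := fun l => by
    refine Measurable.mul ?_ ?_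
    · exact Measurable.tsum fun i => ((measurable_freeWave (hfi l i).1).comp
        measurable_neg).enorm.pow_const 2
    · exact Measurable.tsum fun i => ((measurable_freeWave (hgi l i).1).comp
        measurable_neg).enorm.pow_const 2
  have hSle : ∀ l, ∫⁻ z, S l z ≤ C * ((∑' i, eLpNorm (p i) 2 ^ 2) * ∑' i, eLpNorm (π i) 2 ^ 2) :=
    fun l => (lintegral_tsum_tsum_freeWave_le hαβ hC (hfi l) (hgi l)).trans
      (mul_le_mul' le_rfl (mul_le_mul' (ENNReal.tsum_le_tsum (hfle l))
        (ENNReal.tsum_le_tsum (hgle l))))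
  have hliminf : Measurable fun z => liminf (fun l => S l z) atTop := Measurable.liminf hSm
  -- Only the mollified values are dominated by free waves, with a bound that depends on the scale
  -- `l`. The integrals of these bounds are uniform in `l`, which is all that Fatou's lemma needs.
  have hpt : ∀ᵐ t ∂volume.restrict I, ∀ᵐ x : Space n,
      ‖u t x * v t x‖ₑ ^ 2 ≤ liminf (fun l => S l (t, x)) atTop := by
    filter_upwards [hu.exists_mollification k hk hk2 hψ, hv.exists_mollification k hk hk2 hψ,
      ae_restrict_mem hI] with t hut hvt ht
    filter_upwards [hut, hvt] with x hux hvx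
    have hlim : Tendsto (fun l => ‖U t (ψ l x) * V t (ψ l x)‖ₑ ^ 2) atTop
        (𝓝 (‖u t x * v t x‖ₑ ^ 2)) := ENNReal.Tendsto.pow (hux.mul hvx).enorm
    rw [← hlim.liminf_eq]
    refine liminf_le_liminf (Eventually.of_forall fun l => ?_)
    change _ ≤ S l (t, x)
    rw [enorm_mul, mul_pow]
    exact mul_le_mul' (hUf l t ht x) (hVg l t ht x)
  calc ∫⁻ t in I, (∫⁻ x, ‖u t x * v t x‖ₑ ^ 2)
      ≤ ∫⁻ t in I, (∫⁻ x, liminf (fun l => S l (t, x)) atTop) := by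
        refine lintegral_mono_ae ?_
        filter_upwards [hpt] with t ht
        exact lintegral_mono_ae ht
    _ ≤ ∫⁻ t, (∫⁻ x, liminf (fun l => S l (t, x)) atTop) := setLIntegral_le_lintegral _ _
    _ = ∫⁻ z : ℝ × Space n, liminf (fun l => S l z) atTop :=
        (lintegral_prod _ hliminf.aemeasurable).symm
    _ ≤ liminf (fun l => ∫⁻ z, S l z) atTop := lintegral_liminf_le hSm
    _ ≤ _ := liminf_le_of_le (by isBoundedDefault) fun b hb => by
        obtain ⟨l, hl⟩ := hb.exists
        exact hl.trans (hSle l)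

end Mollification

/-! ### Vanishing norms and the passage to the infimum -/

section Conclusion

open Filter Topology

variable {n : ℕ}

theorem mixedNorm_two_sq (I : Set ℝ) (h : ℝ → Space n → ℂ) :
    mixedNorm I 2 2 h ^ 2 = ∫⁻ t in I, (∫⁻ x, ‖h t x‖ₑ ^ 2) := by
  have e := eLpNorm_nnreal_pow_eq_lintegral (μ := volume.restrict I)
    (f := fun t => eLpNorm (h t) 2 volume) (p := 2) (by norm_num)
  norm_num at e
  simp only [eLpNorm_two_sq] at e
  exact_mod_cast e

theorem RepresentedBy.ae_eq_zero {T : 𝓢'(Space n, ℂ)} {g : Space n → ℂ} (h : RepresentedBy T g)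
    (hT : ∀ φ, T φ = 0) : ∀ᵐ x, g x = 0 := by
  refine ae_eq_zero_of_integral_contDiff_smul_eq_zero h.locallyIntegrable fun f hf hfc => ?_
  have h₁ : HasCompactSupport (Complex.ofRealCLM ∘ f) := hfc.comp_left rfl
  have h₂ : ContDiff ℝ ((⊤ : ℕ∞) : WithTop ℕ∞) (Complex.ofRealCLM ∘ f) :=
    Complex.ofRealCLM.contDiff.comp hf
  have := (h (h₁.toSchwartzMap h₂)).2
  rw [hT] at this
  simpa using this.symm

/-- A distribution dominated by arbitrarily small families of free waves vanishes. -/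
theorem apply_eq_zero_of_atoms (hn : 1 ≤ n) {s : ℝ} (hs : 2 * s < n) {C : ℝ≥0} {t : ℝ}
    {T : 𝓢'(Space n, ℂ)}
    (h : ∀ M : ℝ≥0∞, 0 < M → ∃ p : ℕ × ℕ → Space n → ℂ, (∀ i, MemLp (p i) 2) ∧
      ∑' i, eLpNorm (p i) 2 ^ 2 ≤ C * M ^ 2 ∧
      ∀ φ, ‖𝓕 T φ‖ₑ ^ 2 ≤ ∑' i, ‖∫ ξ, p i ξ * unweight s (evolS t φ) ξ‖ₑ ^ 2)
    (φ : 𝓢(Space n, ℂ)) : T φ = 0 := by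
  set W := unweight s (evolS t (𝓕⁻ φ))
  have hW : MemLp W 2 := memLp_unweight hn hs _
  -- Cauchy–Schwarz on each atom; the factor `M²` can be made arbitrarily small while the test
  -- function stays fixed.
  have hle : ∀ M : ℝ≥0∞, 0 < M → ‖T φ‖ₑ ^ 2 ≤ C * M ^ 2 * eLpNorm W 2 ^ 2 := fun M hM => by
    obtain ⟨p, hp, hpM, hpT⟩ := h M hM
    have := hpT (𝓕⁻ φ)
    rw [TemperedDistribution.fourier_apply, FourierTransform.fourier_fourierInv_eq] at this
    refine this.trans ?_
    refine (ENNReal.tsum_le_tsum (g := fun i => eLpNorm (p i) 2 ^ 2 * eLpNorm W 2 ^ 2)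
      fun i => ?_).trans ?_
    · rw [← mul_pow]
      refine pow_le_pow_left' ?_ 2
      rw [mul_comm]
      exact enorm_integral_mul_le (hp i).1 hW.1 2 2
    · rw [ENNReal.tsum_mul_right]
      exact mul_le_mul' hpM le_rfl
  have hlim : Tendsto (fun k : ℕ => C * ((k : ℝ≥0∞)⁻¹) ^ 2 * eLpNorm W 2 ^ 2) atTop
      (𝓝 (C * 0 ^ 2 * eLpNorm W 2 ^ 2)) :=
    ENNReal.Tendsto.mul_const (ENNReal.Tendsto.const_mul
      (ENNReal.Tendsto.pow ENNReal.tendsto_inv_nat_nhds_zero) (Or.inr ENNReal.coe_ne_top))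
      (Or.inr (ENNReal.pow_ne_top hW.2.ne))
  have h0 : ‖T φ‖ₑ ^ 2 ≤ C * 0 ^ 2 * eLpNorm W 2 ^ 2 :=
    ge_of_tendsto' hlim fun k => hle _ (ENNReal.inv_pos.2 (ENNReal.natCast_ne_top k))
  simpa using h0

theorem mixedNorm_eq_zero {I : Set ℝ} {h : ℝ → Space n → ℂ}
    (hh : ∀ᵐ t ∂volume.restrict I, ∀ᵐ x, h t x = 0) : mixedNorm I 2 2 h = 0 := by
  rw [← pow_eq_zero_iff two_ne_zero, mixedNorm_two_sq]
  rw [lintegral_congr_ae (g := fun _ => 0), lintegral_zero]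
  filter_upwards [hh] with t ht
  rw [lintegral_congr_ae (g := fun _ => 0), lintegral_zero]
  filter_upwards [ht] with x hx
  simp [hx]

/-- Letting `M` and `M'` decrease to `A` and `B` fails for a product `0 · ∞`, so vanishing factors
are covered by the separate hypotheses `hA` and `hB`. When neither factor vanishes and one is
infinite, `K ≠ 0` makes the right-hand side infinite. -/
theorem le_mul_of_forall_gt {N A B : ℝ≥0∞} {K : ℝ≥0} (hK : K ≠ 0) (hA : A = 0 → N = 0)
    (hB : B = 0 → N = 0) (h : ∀ M M', A < M → B < M' → N ≤ K * M * M') : N ≤ K * A * B := by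
  by_cases hA0 : A = 0
  · rw [hA hA0]; exact zero_le
  by_cases hB0 : B = 0
  · rw [hB hB0]; exact zero_le
  have hK' : (K : ℝ≥0∞) ≠ 0 := by exact_mod_cast hK
  by_cases hAt : A = ∞
  · rw [hAt, ENNReal.mul_top hK', ENNReal.top_mul hB0]; exact le_top
  by_cases hBt : B = ∞
  · rw [hBt, ENNReal.mul_top (mul_ne_zero hK' hA0)]; exact le_top
  have hlim : ∀ X : ℝ≥0∞, Tendsto (fun k : ℕ => X + (k : ℝ≥0∞)⁻¹) atTop (𝓝 X) := fun X => by
    simpa using tendsto_const_nhds.add ENNReal.tendsto_inv_nat_nhds_zero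
  have hlim2 : Tendsto (fun k : ℕ => K * (A + (k : ℝ≥0∞)⁻¹) * (B + (k : ℝ≥0∞)⁻¹)) atTop
      (𝓝 (K * A * B)) :=
    ENNReal.Tendsto.mul (ENNReal.Tendsto.const_mul (hlim A) (Or.inr ENNReal.coe_ne_top))
      (Or.inr hBt) (hlim B) (Or.inr (ENNReal.mul_ne_top ENNReal.coe_ne_top hAt))
  exact ge_of_tendsto' hlim2 fun k => h _ _
    (ENNReal.lt_add_right hAt (ENNReal.inv_ne_zero.2 (ENNReal.natCast_ne_top k)))
    (ENNReal.lt_add_right hBt (ENNReal.inv_ne_zero.2 (ENNReal.natCast_ne_top k)))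

end Conclusion

end BilinearStrichartz

end

theorem lemma2p5 (n : ℕ) (hn : 2 ≤ n) (δ : ℝ) (hδ : 0 < δ) (hδn : δ < (n : ℝ) / 2)
    (q₀ : ℝ≥0∞) (hq₀ : 2 < q₀) :
    ∃ C : ℝ≥0, ∀ q₁ r₁ q₂ r₂ : ℝ≥0∞,
      BilinearStrichartz.Admissible n q₁ r₁ → BilinearStrichartz.Admissible n q₂ r₂ →
      q₀ ≤ q₁ → q₀ ≤ q₂ →
      ∀ I : Set ℝ, I.OrdConnected → ∀ t₀ ∈ I,
      ∀ (U V : ℝ → 𝓢'(BilinearStrichartz.Space n, ℂ))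
        (u v : ℝ → BilinearStrichartz.Space n → ℂ),
      BilinearStrichartz.IsSlabFunction I U u → BilinearStrichartz.IsSlabFunction I V v →
      BilinearStrichartz.mixedNorm I 2 2 (fun t x => u t x * v t x) ≤
        C * (BilinearStrichartz.sobolevNorm (-1 / 2 + δ) (U t₀) +
              BilinearStrichartz.forcingNorm I (-1 / 2 + δ)
                (ENNReal.conjExponent q₁) (ENNReal.conjExponent r₁) U) *
          (BilinearStrichartz.sobolevNorm (((n : ℝ) - 1) / 2 - δ) (V t₀) +
            BilinearStrichartz.forcingNorm I (((n : ℝ) - 1) / 2 - δ)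
              (ENNReal.conjExponent q₂) (ENNReal.conjExponent r₂) V) := by
  have hn1 : 1 ≤ n := by omega
  have hnR : (2 : ℝ) ≤ n := by exact_mod_cast hn
  have : Nonempty (Fin n) := ⟨⟨0, hn1⟩⟩
  have hs₁ : 2 * (-1 / 2 + δ) < n := by linarith
  have hs₂ : 2 * (((n : ℝ) - 1) / 2 - δ) < n := by linarith
  have hrank : Module.finrank ℝ (BilinearStrichartz.Space n) = n := by simp
  have hαβ : -(2 * (-1 / 2 + δ)) + -(2 * (((n : ℝ) - 1) / 2 - δ)) =
      2 - Module.finrank ℝ (BilinearStrichartz.Space n) := by rw [hrank]; ring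
  -- The exponents are `α = 1 - 2δ` and `β = -(n - 1) + 2δ`. The two lower bounds by `-(n - 1)`
  -- required of them are `δ < n/2` and `0 < δ`.
  obtain ⟨C₀, hC₀⟩ := BilinearStrichartz.exists_lintegral_sphere_mul_le
    (E := BilinearStrichartz.Space n) (by rw [hrank]; exact hn)
    (by rw [hrank]; linarith) (by rw [hrank]; linarith) hαβ
  obtain ⟨C₁, hC₁⟩ := BilinearStrichartz.exists_freeWave_atoms hn hq₀ hs₁
  obtain ⟨C₂, hC₂⟩ := BilinearStrichartz.exists_freeWave_atoms hn hq₀ hs₂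
  -- The squared estimate has the constant `x = C₀ * C₁ * C₂`, and `x ≤ (1 + x)²` avoids a square
  -- root; the summand `1` also makes the constant non-zero.
  refine ⟨1 + C₀ * C₁ * C₂, fun q₁ r₁ q₂ r₂ h₁ h₂ hq₁ hq₂ I hI t₀ ht₀ U V u v hu hv => ?_⟩
  refine BilinearStrichartz.le_mul_of_forall_gt (by positivity) (fun hA => ?_) (fun hB => ?_)
    fun M M' hM hM' => ?_
  -- If the factor of `u` is zero, every `M > 0` is admissible, so `U t` vanishes at every time in
  -- `I` and `u` is zero almost everywhere, whatever the factor of `v` is.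
  · refine BilinearStrichartz.mixedNorm_eq_zero ?_
    filter_upwards [hu.represented, MeasureTheory.ae_restrict_mem hI.measurableSet] with t ht htI
    filter_upwards [ht.ae_eq_zero (BilinearStrichartz.apply_eq_zero_of_atoms hn1 hs₁ (t := -t)
      fun M hM => by
        obtain ⟨p, hp, hpM, hpU⟩ := hC₁ q₁ r₁ h₁ hq₁ I hI t₀ ht₀ U M (by rwa [hA])
        exact ⟨p, hp, hpM, hpU t htI⟩)] with x hx
    rw [hx, zero_mul]
  · refine BilinearStrichartz.mixedNorm_eq_zero ?_
    filter_upwards [hv.represented, MeasureTheory.ae_restrict_mem hI.measurableSet] with t ht htI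
    filter_upwards [ht.ae_eq_zero (BilinearStrichartz.apply_eq_zero_of_atoms hn1 hs₂ (t := -t)
      fun M hM => by
        obtain ⟨p, hp, hpM, hpV⟩ := hC₂ q₂ r₂ h₂ hq₂ I hI t₀ ht₀ V M (by rwa [hB])
        exact ⟨p, hp, hpM, hpV t htI⟩)] with x hx
    rw [hx, mul_zero]
  · obtain ⟨p, hp, hpM, hpU⟩ := hC₁ q₁ r₁ h₁ hq₁ I hI t₀ ht₀ U M hM
    obtain ⟨π, hπ, hπM, hπV⟩ := hC₂ q₂ r₂ h₂ hq₂ I hI t₀ ht₀ V M' hM'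
    rw [← ENNReal.pow_le_pow_left_iff two_ne_zero, BilinearStrichartz.mixedNorm_two_sq]
    refine (BilinearStrichartz.lintegral_mul_sq_le_of_atoms hn1 hs₁ hs₂ hαβ hC₀ hu hv hp hπ hpU hπV
      hI.measurableSet).trans ?_
    calc (C₀ : ENNReal) * ((∑' i, MeasureTheory.eLpNorm (p i) 2 MeasureTheory.volume ^ 2) *
          ∑' i, MeasureTheory.eLpNorm (π i) 2 MeasureTheory.volume ^ 2)
        ≤ C₀ * ((C₁ * M ^ 2) * (C₂ * M' ^ 2)) := mul_le_mul' le_rfl (mul_le_mul' hpM hπM)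
      _ = ((C₀ * C₁ * C₂ : NNReal) : ENNReal) * (M * M') ^ 2 := by push_cast; ring
      _ ≤ ((1 + C₀ * C₁ * C₂ : NNReal) : ENNReal) ^ 2 * (M * M') ^ 2 := by
        refine mul_le_mul' ?_ le_rfl
        rw [← ENNReal.coe_pow]
        refine ENNReal.coe_le_coe.2 ?_
        have : 0 ≤ C₀ * C₁ * C₂ := zero_le
        nlinarith
      _ = _ := by rw [← mul_pow, ← mul_assoc]
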